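/- **Theorem (guaranteed a posteriori estimate with inexpensive evaluation on polytopal meshes).** *Meshes.* Let $d\ge 1$ and let $\Omega\subset\mathbb R^d$ be the interior of its closure (e.g. a bounded polytope with Lipschitz boundary). Let $\mathcal T_h$ be a conforming simplicial mesh of $\Omega$: finitely many nondegenerate closed $d$-simplices with union $\overline\Omega$, any two of which meet in the convex hull of their common vertices. Let $\mathcal T_H$ be a polytopal mesh of $\Omega$ of which $\mathcal T_h$ is a submesh: $\mathcal T_h$ is partitioned into nonempty sets $\mathcal T_K$, $K\in\mathcal T_H$, and $K=\bigcup_{\kappa\in\mathcal T_K}\kappa$ has connected interior (e.g. is a possibly nonconvex polytope homotopic to a ball with Lipschitz boundary). Let $\mathcal F_K^{\rm ext}$, resp. $\mathcal F_K^{\rm int}$, be the set of $(d-1)$-dimensional faces $\sigma$ of simplices of $\mathcal T_K$ with $\sigma\subset\partial K$, resp. $\sigma\not\subset\partial K$, and $\mathcal V_K$ the set of vertices of $\mathcal T_K$. The simplicial faces in $\bigcup_K\mathcal F_K^{\rm ext}$ are grouped into polytopal faces $F\in\mathcal F_H$; each $F$ lies in a hyperplane, lies entirely on $\partial K$ as soon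 as one of its simplicial faces does, has a constant unit normal $n_K$ pointing out of each such $K$, and has a fixed unit normal $n_F$ (exterior to $\Omega$ if $F\subset\partial\Omega$). $\mathcal F_K$ is the set of polytopal faces on $\partial K$. Each simplicial face has a fixed unit normal $n_\sigma$. *Problem.* Let $\mathbf K$ (symmetric positive definite) and $f$ be constant on each $K\in\mathcal T_H$, let $p\in H^1_0(\Omega)$ satisfy $(\mathbf K\nabla p,\nabla v)=(f,v)$ for all $v\in H^1_0(\Omega)$, where $H^1_0(\Omega)$ is the closure of $\mathcal D(\Omega)$ in $H^1(\Omega)$, and let $u=-\mathbf K\nabla p$. Put $\|v\|^2_{\mathbf K^{-1/2},\omega}=\int_\omega|\mathbf K^{-1/2}v|^2$ (with $\omega=\Omega$ when omitted) and $F_K=(f,1)_K$. *Scheme.* Let $(P_K)_{K\in\mathcal T_H}$ and $(U_F)_{F\in\mathcal F_H}$ be any real numbers such that $$\sum_{F\in\mathcal F_K}U_F\,n_K\cdot n_F=F_K\qquad\forall K\in\mathcal T_H .$$ (How $U$ depends on $P$ is irrelevant.) For a simplicial face $\sigma\subset F$ put $U_\sigma=U_F|\sigma|/|F|$. The element vector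 $U_K^{\rm ext}=(n_K\cdot n_F\,U_\sigma)_{\sigma\in\mathcal F_K^{\rm ext},\,\sigma\subset F}$ collects the fluxes oriented *out of* $K$. For a vertex $a$ of $\mathcal T_h$, let $Z_a=0$ if $a\in\partial\Omega$, and otherwise let $Z_a$ be the arithmetic mean of $P_K$ over the elements $K\in\mathcal T_H$ containing $a$ (so $Z_a=P_K$ if $a$ lies inside $K$). Put $Z_K=(Z_a)_{a\in\mathcal V_K}$ and $Z_K^{\rm ext}=\big(\tfrac1d\sum_{a\in\sigma\text{ vertex}}Z_a\big)_{\sigma\in\mathcal F_K^{\rm ext}}$. *Flux reconstruction.* On each $K\in\mathcal T_H$, $$u_h|_K=\arg\min\big\{\|v\|^2_{\mathbf K^{-1/2},K}:\ v\in RT_0(\mathcal T_K)\cap H(\mathrm{div},K),\ \nabla\!\cdot v=f|_K,\ \langle v\cdot n_F,1\rangle_\sigma=U_\sigma\ \ \forall\sigma\in\mathcal F_K^{\rm ext},\ \sigma\subset F\big\},$$ where $RT_0(\mathcal T_K)$ consists of the fields of the form $x\mapsto b_\kappa+c_\kappa x$ ($b_\kappa\in\mathbb R^d$, $c_\kappa\in\mathbb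 R$) on each $\kappa\in\mathcal T_K$. *Matrices.* For $\sigma\in\mathcal F_K^{\rm ext}\cup\mathcal F_K^{\rm int}$ let $v_\sigma$ be the field on $K$ equal to $\frac{s_{\kappa,\sigma}}{d|\kappa|}(x-a_{\kappa,\sigma})$ on the simplices $\kappa\in\mathcal T_K$ having the face $\sigma$ ($a_{\kappa,\sigma}$ the opposite vertex) and $0$ on the others, where $s_{\kappa,\sigma}=1$ if $\sigma\in\mathcal F_K^{\rm ext}$, and $s_{\kappa,\sigma}=n_\kappa\cdot n_\sigma=\pm1$, with $n_\kappa$ the outer normal of $\kappa$ on $\sigma$, if $\sigma\in\mathcal F_K^{\rm int}$. Let $(q_i)$ be any basis of the piecewise constants on $\mathcal T_K$ with zero mean on $K$. With $(A^{\bullet,\circ})_{\sigma,\sigma'}=(\mathbf K^{-1}v_{\sigma'},v_\sigma)_K$ for $\sigma\in\mathcal F_K^\bullet$, $\sigma'\in\mathcal F_K^\circ$, and $(B^{\circ})_{i,\sigma'}=-(\nabla\!\cdot v_{\sigma'},q_i)_K$ for $\sigma'\in\mathcal F_K^\circ$ ($\bullet,\circ\in\{\rm int,ext\}$), let $$\widehat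 A_{{\rm MFE},K}=A^{\rm ext,ext}-\begin{pmatrix}A^{\rm int,ext}\\B^{\rm ext}\end{pmatrix}^{t}\begin{pmatrix}A^{\rm int,int}&(B^{\rm int})^t\\B^{\rm int}&0\end{pmatrix}^{-1}\begin{pmatrix}A^{\rm int,ext}\\B^{\rm ext}\end{pmatrix},$$ and let $(\widehat S_{{\rm FE},K})_{a,a'}=(\mathbf K\nabla\psi_{a'},\nabla\psi_a)_K$, $(\widehat M_{{\rm FE},K})_{a,a'}=(\psi_{a'},\psi_a)_K$, $a,a'\in\mathcal V_K$, where $\psi_a$ are the piecewise affine hat functions of $\mathcal T_h$. Finally, put $$\eta_K^2=(U_K^{\rm ext})^t\widehat A_{{\rm MFE},K}U_K^{\rm ext}+Z_K^t\widehat S_{{\rm FE},K}Z_K+2(U_K^{\rm ext})^tZ_K^{\rm ext}-2F_K|K|^{-1}\mathbf 1^t\widehat M_{{\rm FE},K}Z_K .$$ *Conclusion.* For each $K\in\mathcal T_H$, the saddle-point matrix inverted above is invertible and $\eta_K^2\ge0$. The flux reconstruction $u_h$ exists and is unique, it belongs to $RT_0(\mathcal T_h)\cap H(\mathrm{div},\Omega)$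 with $\nabla\!\cdot u_h=f$, and $$\|u-u_h\|_{\mathbf K^{-1/2}}\le\Big\{\sum_{K\in\mathcal T_H}\eta_K^2\Big\}^{1/2}.$$ -/

import Mathlib

open MeasureTheory Filter Topology
open scoped ContDiff Classical

noncomputable section

namespace PolytopalDarcy

/-- The space `ℝ^d` with its Euclidean structure. -/
abbrev Pt (d : ℕ) := EuclideanSpace ℝ (Fin d)

/-- A simplex (or a face of a simplex), given by the set of its vertices. -/
abbrev Spx (d : ℕ) := Finset (Pt d)

/-- A finite collection of simplices. A polytopal element `K` is represented by its simplicial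
submesh `T_K`, and a polytopal face by the set of the simplicial faces that subdivide it. -/
abbrev Coll (d : ℕ) := Finset (Spx d)

variable {d : ℕ}

/-! ### Sobolev spaces -/

/-- `φ ∈ D(O)`: infinitely differentiable with compact support in `O`. -/
def IsTest (O : Set (Pt d)) (φ : Pt d → ℝ) : Prop :=
  ContDiff ℝ ∞ φ ∧ HasCompactSupport φ ∧ tsupport φ ⊆ O

/-- `v ∈ L²(O)` admits the weak gradient `g ∈ [L²(O)]^d`. -/
def HasWeakGrad (O : Set (Pt d)) (v : Pt d → ℝ) (g : Pt d → Pt d) : Prop :=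
  MemLp v 2 (volume.restrict O) ∧ MemLp g 2 (volume.restrict O) ∧
    ∀ φ : Pt d → ℝ, IsTest O φ → ∀ i : Fin d,
      ∫ x in O, v x * (gradient φ x) i = - ∫ x in O, (g x) i * φ x

/-- `v ∈ [L²(O)]^d` admits the weak divergence `w ∈ L²(O)`; thus `v ∈ H(div, O)`, `div v = w`. -/
def HasWeakDiv (O : Set (Pt d)) (v : Pt d → Pt d) (w : Pt d → ℝ) : Prop :=
  MemLp v 2 (volume.restrict O) ∧ MemLp w 2 (volume.restrict O) ∧
    ∀ φ : Pt d → ℝ, IsTest O φ →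
      ∫ x in O, inner ℝ (v x) (gradient φ x) = - ∫ x in O, w x * φ x

/-- `v ∈ H¹₀(O)` with weak gradient `g`, where `H¹₀(O)` is the closure of `D(O)` in `H¹(O)`. -/
def MemH10 (O : Set (Pt d)) (v : Pt d → ℝ) (g : Pt d → Pt d) : Prop :=
  HasWeakGrad O v g ∧ ∃ φ : ℕ → Pt d → ℝ, (∀ n, IsTest O (φ n)) ∧
    Tendsto (fun n => eLpNorm (fun x => φ n x - v x) 2 (volume.restrict O)) atTop (𝓝 0) ∧
    Tendsto (fun n => eLpNorm (fun x => gradient (φ n) x - g x) 2 (volume.restrict O))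
      atTop (𝓝 0)

/-! ### Geometry of a single simplex -/

/-- The closed simplex with the given vertices. -/
def hull (κ : Spx d) : Set (Pt d) := convexHull ℝ (κ : Set (Pt d))

/-- The Lebesgue measure `|κ|` of a `d`-simplex. -/
def vol (κ : Spx d) : ℝ := volume.real (hull κ)

/-- The `(d-1)`-dimensional Lebesgue (surface) measure `|σ|` of a simplicial face. -/
def area (σ : Spx d) : ℝ := (μHE[d - 1] : Measure (Pt d)).real (hull σ)

/-- The set `F_κ` of the `(d-1)`-dimensional faces of the `d`-simplex `κ`. -/
def facets (κ : Spx d) : Finset (Spx d) := κ.powersetCard d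

/-- The vertex of `κ` opposite to its face `σ` (the only element of `κ \ σ`). -/
def opp (κ σ : Spx d) : Pt d := ∑ a ∈ κ \ σ, a

/-- The barycentre of a `(d-1)`-dimensional face (which has `d` vertices). -/
def bary (σ : Spx d) : Pt d := (d : ℝ)⁻¹ • ∑ a ∈ σ, a

/-- The altitude vector of `κ` over its face `σ`: the component of `opp κ σ - bary σ` that is
orthogonal to `σ`. -/
def altitude (κ σ : Spx d) : Pt d :=
  (vectorSpan ℝ (σ : Set (Pt d)))ᗮ.starProjection (opp κ σ - bary σ)

/-- The unit normal vector to the face `σ` of `κ` pointing out of `κ`. -/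
def outNormal (κ σ : Spx d) : Pt d := -(‖altitude κ σ‖⁻¹ • altitude κ σ)

/-- The gradient of the barycentric coordinate of the vertex `a` in the simplex `κ`. -/
def hatGrad (κ : Spx d) (a : Pt d) : Pt d :=
  (‖altitude κ (κ.erase a)‖ ^ 2)⁻¹ • altitude κ (κ.erase a)

/-- The barycentric coordinate of the vertex `a` in the simplex `κ`: the affine function with value
`1` in `a` and `0` in the other vertices of `κ`. -/
def hat (κ : Spx d) (a x : Pt d) : ℝ := inner ℝ (hatGrad κ a) (x - bary (κ.erase a))

/-! ### Raviart--Thomas functions and piecewise functions -/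

/-- An element of `RT₀(κ) = [P₀(κ)]^d + x P₀(κ)`: the pair `(v, w)` stands for `x ↦ v + w x`. -/
abbrev RT (d : ℕ) := Pt d × ℝ

/-- Pointwise value of a Raviart--Thomas polynomial. -/
def rtEval (q : RT d) (x : Pt d) : Pt d := q.1 + q.2 • x

/-- The (constant) divergence of a Raviart--Thomas polynomial. -/
def rtDiv (q : RT d) : ℝ := d * q.2

/-- The piecewise function equal to `g κ` inside each simplex `κ` of `K`. -/
def pw {V : Type*} [AddCommMonoid V] (K : Coll d) (g : Spx d → Pt d → V) (x : Pt d) : V :=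
  ∑ κ ∈ K, (interior (hull κ)).indicator (g κ) x

/-- The function of `RT₀(K)` (broken space) whose restriction to each `κ ∈ K` is `v κ`. -/
def rtField (K : Coll d) (v : Spx d → RT d) : Pt d → Pt d := pw K fun κ => rtEval (v κ)

/-! ### Meshes -/

/-- The closed set covered by a collection of simplices. -/
def region (K : Coll d) : Set (Pt d) := ⋃ κ ∈ K, hull κ

/-- The simplicial faces of the submesh `K` lying on the boundary of the polytope `K`. -/
def extFacets (K : Coll d) : Finset (Spx d) :=
  (K.biUnion facets).filter fun σ => hull σ ⊆ frontier (region K)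

/-- The simplicial faces of the submesh `K` lying inside the polytope `K`. -/
def intFacets (K : Coll d) : Finset (Spx d) :=
  (K.biUnion facets).filter fun σ => ¬ hull σ ⊆ frontier (region K)

/-- The vertices of the simplices of `K`. -/
def vertices (K : Coll d) : Finset (Pt d) := K.biUnion id

/-- `T` is a conforming simplicial mesh of `Ω`: a finite collection of nondegenerate closed
`d`-simplices covering `closure Ω`, where any two meet in the (possibly empty) common face. -/
structure IsSimplicialMesh (Ω : Set (Pt d)) (T : Coll d) : Prop where
  card_eq : ∀ κ ∈ T, κ.card = d + 1
  affineIndependent : ∀ κ ∈ T, AffineIndependent ℝ ((↑) : κ → Pt d)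
  inter_eq : ∀ κ ∈ T, ∀ κ' ∈ T, hull κ ∩ hull κ' = hull (κ ∩ κ')
  cover : region T = closure Ω

/-- A polytopal mesh of `Ω` with a (virtual) simplicial submesh and fixed face normals.
An element `K` of the polytopal mesh is given by the simplices `T_K` of its simplicial submesh.
Elements may be nonconvex; instead of asking `K` to be homotopic to a ball with Lipschitz boundary,
only the weaker property that its interior is connected is asked. -/
structure PolytopalMesh (d : ℕ) (Ω : Set (Pt d)) where
  /-- the simplicial mesh `T_h` -/
  Th : Coll d
  isMesh : IsSimplicialMesh Ω Th
  /-- the polytopal mesh `T_H`, whose elements group the simplices of `T_h` -/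
  TH : Finpartition Th
  connected : ∀ K ∈ TH.parts, IsConnected (interior (region K))
  /-- the polytopal faces `F_H`, which group the simplicial faces lying on element boundaries -/
  FH : Finpartition (TH.parts.biUnion extFacets)
  /-- an element contains on its boundary a polytopal face either entirely or not at all -/
  face_entire : ∀ F ∈ FH.parts, ∀ K ∈ TH.parts, ∀ σ ∈ F, σ ∈ extFacets K → F ⊆ extFacets K
  /-- the fixed unit normal `n_F` of the polytopal face `F` -/
  normal : Coll d → Pt d
  normal_unit : ∀ F ∈ FH.parts, ‖normal F‖ = 1
  /-- `F` lies in a hyperplane orthogonal to `n_F` -/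
  normal_orthogonal : ∀ F ∈ FH.parts, ∀ σ ∈ F, ∀ τ ∈ F, ∀ a ∈ σ, ∀ b ∈ τ,
    inner ℝ (normal F) (a - b) = 0
  /-- the unit normal `n_K` to the face `F` of `K` pointing out of `K` -/
  cellNormal : Coll d → Coll d → Pt d
  cellNormal_eq : ∀ K ∈ TH.parts, ∀ F ∈ FH.parts, F ⊆ extFacets K →
    ∀ σ ∈ F, ∀ κ ∈ K, σ ∈ facets κ → cellNormal K F = outNormal κ σ
  /-- on the boundary of `Ω`, the fixed normal is the exterior one -/
  normal_boundary : ∀ K ∈ TH.parts, ∀ F ∈ FH.parts, F ⊆ extFacets K →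
    (∀ σ ∈ F, hull σ ⊆ frontier Ω) → normal F = cellNormal K F
  /-- a fixed unit normal of each face of the simplicial mesh -/
  simplexNormal : Spx d → Pt d
  simplexNormal_unit : ∀ σ ∈ Th.biUnion facets, ‖simplexNormal σ‖ = 1
  simplexNormal_orthogonal : ∀ σ ∈ Th.biUnion facets, ∀ a ∈ σ, ∀ b ∈ σ,
    inner ℝ (simplexNormal σ) (a - b) = 0

namespace PolytopalMesh

variable {Ω : Set (Pt d)} (M : PolytopalMesh d Ω)

/-- The polytopal elements (the set `T_H`). -/
def cells : Finset (Coll d) := M.TH.parts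

/-- The set `F_K` of the polytopal faces of the element `K`. -/
def cellFaces (K : Coll d) : Finset (Coll d) := M.FH.parts.filter fun F => F ⊆ extFacets K

/-- The function equal to the constant `c K` inside each polytopal element `K`. -/
def pwc {V : Type*} [AddCommMonoid V] (c : Coll d → V) (x : Pt d) : V :=
  ∑ K ∈ M.cells, (interior (region K)).indicator (fun _ => c K) x

/-! ### The continuous problem -/

/-- `∫_O A⁻¹ v · v = ‖A^{-1/2} v‖²_O` for a field `A` of symmetric positive definite matrices. -/
def energySq (O : Set (Pt d)) (A : Pt d → Matrix (Fin d) (Fin d) ℝ) (v : Pt d → Pt d) : ℝ :=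
  ∫ x in O, inner ℝ (Matrix.toEuclideanLin (A x)⁻¹ (v x)) (v x)

/-- The energy norm `‖v‖_{A^{-1/2}, O}`. -/
def energyNorm (O : Set (Pt d)) (A : Pt d → Matrix (Fin d) (Fin d) ℝ) (v : Pt d → Pt d) : ℝ :=
  Real.sqrt (energySq O A v)

/-- `p ∈ H¹₀(Ω)`, with weak gradient `g`, is the weak solution of `-div(D ∇p) = f` in `Ω`, `p = 0`
on `∂Ω`, where `D` and `f` are constant in each polytopal element. -/
def IsWeakSolution (D : Coll d → Matrix (Fin d) (Fin d) ℝ) (f : Coll d → ℝ)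
    (p : Pt d → ℝ) (g : Pt d → Pt d) : Prop :=
  MemH10 Ω p g ∧ ∀ v : Pt d → ℝ, ∀ w : Pt d → Pt d, MemH10 Ω v w →
    ∫ x in Ω, inner ℝ (Matrix.toEuclideanLin (M.pwc D x) (g x)) (w x) =
      ∫ x in Ω, M.pwc f x * v x

/-- The flux `u = -D ∇p`, where `g = ∇p`. -/
def darcyFlux (D : Coll d → Matrix (Fin d) (Fin d) ℝ) (g : Pt d → Pt d) (x : Pt d) : Pt d :=
  - Matrix.toEuclideanLin (M.pwc D x) (g x)

/-! ### The discretization and its face fluxes -/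

/-- The load `F_K = (f, 1)_K`. -/
def load (f : Coll d → ℝ) (K : Coll d) : ℝ := ∫ x in region K, M.pwc f x

/-- The discrete flux balance `∑_{F ∈ F_K} U_F n_K · n_F = F_K` for all elements `K`. -/
def FluxBalance (f : Coll d → ℝ) (U : Coll d → ℝ) : Prop :=
  ∀ K ∈ M.cells,
    ∑ F ∈ M.cellFaces K, U F * inner ℝ (M.cellNormal K F) (M.normal F) = M.load f K

/-- The flux `U_σ = (U_F / |F|) |σ|` of a simplicial face `σ` contained in the polytopal face
`F = M.FH.part σ`, in the direction of `n_F`. -/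
def subFlux (U : Coll d → ℝ) (σ : Spx d) : ℝ :=
  U (M.FH.part σ) / (∑ τ ∈ M.FH.part σ, area τ) * area σ

/-- The element vector `U_K^ext` of the face fluxes, oriented out of `K`. -/
def extFlux (U : Coll d → ℝ) (K : Coll d) (σ : extFacets K) : ℝ :=
  inner ℝ (M.cellNormal K (M.FH.part σ)) (M.normal (M.FH.part σ)) * M.subFlux U σ

/-- `v` restricted to `K` is in `RT₀(T_K) ∩ H(div, K)`, has the prescribed fluxes `U_σ` through the
simplicial faces on the boundary of `K`, and has the divergence equal to the constant `c`. -/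
def IsAdmissible (U : Coll d → ℝ) (K : Coll d) (c : ℝ) (v : Spx d → RT d) : Prop :=
  HasWeakDiv (interior (region K)) (rtField K v) (fun _ => c) ∧
    ∀ κ ∈ K, ∀ σ ∈ facets κ, σ ∈ extFacets K →
      ∫ x in hull σ, inner ℝ (rtEval (v κ) x) (M.normal (M.FH.part σ)) ∂μHE[d - 1] =
        M.subFlux U σ

/-- The flux reconstruction `u_h`: in each element `K`, it minimizes the energy
`‖v‖²_{D^{-1/2}, K}` among `v ∈ RT₀(T_K) ∩ H(div, K)` with the prescribed boundary face fluxes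
and `div v = f|_K`. -/
def IsFluxReconstruction (D : Coll d → Matrix (Fin d) (Fin d) ℝ) (f : Coll d → ℝ)
    (U : Coll d → ℝ) (uh : Spx d → RT d) : Prop :=
  ∀ K ∈ M.cells, M.IsAdmissible U K (f K) uh ∧
    ∀ v : Spx d → RT d, M.IsAdmissible U K (f K) v →
      energySq (region K) (fun _ => D K) (rtField K uh) ≤
        energySq (region K) (fun _ => D K) (rtField K v)

/-! ### The mixed finite element matrix -/

/-- The basis function `v_σ` of `RT₀(T_K) ∩ H(div, K)` associated with the simplicial face `σ` of
`T_K`: equal to `± (x - a_{κ,σ}) / (d |κ|)` on the simplices `κ` having `σ` as a face and `0` on the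
others. It has unit normal flux through `σ`, in the outward direction if `σ` lies on the boundary
of `K` and in the direction of the fixed normal of `σ` if `σ` lies inside `K`. -/
def rtBasis (K : Coll d) (σ κ : Spx d) : RT d :=
  if σ ∈ facets κ then
    ((if σ ∈ extFacets K then 1 else inner ℝ (outNormal κ σ) (M.simplexNormal σ)) /
      (d * vol κ)) • ((-opp κ σ, 1) : RT d)
  else 0

/-- `(A_K)_{σ,τ} = (D⁻¹ v_τ, v_σ)_K`, rows indexed by `S` and columns by `S'`. -/
def matA (DK : Matrix (Fin d) (Fin d) ℝ) (K : Coll d) (S S' : Finset (Spx d)) : Matrix S S' ℝ :=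
  Matrix.of fun σ τ => ∫ x in region K,
    inner ℝ (Matrix.toEuclideanLin DK⁻¹ (rtField K (M.rtBasis K τ) x))
      (rtField K (M.rtBasis K σ) x)

end PolytopalMesh

/-- The space `Q_{h,0}^K` of piecewise constants on `T_K` with mean value zero on `K`; a piecewise
constant is given by its values on the simplices. -/
def Q0 (K : Coll d) : Submodule ℝ (K → ℝ) :=
  LinearMap.ker (∑ κ : K, vol (κ : Spx d) • (LinearMap.proj κ : (K → ℝ) →ₗ[ℝ] ℝ))

namespace PolytopalMesh

variable {Ω : Set (Pt d)} (M : PolytopalMesh d Ω)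

/-- `(B_K)_{i,σ} = -(div v_σ, q_i)_K`, with columns indexed by `S`. -/
def matB {n : ℕ} (K : Coll d) (q : Module.Basis (Fin n) ℝ (Q0 K)) (S : Finset (Spx d)) :
    Matrix (Fin n) S ℝ :=
  Matrix.of fun i σ => - ∑ κ : K, vol (κ : Spx d) * rtDiv (M.rtBasis K σ κ) * (q i : K → ℝ) κ

/-- The saddle-point matrix of the local mixed finite element problem. -/
def saddle {n : ℕ} (DK : Matrix (Fin d) (Fin d) ℝ) (K : Coll d)
    (q : Module.Basis (Fin n) ℝ (Q0 K)) :
    Matrix (intFacets K ⊕ Fin n) (intFacets K ⊕ Fin n) ℝ :=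
  Matrix.fromBlocks (M.matA DK K (intFacets K) (intFacets K))
    (M.matB K q (intFacets K)).transpose (M.matB K q (intFacets K)) 0

/-- The stacked matrix with the blocks `A^{int,ext}` and `B^{0,ext}`. -/
def coupling {n : ℕ} (DK : Matrix (Fin d) (Fin d) ℝ) (K : Coll d)
    (q : Module.Basis (Fin n) ℝ (Q0 K)) :
    Matrix (intFacets K ⊕ Fin n) (extFacets K) ℝ :=
  Matrix.fromRows (M.matA DK K (intFacets K) (extFacets K)) (M.matB K q (extFacets K))

/-- The element matrix `Â_{MFE,K}` of the mixed finite element method (a Schur complement). -/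
def matMFE {n : ℕ} (DK : Matrix (Fin d) (Fin d) ℝ) (K : Coll d)
    (q : Module.Basis (Fin n) ℝ (Q0 K)) : Matrix (extFacets K) (extFacets K) ℝ :=
  M.matA DK K (extFacets K) (extFacets K) -
    (M.coupling DK K q).transpose * (M.saddle DK K q)⁻¹ * M.coupling DK K q

end PolytopalMesh

/-! ### The finite element matrices -/

/-- The restriction to `K` of the hat function `ψ_a`. -/
def psi (K : Coll d) (a : Pt d) : Pt d → ℝ := pw K fun κ x => if a ∈ κ then hat κ a x else 0

/-- The restriction to `K` of the gradient of the hat function `ψ_a`. -/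
def psiGrad (K : Coll d) (a : Pt d) : Pt d → Pt d :=
  pw K fun κ _ => if a ∈ κ then hatGrad κ a else 0

/-- The element stiffness matrix `(D ∇ψ_b, ∇ψ_a)_K`. -/
def matStiff (DK : Matrix (Fin d) (Fin d) ℝ) (K : Coll d) :
    Matrix (vertices K) (vertices K) ℝ :=
  Matrix.of fun a b => ∫ x in region K,
    inner ℝ (Matrix.toEuclideanLin DK (psiGrad K b x)) (psiGrad K a x)

/-- The element mass matrix `(ψ_b, ψ_a)_K`. -/
def matMass (K : Coll d) : Matrix (vertices K) (vertices K) ℝ :=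
  Matrix.of fun a b => ∫ x in region K, psi K b x * psi K a x

namespace PolytopalMesh

variable {Ω : Set (Pt d)} (M : PolytopalMesh d Ω)

/-! ### Potential point values and the estimators -/

/-- The point value `Z_a`: zero on the boundary of `Ω`, and otherwise the average of the values
`P_K` over the polytopal elements `K` containing the vertex `a` (if `a` lies inside some element
`K`, this is the only one and `Z_a = P_K`). -/
def pointValue (P : Coll d → ℝ) (a : Pt d) : ℝ :=
  if a ∈ frontier Ω then 0
  else ((M.cells.filter fun K => a ∈ region K).card : ℝ)⁻¹ *
    ∑ K ∈ M.cells.filter (fun K => a ∈ region K), P K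

/-- The element vector `Z_K` of the values in the vertices of `T_K`. -/
def vertexVec (P : Coll d → ℝ) (K : Coll d) (a : vertices K) : ℝ := M.pointValue P a

/-- The element vector `Z_K^ext` of the values `Z_σ = (1/d) ∑_{a ∈ V_σ} Z_a` on the simplicial faces
on the boundary of `K`. -/
def faceVec (P : Coll d → ℝ) (K : Coll d) (σ : extFacets K) : ℝ :=
  (d : ℝ)⁻¹ * ∑ a ∈ (σ : Spx d), M.pointValue P a

/-- The squared element estimator `η_K²`. -/
def etaSq {n : ℕ} (D : Coll d → Matrix (Fin d) (Fin d) ℝ) (f : Coll d → ℝ)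
    (U P : Coll d → ℝ) (K : Coll d) (q : Module.Basis (Fin n) ℝ (Q0 K)) : ℝ :=
  M.extFlux U K ⬝ᵥ (M.matMFE (D K) K q).mulVec (M.extFlux U K)
    + M.vertexVec P K ⬝ᵥ (matStiff (D K) K).mulVec (M.vertexVec P K)
    + 2 * (M.extFlux U K ⬝ᵥ M.faceVec P K)
    - 2 * M.load f K * (volume.real (region K))⁻¹ *
        ((fun _ => 1) ⬝ᵥ (matMass K).mulVec (M.vertexVec P K))

end PolytopalMesh

end PolytopalDarcy

end

noncomputable section

namespace PolytopalDarcy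

variable {d : ℕ}

/-! ### Barycentric coordinates of a nondegenerate simplex -/

/-! The estimate is the Prager–Synge inequality. Let `s` be the continuous piecewise affine function
with vertex values `Z_a`; it lies in `H¹₀(Ω)` since `Z` vanishes on the boundary. Both `u` and `u_h`
have divergence `f`, so `u - u_h` is orthogonal to the gradient of every `H¹₀` function. Expanding
`u_h + K∇s = K∇(s - p) - (u - u_h)` in the energy norm then loses its cross term, and the energy of
`u - u_h` is at most that of `u_h + K∇s` (`energySq_sub_le`).

It remains to see that `η_K²` is the energy of `u_h + K∇s` on `K` (`etaSq_eq`); this also gives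
`η_K² ≥ 0`. The energy of `s` is the stiffness term. The cross term `2(u_h, ∇s)_K` is integrated by
parts: the boundary part pairs exterior fluxes with face means of `s`, and the volume part is `f|_K`
times the integral of `s`, obtained from the mass matrix. The energy of `u_h` is the Schur
complement term: admissible fields are parametrized by their interior face fluxes, and the minimizer
solves the saddle-point system (`exists_saddle_solution`, `exists_local_minimizer`).

That system is invertible because the energy form is definite and `(B^int)ᵗ` is injective. A
piecewise constant in the kernel has equal values across each interior face; connectedness of the
interior of `K` makes it constant (`eq_of_closed_under_adjacency`), and zero mean makes it vanish.

The link with weak divergences is `isAdmissible_iff`: a broken Raviart–Thomas field has weak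
divergence `c` on `K` exactly when its elementwise divergences equal `c` and its interior jumps
vanish. One direction is elementwise integration by parts; the other tests with bubbles of simplices
and faces. The bubbles are only Lipschitz and need not have compact support in the open set, so
`memH10_of_lipschitz` places them in `H¹₀` by truncation and mollification.

Traces are handled by volume integrals. The face mean of `φ` is encoded by the integral of `div((x -
a) φ)` over the simplex, `a` being the opposite vertex; `integral_trace_eq_zero` shows that it
depends only on `φ` on the face, and `traceMean_eq_of_common_facet` that it is the same from both
sides. Surface measure enters only through `area_mul_norm_altitude`, which relates prescribed
surface fluxes to the algebraic `flux`. -/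

/-- A nondegenerate `d`-simplex in dimension `d ≥ 1`. -/
structure IsSimplex (κ : Spx d) : Prop where
  one_le : 1 ≤ d
  card_eq : κ.card = d + 1
  affineIndependent : AffineIndependent ℝ ((↑) : κ → Pt d)

lemma hat_sub_hat (κ : Spx d) (a x y : Pt d) :
    hat κ a x - hat κ a y = inner ℝ (hatGrad κ a) (x - y) := by
  simp only [hat, ← inner_sub_right]
  congr 1
  abel

lemma hat_eq_add (κ : Spx d) (a x y : Pt d) :
    hat κ a x = hat κ a y + inner ℝ (hatGrad κ a) (x - y) := by
  rw [← hat_sub_hat]; ring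

lemma mem_facets {κ σ : Spx d} (hκ : κ.card = d + 1) :
    σ ∈ facets κ ↔ ∃ a ∈ κ, σ = κ.erase a := by
  rw [facets, Finset.mem_powersetCard]
  constructor
  · rintro ⟨hs, hc⟩
    have h1 : (κ \ σ).card = 1 := by rw [Finset.card_sdiff_of_subset hs]; omega
    obtain ⟨a, ha⟩ := Finset.card_eq_one.mp h1
    have ha' : a ∈ κ \ σ := by rw [ha]; simp
    refine ⟨a, (Finset.mem_sdiff.mp ha').1, ?_⟩
    rw [Finset.erase_eq, ← ha, Finset.sdiff_sdiff_eq_self hs]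
  · rintro ⟨a, ha, rfl⟩
    exact ⟨Finset.erase_subset _ _, by rw [Finset.card_erase_of_mem ha]; omega⟩

lemma opp_erase {κ : Spx d} {a : Pt d} (ha : a ∈ κ) : opp κ (κ.erase a) = a := by
  have : κ \ κ.erase a = {a} := by
    ext x; simp only [Finset.mem_sdiff, Finset.mem_erase, Finset.mem_singleton]
    constructor
    · rintro ⟨h1, h2⟩; by_contra h; exact h2 ⟨h, h1⟩
    · rintro rfl; exact ⟨ha, by simp⟩
  simp [opp, this]

lemma sub_bary_mem {σ : Spx d} (hσ : σ.card = d) {b : Pt d} (hb : b ∈ σ) :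
    b - bary σ ∈ vectorSpan ℝ (σ : Set (Pt d)) := by
  have hd : (d : ℝ) ≠ 0 := by
    have : σ.card ≠ 0 := Finset.card_ne_zero_of_mem hb
    rw [hσ] at this; exact_mod_cast this
  have : b - bary σ = (d : ℝ)⁻¹ • ∑ c ∈ σ, (b - c) := by
    rw [Finset.sum_sub_distrib, Finset.sum_const, hσ, bary, smul_sub, ← Nat.cast_smul_eq_nsmul ℝ,
      smul_smul, inv_mul_cancel₀ hd, one_smul]
  rw [this]
  exact Submodule.smul_mem _ _ (Submodule.sum_mem _ fun c hc =>
    vsub_mem_vectorSpan ℝ (Finset.mem_coe.2 hb) (Finset.mem_coe.2 hc))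

namespace IsSimplex

variable {κ : Spx d} (h : IsSimplex κ)

include h

lemma natCast_pos : (0 : ℝ) < d := by exact_mod_cast h.one_le

lemma card_erase {a : Pt d} (ha : a ∈ κ) : (κ.erase a).card = d := by
  rw [Finset.card_erase_of_mem ha, h.card_eq]; omega

lemma erase_nonempty {a : Pt d} (ha : a ∈ κ) : (κ.erase a).Nonempty := by
  rw [← Finset.card_pos, h.card_erase ha]; exact h.one_le

/-- The vertices of a simplex, as an affine basis. -/
def basis : AffineBasis κ ℝ (Pt d) where
  toFun := (↑)
  ind' := h.affineIndependent
  tot' := by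
    rw [h.affineIndependent.affineSpan_eq_top_iff_card_eq_finrank_add_one]
    simp [h.card_eq]

/-- By affine independence the apex is outside the affine span of the opposite face. This is what
makes the altitude nonzero and the normalization in `hatGrad` legitimate. -/
lemma sub_bary_notMem {a : Pt d} (ha : a ∈ κ) :
    a - bary (κ.erase a) ∉ vectorSpan ℝ ((κ.erase a : Spx d) : Set (Pt d)) := by
  intro hmem
  obtain ⟨b, hb⟩ := h.erase_nonempty ha
  have h2 : a - b ∈ vectorSpan ℝ ((κ.erase a : Spx d) : Set (Pt d)) := by
    have := Submodule.sub_mem _ hmem (sub_bary_mem (h.card_erase ha) hb)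
    simpa using this
  have h3 : a ∈ affineSpan ℝ ((κ.erase a : Spx d) : Set (Pt d)) := by
    rw [← direction_affineSpan] at h2
    have := AffineSubspace.vadd_mem_of_mem_direction h2 (subset_affineSpan ℝ _ (Finset.mem_coe.2 hb))
    simpa using this
  have h4 := h.affineIndependent.notMem_affineSpan_sdiff ⟨a, ha⟩ Set.univ
  apply h4
  convert h3 using 2
  ext x
  simp only [Set.mem_image, Set.mem_sdiff, Set.mem_univ, Set.mem_singleton_iff, true_and,
    Finset.coe_erase, Finset.mem_coe]
  constructor
  · rintro ⟨⟨y, hy⟩, hne, rfl⟩; exact ⟨hy, fun e => hne (Subtype.ext e)⟩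
  · rintro ⟨hx, hne⟩; exact ⟨⟨x, hx⟩, fun e => hne (congrArg Subtype.val e), rfl⟩

lemma altitude_ne_zero {a : Pt d} (ha : a ∈ κ) : altitude κ (κ.erase a) ≠ 0 := by
  intro h0
  rw [altitude, opp_erase ha, Submodule.starProjection_apply, Submodule.coe_eq_zero,
    Submodule.orthogonalProjectionOnto_eq_zero_iff, Submodule.orthogonal_orthogonal] at h0
  exact h.sub_bary_notMem ha h0

-- An orthogonal projection is idempotent and self-adjoint, so the inner product of `Pv` with `v` is
-- the squared norm of `Pv`. Division by this square gives the coordinate the value `1` at the apex.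
omit h in
lemma inner_altitude {a : Pt d} (ha : a ∈ κ) :
    inner ℝ (altitude κ (κ.erase a)) (a - bary (κ.erase a)) = ‖altitude κ (κ.erase a)‖ ^ 2 := by
  rw [altitude, opp_erase ha]
  set W := (vectorSpan ℝ ((κ.erase a : Spx d) : Set (Pt d)))ᗮ
  rw [← real_inner_self_eq_norm_sq, ← Submodule.inner_starProjection_left_eq_right]
  congr 1
  exact (W.starProjection_eq_self_iff.2 (W.starProjection_apply_mem _)).symm

omit h in
lemma inner_altitude_of_mem {a v : Pt d}
    (hv : v ∈ vectorSpan ℝ ((κ.erase a : Spx d) : Set (Pt d))) :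
    inner ℝ (altitude κ (κ.erase a)) v = 0 := by
  have : altitude κ (κ.erase a) ∈ (vectorSpan ℝ ((κ.erase a : Spx d) : Set (Pt d)))ᗮ :=
    Submodule.starProjection_apply_mem _ _
  rw [real_inner_comm]
  exact (Submodule.mem_orthogonal _ _).1 this v hv

lemma hat_self {a : Pt d} (ha : a ∈ κ) : hat κ a a = 1 := by
  have := h.altitude_ne_zero ha
  rw [hat, hatGrad, real_inner_smul_left, inner_altitude ha, inv_mul_cancel₀]
  simpa using this

lemma hat_of_ne {a b : Pt d} (ha : a ∈ κ) (hb : b ∈ κ) (hab : b ≠ a) : hat κ a b = 0 := by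
  rw [hat, hatGrad, real_inner_smul_left, inner_altitude_of_mem, mul_zero]
  exact sub_bary_mem (h.card_erase ha) (Finset.mem_erase.2 ⟨hab, hb⟩)

omit h in
lemma hat_sum (s : Finset (Pt d)) (w : Pt d → ℝ) (hw : ∑ i ∈ s, w i = 1) (a : Pt d) :
    hat κ a (∑ i ∈ s, w i • i) = ∑ i ∈ s, w i * hat κ a i := by
  have : (∑ i ∈ s, w i • i) - bary (κ.erase a) = ∑ i ∈ s, w i • (i - bary (κ.erase a)) := by
    simp only [smul_sub, Finset.sum_sub_distrib, ← Finset.sum_smul, hw, one_smul]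
  simp only [hat, this, inner_sum, real_inner_smul_right]

lemma hat_combo {w : Pt d → ℝ} (hw : ∑ i ∈ κ, w i = 1) {a : Pt d} (ha : a ∈ κ) :
    hat κ a (∑ i ∈ κ, w i • i) = w a := by
  rw [hat_sum _ _ hw, Finset.sum_eq_single a]
  · rw [h.hat_self ha, mul_one]
  · intro b hb hne; rw [h.hat_of_ne ha hb hne, mul_zero]
  · exact fun hn => absurd ha hn

/-- Both sides are affine with the same vertex values. The identification imports the descriptions
of the hull and of its interior by signs of affine coordinates. -/
lemma hat_eq_coord {a : Pt d} (ha : a ∈ κ) (x : Pt d) : hat κ a x = h.basis.coord ⟨a, ha⟩ x := by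
  set w : Pt d → ℝ := fun i => if hi : i ∈ κ then h.basis.coord ⟨i, hi⟩ x else 0
  have h1 : ∑ i ∈ κ, w i = 1 := by
    rw [← h.basis.sum_coord_apply_eq_one x, ← Finset.sum_coe_sort κ]
    exact Finset.sum_congr rfl fun i _ => by simp [w]
  have h2 : ∑ i ∈ κ, w i • i = x := by
    conv_rhs => rw [← h.basis.linear_combination_coord_eq_self x]
    rw [← Finset.sum_coe_sort κ]
    refine Finset.sum_congr rfl fun i _ => ?_
    simp only [w, dif_pos i.2]
    rfl
  have h3 := h.hat_combo h1 ha
  rw [h2] at h3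
  rw [h3]
  simp only [w, dif_pos ha]

lemma sum_hat (x : Pt d) : ∑ a ∈ κ, hat κ a x = 1 := by
  rw [← h.basis.sum_coord_apply_eq_one x, ← Finset.sum_coe_sort κ]
  exact Finset.sum_congr rfl fun i _ => h.hat_eq_coord i.2 x

lemma sum_hat_smul (x : Pt d) : ∑ a ∈ κ, hat κ a x • a = x := by
  conv_rhs => rw [← h.basis.linear_combination_coord_eq_self x]
  rw [← Finset.sum_coe_sort κ]
  exact Finset.sum_congr rfl fun i _ => by rw [h.hat_eq_coord i.2 x]; rfl

omit h in
lemma range_coe : Set.range ((↑) : κ → Pt d) = (κ : Set (Pt d)) := by simp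

lemma mem_hull {x : Pt d} : x ∈ hull κ ↔ ∀ a ∈ κ, 0 ≤ hat κ a x := by
  have := h.basis.convexHull_eq_nonneg_coord
  rw [show Set.range h.basis = (κ : Set (Pt d)) from range_coe] at this
  rw [hull, this]
  simp only [Set.mem_ofPred_eq, Subtype.forall]
  exact forall₂_congr fun a ha => by rw [h.hat_eq_coord ha]

lemma mem_interior_hull {x : Pt d} : x ∈ interior (hull κ) ↔ ∀ a ∈ κ, 0 < hat κ a x := by
  have := h.basis.interior_convexHull
  rw [show Set.range h.basis = (κ : Set (Pt d)) from range_coe] at this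
  rw [hull, this]
  simp only [Set.mem_ofPred_eq, Subtype.forall]
  exact forall₂_congr fun a ha => by rw [h.hat_eq_coord ha]

lemma ext_hat {x y : Pt d} (hxy : ∀ a ∈ κ, hat κ a x = hat κ a y) : x = y := by
  rw [← h.sum_hat_smul x, ← h.sum_hat_smul y]
  exact Finset.sum_congr rfl fun a ha => by rw [hxy a ha]

/-- A face is cut out of the simplex by the vanishing of the coordinates of the missing vertices,
because the coordinates of a point are the weights of its unique affine combination. -/
lemma mem_hull_of_subset {τ : Spx d} (hτ : τ ⊆ κ) {x : Pt d} :
    x ∈ hull τ ↔ x ∈ hull κ ∧ ∀ a ∈ κ, a ∉ τ → hat κ a x = 0 := by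
  constructor
  · intro hx
    refine ⟨convexHull_mono (by exact_mod_cast hτ) hx, fun a ha haτ => ?_⟩
    rw [hull, Finset.mem_convexHull'] at hx
    obtain ⟨w, -, hw1, rfl⟩ := hx
    rw [hat_sum _ _ hw1]
    refine Finset.sum_eq_zero fun i hi => ?_
    rw [h.hat_of_ne ha (hτ hi) (fun e => haτ (e ▸ hi)), mul_zero]
  · rintro ⟨hx, h0⟩
    rw [hull, Finset.mem_convexHull']
    refine ⟨fun a => hat κ a x, fun a ha => h.mem_hull.1 hx a (hτ ha), ?_, ?_⟩
    · rw [← h.sum_hat x]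
      exact Finset.sum_subset hτ h0
    · conv_rhs => rw [← h.sum_hat_smul x]
      exact Finset.sum_subset hτ fun a ha haτ => by
        simp only [h0 a ha haτ, zero_smul]

lemma hat_nonneg {x : Pt d} (hx : x ∈ hull κ) {a : Pt d} (ha : a ∈ κ) : 0 ≤ hat κ a x :=
  h.mem_hull.1 hx a ha

lemma hat_le_one {x : Pt d} (hx : x ∈ hull κ) {a : Pt d} (ha : a ∈ κ) : hat κ a x ≤ 1 := by
  rw [← h.sum_hat x]
  exact Finset.single_le_sum (f := fun a => hat κ a x) (fun b hb => h.hat_nonneg hx hb) ha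

lemma sum_hatGrad : ∑ a ∈ κ, hatGrad κ a = 0 := by
  have key : ∀ v : Pt d, inner ℝ (∑ a ∈ κ, hatGrad κ a) v = 0 := fun v => by
    have h1 := h.sum_hat v
    have h2 := h.sum_hat 0
    rw [sum_inner]
    have : ∀ a ∈ κ, inner ℝ (hatGrad κ a) v = hat κ a v - hat κ a 0 := fun a _ => by
      rw [hat_sub_hat, sub_zero]
    rw [Finset.sum_congr rfl this, Finset.sum_sub_distrib, h1, h2, sub_self]
  exact inner_self_eq_zero.1 (key _)

lemma sum_inner_hatGrad_smul (v : Pt d) : ∑ a ∈ κ, inner ℝ (hatGrad κ a) v • a = v := by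
  have h1 := h.sum_hat_smul v
  have h2 := h.sum_hat_smul 0
  have : ∀ a ∈ κ, inner ℝ (hatGrad κ a) v • a = hat κ a v • a - hat κ a 0 • a := fun a _ => by
    rw [← sub_smul, hat_sub_hat, sub_zero]
  rw [Finset.sum_congr rfl this, Finset.sum_sub_distrib, h1, h2, sub_zero]

lemma hatGrad_ne_zero {a : Pt d} (ha : a ∈ κ) : hatGrad κ a ≠ 0 := by
  have := h.altitude_ne_zero ha
  exact smul_ne_zero (inv_ne_zero (pow_ne_zero _ (norm_ne_zero_iff.2 this))) this

lemma hat_bary {a b : Pt d} (ha : a ∈ κ) (hb : b ∈ κ) :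
    hat κ b (bary (κ.erase a)) = if b = a then 0 else (d : ℝ)⁻¹ := by
  have hd := h.natCast_pos
  have e : bary (κ.erase a) = ∑ i ∈ κ.erase a, (d : ℝ)⁻¹ • i := by rw [bary, Finset.smul_sum]
  rw [e, hat_sum]
  · split_ifs with hba
    · subst hba
      refine Finset.sum_eq_zero fun i hi => ?_
      rw [Finset.mem_erase] at hi
      rw [h.hat_of_ne hb hi.2 hi.1, mul_zero]
    · rw [Finset.sum_eq_single_of_mem b (Finset.mem_erase.2 ⟨hba, hb⟩), h.hat_self hb, mul_one]
      intro i hi hne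
      rw [h.hat_of_ne hb (Finset.mem_of_mem_erase hi) hne, mul_zero]
  · rw [Finset.sum_const, h.card_erase ha, nsmul_eq_mul, mul_inv_cancel₀ hd.ne']

lemma bary_mem_hull {a : Pt d} (ha : a ∈ κ) : bary (κ.erase a) ∈ hull (κ.erase a) := by
  rw [h.mem_hull_of_subset (Finset.erase_subset _ _), h.mem_hull]
  have hd := h.natCast_pos
  refine ⟨fun b hb => ?_, fun b hb hb' => ?_⟩
  · rw [h.hat_bary ha hb]; split_ifs <;> positivity
  · have : b = a := by by_contra hne; exact hb' (Finset.mem_erase.2 ⟨hne, hb⟩)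
    rw [h.hat_bary ha hb, if_pos this]

lemma sum_facets {β : Type*} [AddCommMonoid β] (F : Spx d → β) :
    ∑ σ ∈ facets κ, F σ = ∑ a ∈ κ, F (κ.erase a) := by
  symm
  refine Finset.sum_bij (fun a _ => κ.erase a) ?_ ?_ ?_ fun _ _ => rfl
  · intro a ha; exact (mem_facets h.card_eq).2 ⟨a, ha, rfl⟩
  · intro a ha b hb hab
    have := congrArg (opp κ) hab
    rwa [opp_erase ha, opp_erase hb] at this
  · intro σ hσ
    obtain ⟨a, ha, rfl⟩ := (mem_facets h.card_eq).1 hσ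
    exact ⟨a, ha, rfl⟩

end IsSimplex

/-! ### Topology and volume of the closed simplices -/

lemma isCompact_hull (κ : Spx d) : IsCompact (hull κ) :=
  κ.finite_toSet.isCompact_convexHull (𝕜 := ℝ)

lemma convex_hull (κ : Spx d) : Convex ℝ (hull κ) := convex_convexHull ℝ _

lemma isClosed_hull (κ : Spx d) : IsClosed (hull κ) := (isCompact_hull κ).isClosed

lemma measurableSet_hull (κ : Spx d) : MeasurableSet (hull κ) := (isClosed_hull κ).measurableSet

lemma volume_frontier_hull (κ : Spx d) : volume (frontier (hull κ)) = 0 :=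
  (convex_hull κ).addHaar_frontier _

lemma interior_hull_ae_eq (κ : Spx d) : interior (hull κ) =ᵐ[volume] hull κ :=
  interior_ae_eq_of_null_frontier (volume_frontier_hull κ)

lemma volume_hull_lt_top (κ : Spx d) : volume (hull κ) < ⊤ := (isCompact_hull κ).measure_lt_top

namespace IsSimplex

variable {κ : Spx d} (h : IsSimplex κ)

include h

lemma interior_nonempty : (interior (hull κ)).Nonempty := by
  have hp := h.natCast_pos
  refine ⟨∑ i ∈ κ, (d + 1 : ℝ)⁻¹ • i, h.mem_interior_hull.2 fun a ha => ?_⟩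
  rw [h.hat_combo (w := fun _ => (d + 1 : ℝ)⁻¹) _ ha]
  · positivity
  · rw [Finset.sum_const, h.card_eq, nsmul_eq_mul]; push_cast; field_simp

lemma vol_pos : 0 < vol κ := by
  rw [vol, measureReal_def, ENNReal.toReal_pos_iff]
  refine ⟨?_, volume_hull_lt_top κ⟩
  exact (isOpen_interior.measure_pos volume h.interior_nonempty).trans_le
    (measure_mono interior_subset)

end IsSimplex

lemma continuous_hat (κ : Spx d) (a : Pt d) : Continuous (hat κ a) := by
  unfold hat; fun_prop

lemma contDiff_hat (κ : Spx d) (a : Pt d) : ContDiff ℝ ∞ (hat κ a) := by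
  exact contDiff_const.inner ℝ (contDiff_id.sub contDiff_const)

lemma hasGradientAt_hat (κ : Spx d) (a x : Pt d) : HasGradientAt (hat κ a) (hatGrad κ a) x := by
  rw [hasGradientAt_iff_hasFDerivAt]
  exact ((innerSL ℝ (hatGrad κ a)).hasFDerivAt (x := x - bary (κ.erase a))).comp x
    ((hasFDerivAt_id x).sub_const (bary (κ.erase a)))

/-! ### Affine changes of variables between simplices -/

lemma Continuous.integrableOn_hull {E : Type*} [NormedAddCommGroup E] {ψ : Pt d → E}
    (hψ : Continuous ψ) (κ : Spx d) : IntegrableOn ψ (hull κ) :=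
  hψ.continuousOn.integrableOn_compact (isCompact_hull κ)

/-- The mean value of a function over a simplex. -/
def mean (κ : Spx d) (ψ : Pt d → ℝ) : ℝ := (vol κ)⁻¹ * ∫ x in hull κ, ψ x

/-- The affine map sending each vertex `a` of `κ` to `e a`. -/
def simplexMap (κ : Spx d) (e : Pt d → Pt d) (x : Pt d) : Pt d := ∑ a ∈ κ, hat κ a x • e a

/-- The linear part of `simplexMap κ e`. -/
def simplexMapDeriv (κ : Spx d) (e : Pt d → Pt d) : Pt d →L[ℝ] Pt d :=
  ∑ a ∈ κ, (innerSL ℝ (hatGrad κ a)).smulRight (e a)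

lemma contDiff_simplexMap (κ : Spx d) (e : Pt d → Pt d) : ContDiff ℝ ∞ (simplexMap κ e) :=
  ContDiff.sum fun a _ => (contDiff_hat κ a).smul contDiff_const

lemma simplexMap_sub (κ : Spx d) (e : Pt d → Pt d) (x y : Pt d) :
    simplexMap κ e x - simplexMap κ e y = simplexMapDeriv κ e (x - y) := by
  simp only [simplexMap, simplexMapDeriv, _root_.sum_apply,
    ContinuousLinearMap.smulRight_apply, innerSL_apply_apply, ← hat_sub_hat, sub_smul,
    Finset.sum_sub_distrib]

lemma hasFDerivAt_simplexMap (κ : Spx d) (e : Pt d → Pt d) (x : Pt d) :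
    HasFDerivAt (simplexMap κ e) (simplexMapDeriv κ e) x := by
  have : simplexMap κ e = fun y => simplexMapDeriv κ e y + simplexMap κ e 0 := by
    ext1 y
    rw [← sub_zero y, ← simplexMap_sub]; simp
  rw [this]
  exact (simplexMapDeriv κ e).hasFDerivAt.add_const _

namespace IsSimplex

variable {κ κ' : Spx d} (h : IsSimplex κ)

include h

lemma simplexMap_apply_mem (e : Pt d → Pt d) {a : Pt d} (ha : a ∈ κ) : simplexMap κ e a = e a := by
  rw [simplexMap, Finset.sum_eq_single_of_mem a ha, h.hat_self ha, one_smul]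
  intro b hb hne
  rw [h.hat_of_ne hb ha hne.symm, zero_smul]

lemma injOn_of_image (h' : IsSimplex κ') {e : Pt d → Pt d} (he : κ.image e = κ') :
    Set.InjOn e κ := by
  rw [← Finset.card_image_iff, he, h.card_eq, h'.card_eq]

lemma hat_simplexMap (h' : IsSimplex κ') {e : Pt d → Pt d} (he : κ.image e = κ') {a : Pt d}
    (ha : a ∈ κ) (x : Pt d) : hat κ' (e a) (simplexMap κ e x) = hat κ a x := by
  have hinj := h.injOn_of_image h' he
  have hm : ∀ b ∈ κ, e b ∈ κ' := fun b hb => he ▸ Finset.mem_image_of_mem e hb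
  have : simplexMap κ e x = ∑ b ∈ κ', (∑ c ∈ κ with e c = b, hat κ c x) • b := by
    rw [simplexMap, ← he, Finset.sum_image hinj]
    refine Finset.sum_congr rfl fun b hb => ?_
    congr 1
    rw [Finset.sum_eq_single_of_mem b (by simp [hb])]
    intro c hc hne
    rw [Finset.mem_filter] at hc
    exact absurd (hinj hc.1 hb hc.2) hne
  rw [this, h'.hat_combo (w := fun b => ∑ c ∈ κ with e c = b, hat κ c x) _ (hm a ha),
    Finset.sum_eq_single_of_mem a (by simp [ha])]
  · intro c hc hne
    rw [Finset.mem_filter] at hc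
    exact absurd (hinj hc.1 ha hc.2) hne
  · rw [Finset.sum_fiberwise_of_maps_to hm, h.sum_hat]

lemma simplexMap_injective (h' : IsSimplex κ') {e : Pt d → Pt d} (he : κ.image e = κ') :
    Function.Injective (simplexMap κ e) := fun x y hxy =>
  h.ext_hat fun a ha => by
    rw [← h.hat_simplexMap h' he ha, ← h.hat_simplexMap h' he ha, hxy]

lemma image_simplexMap (h' : IsSimplex κ') {e : Pt d → Pt d} (he : κ.image e = κ') :
    simplexMap κ e '' hull κ = hull κ' := by
  apply Set.Subset.antisymm
  · rintro _ ⟨x, hx, rfl⟩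
    rw [h'.mem_hull, ← he]
    intro b hb
    obtain ⟨a, ha, rfl⟩ := Finset.mem_image.1 hb
    rw [he, h.hat_simplexMap h' he ha]
    exact h.hat_nonneg hx ha
  · intro y hy
    have hs : ∑ a ∈ κ, hat κ' (e a) y = 1 := by
      rw [← h'.sum_hat y, ← he, Finset.sum_image (h.injOn_of_image h' he)]
    refine ⟨∑ a ∈ κ, hat κ' (e a) y • a, ?_, ?_⟩
    · rw [h.mem_hull]
      intro a ha
      rw [h.hat_combo (w := fun a => hat κ' (e a) y) hs ha]
      exact h'.hat_nonneg hy (he ▸ Finset.mem_image_of_mem e ha)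
    · conv_rhs => rw [← h'.sum_hat_smul y]
      conv_rhs => rw [← he, Finset.sum_image (h.injOn_of_image h' he)]
      rw [simplexMap]
      refine Finset.sum_congr rfl fun a ha => ?_
      rw [h.hat_combo (w := fun a => hat κ' (e a) y) hs ha, he]

lemma integral_simplexMap (h' : IsSimplex κ') {e : Pt d → Pt d} (he : κ.image e = κ')
    (ψ : Pt d → ℝ) :
    ∫ x in hull κ', ψ x = |(simplexMapDeriv κ e).det| * ∫ x in hull κ, ψ (simplexMap κ e x) := by
  rw [← h.image_simplexMap h' he, integral_image_eq_integral_abs_det_fderiv_smul volume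
    (measurableSet_hull κ) (fun x _ => (hasFDerivAt_simplexMap κ e x).hasFDerivWithinAt)
    (h.simplexMap_injective h' he).injOn, ← integral_const_mul]
  rfl

/-- The Jacobian is constant, and comparison with the integral of `1` shows that it is the ratio of
the volumes; it therefore drops out of means. -/
lemma mean_simplexMap (h' : IsSimplex κ') {e : Pt d → Pt d} (he : κ.image e = κ')
    (ψ : Pt d → ℝ) : mean κ' ψ = mean κ (fun x => ψ (simplexMap κ e x)) := by
  have h1 := h.integral_simplexMap h' he fun _ => 1
  simp only [integral_const, smul_eq_mul, mul_one, measureReal_restrict_apply_univ] at h1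
  change vol κ' = _ * vol κ at h1
  have hv := h.vol_pos
  have hv' := h'.vol_pos
  rw [mean, mean, h.integral_simplexMap h' he, h1]
  have : |(simplexMapDeriv κ e).det| ≠ 0 := by
    intro h0; rw [h0] at h1; linarith
  field_simp

lemma mean_const (c : ℝ) : mean κ (fun _ => c) = c := by
  have hv := h.vol_pos
  rw [mean, integral_const, measureReal_restrict_apply_univ, smul_eq_mul]
  change (vol κ)⁻¹ * (vol κ * c) = c
  field_simp

omit h in
lemma mean_finset_sum {ι : Type*} (s : Finset ι) {ψ : ι → Pt d → ℝ}
    (hψ : ∀ i ∈ s, Continuous (ψ i)) : mean κ (fun x => ∑ i ∈ s, ψ i x) = ∑ i ∈ s, mean κ (ψ i) := by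
  simp only [mean]
  rw [integral_finsetSum _ fun i hi => Continuous.integrableOn_hull (hψ i hi) κ, Finset.mul_sum]

/-- By symmetry all `d + 1` coordinates have the same mean, and these means add up to `1`. -/
lemma mean_hat {a : Pt d} (ha : a ∈ κ) : mean κ (hat κ a) = (d + 1 : ℝ)⁻¹ := by
  have hsymm : ∀ b ∈ κ, mean κ (hat κ b) = mean κ (hat κ a) := by
    intro b hb
    have he : κ.image (Equiv.swap a b) = κ := by
      ext x
      simp only [Finset.mem_image]
      constructor
      · rintro ⟨y, hy, rfl⟩
        rw [Equiv.swap_apply_def]; split_ifs <;> assumption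
      · intro hx
        refine ⟨Equiv.swap a b x, ?_, Equiv.swap_apply_self _ _ _⟩
        rw [Equiv.swap_apply_def]; split_ifs <;> assumption
    rw [h.mean_simplexMap h he (hat κ b)]
    congr 1
    ext x
    have := h.hat_simplexMap h he ha x
    rwa [Equiv.swap_apply_left] at this
  have h1 := mean_finset_sum (κ := κ) κ fun b _ => continuous_hat κ b
  simp only [h.sum_hat, h.mean_const] at h1
  rw [Finset.sum_congr rfl hsymm, Finset.sum_const, h.card_eq, nsmul_eq_mul] at h1
  push_cast at h1
  exact eq_inv_of_mul_eq_one_right h1.symm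

lemma integral_hat {a : Pt d} (ha : a ∈ κ) :
    ∫ x in hull κ, hat κ a x = vol κ * (d + 1 : ℝ)⁻¹ := by
  have hv := h.vol_pos
  rw [← h.mean_hat ha, mean, mul_inv_cancel_left₀ hv.ne']

end IsSimplex

/-! ### Integration by parts for Raviart--Thomas functions on a simplex -/

/-- The mean of `φ` over the face `σ` of `κ`, expressed by an integral over `κ`. -/
def traceMean (κ σ : Spx d) (φ : Pt d → ℝ) : ℝ :=
  (d * vol κ)⁻¹ * ∫ x in hull κ, (fderiv ℝ φ x (x - opp κ σ) + d * φ x)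

lemma continuous_traceIntegrand {φ : Pt d → ℝ} (hφ : ContDiff ℝ 1 φ) (a : Pt d) :
    Continuous fun x => fderiv ℝ φ x (x - a) + d * φ x := by
  have := hφ.continuous
  have := hφ.continuous_fderiv one_ne_zero
  fun_prop

lemma traceMean_sub (κ σ : Spx d) {φ ψ : Pt d → ℝ} (hφ : ContDiff ℝ 1 φ) (hψ : ContDiff ℝ 1 ψ) :
    traceMean κ σ (fun x => φ x - ψ x) = traceMean κ σ φ - traceMean κ σ ψ := by
  simp only [traceMean]
  rw [← mul_sub, ← integral_sub
    (Continuous.integrableOn_hull (continuous_traceIntegrand hφ _) κ)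
    (Continuous.integrableOn_hull (continuous_traceIntegrand hψ _) κ)]
  congr 2
  ext x
  have h1 := (hφ.differentiable one_ne_zero) x
  have h2 := (hψ.differentiable one_ne_zero) x
  rw [fderiv_fun_sub h1 h2]
  simp only [_root_.sub_apply]
  ring

/-- For `s > 0` the scaled integral is the integral of `φ` over the homothetic copy of the simplex
with centre `a` and ratio `s`. The trace integrand is thus the rate of change of `∫ φ` as the
simplex is shrunk towards `a`. -/
lemma hasDerivAt_scaled_integral (κ : Spx d) (a : Pt d) {φ : Pt d → ℝ} (hφ : ContDiff ℝ 1 φ) :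
    HasDerivAt (fun s : ℝ => s ^ d * ∫ x in hull κ, φ (a + s • (x - a)))
      (∫ x in hull κ, (fderiv ℝ φ x (x - a) + d * φ x)) 1 := by
  have hc := hφ.continuous
  have hc' := hφ.continuous_fderiv one_ne_zero
  have hcont : Continuous fun p : ℝ × Pt d =>
      fderiv ℝ φ (a + p.1 • (p.2 - a)) (p.2 - a) := by fun_prop
  obtain ⟨C, hC⟩ := (((isCompact_Icc (a := (0 : ℝ)) (b := 2)).prod (isCompact_hull κ)).image
    hcont).isBounded.exists_norm_le
  have key := hasDerivAt_integral_of_dominated_loc_of_deriv_le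
    (μ := volume.restrict (hull κ)) (F := fun s x => φ (a + s • (x - a)))
    (F' := fun s x => fderiv ℝ φ (a + s • (x - a)) (x - a)) (x₀ := (1 : ℝ))
    (s := Set.Icc 0 2) (bound := fun _ => C)
    (Icc_mem_nhds (by norm_num) (by norm_num))
    (Eventually.of_forall fun s => (show Continuous fun x : Pt d => φ (a + s • (x - a)) by
      fun_prop).aestronglyMeasurable)
    (Continuous.integrableOn_hull (by fun_prop) κ)
    (show Continuous fun x : Pt d => fderiv ℝ φ (a + (1 : ℝ) • (x - a)) (x - a) by
      fun_prop).aestronglyMeasurable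
    ((ae_restrict_iff' (measurableSet_hull κ)).2 (Eventually.of_forall fun x hx s hs =>
      hC _ ⟨(s, x), ⟨hs, hx⟩, rfl⟩))
    (Continuous.integrableOn_hull continuous_const κ)
    (Eventually.of_forall fun x s _ => by
      have h1 : HasDerivAt (fun s : ℝ => a + s • (x - a)) (x - a) s := by
        simpa using ((hasDerivAt_id s).smul_const (x - a)).const_add a
      exact ((hφ.differentiable one_ne_zero) _).hasFDerivAt.comp_hasDerivAt s h1)
  have h2 := (hasDerivAt_pow d (1 : ℝ)).mul key.2
  refine h2.congr_deriv ?_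
  simp only [one_pow, mul_one, one_smul, add_sub_cancel, one_mul]
  rw [integral_add (Continuous.integrableOn_hull (by fun_prop) κ)
    (Continuous.integrableOn_hull (by fun_prop) κ), integral_const_mul, add_comm]

namespace IsSimplex

variable {κ κ' : Spx d} (h : IsSimplex κ)

include h

/-- Project `x` from the vertex `a` onto the opposite face. The distance to the projection is `hat κ
a x` times a bounded length, and `φ` is Lipschitz on the simplex and vanishes at the projection. -/
lemma abs_le_mul_hat {a : Pt d} (ha : a ∈ κ) {φ : Pt d → ℝ} (hφ : ContDiff ℝ 1 φ)
    (h0 : ∀ x ∈ hull (κ.erase a), φ x = 0) :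
    ∃ C, ∀ x ∈ hull κ, |φ x| ≤ C * hat κ a x := by
  have hc' := hφ.continuous_fderiv one_ne_zero
  obtain ⟨C, hC⟩ := ((isCompact_hull κ).image hc').isBounded.exists_norm_le
  obtain ⟨R, hR⟩ := ((isCompact_hull κ).image (f := fun x => a - x)
    (by fun_prop)).isBounded.exists_norm_le
  have hlip : ∀ x ∈ hull κ, ∀ y ∈ hull κ, ‖φ y - φ x‖ ≤ C * ‖y - x‖ := fun x hx y hy =>
    (convex_hull κ).norm_image_sub_le_of_norm_fderiv_le
      (fun z _ => (hφ.differentiable one_ne_zero) z) (fun z hz => hC _ ⟨z, hz, rfl⟩) hx hy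
  have haκ : a ∈ hull κ := subset_convexHull ℝ _ ha
  have hC0 : 0 ≤ C := (norm_nonneg _).trans (hC _ ⟨a, haκ, rfl⟩)
  -- Here `C` bounds the derivative and `R` the distance to `a`. The summand `|φ a|` covers `x = a`,
  -- where the projection is undefined.
  refine ⟨C * R + |φ a|, fun x hx => ?_⟩
  have hR0 : 0 ≤ R := (norm_nonneg _).trans (hR _ ⟨a, haκ, rfl⟩)
  set t := hat κ a x with ht
  have ht0 : 0 ≤ t := h.hat_nonneg hx ha
  rcases eq_or_lt_of_le (h.hat_le_one hx ha) with h1 | h1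
  · have hxa : x = a := h.ext_hat fun b hb => by
      by_cases hba : b = a
      · rw [hba, h.hat_self ha, h1]
      · rw [h.hat_of_ne hb ha (Ne.symm hba)]
        have h2 := h.sum_hat x
        rw [← Finset.add_sum_erase κ (fun c => hat κ c x) ha] at h2
        have h3 : hat κ b x ≤ ∑ c ∈ κ.erase a, hat κ c x :=
          Finset.single_le_sum (f := fun c => hat κ c x)
            (fun c hc => h.hat_nonneg hx (Finset.mem_of_mem_erase hc))
            (Finset.mem_erase.2 ⟨hba, hb⟩)
        have := h.hat_nonneg hx hb
        linarith
    have : t = 1 := h1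
    rw [this, hxa]
    nlinarith [abs_nonneg (φ a)]
  · have h1t : 0 < 1 - t := by linarith
    set y : Pt d := a + (1 - t)⁻¹ • (x - a) with hy
    have hhat : ∀ b, hat κ b y = hat κ b a + (1 - t)⁻¹ * (hat κ b x - hat κ b a) := fun b => by
      rw [hat_eq_add κ b y a, hy, add_sub_cancel_left, real_inner_smul_right, ← hat_sub_hat]
    have hyσ : y ∈ hull (κ.erase a) := by
      rw [h.mem_hull_of_subset (Finset.erase_subset _ _), h.mem_hull]
      have hya : hat κ a y = 0 := by
        rw [hhat, h.hat_self ha, ← ht]; field_simp; ring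
      refine ⟨fun b hb => ?_, fun b hb hb' => ?_⟩
      · by_cases hba : b = a
        · rw [hba, hya]
        · rw [hhat, h.hat_of_ne hb ha (Ne.symm hba)]
          have := h.hat_nonneg hx hb
          simp only [sub_zero, zero_add]; positivity
      · have : b = a := by by_contra hne; exact hb' (Finset.mem_erase.2 ⟨hne, hb⟩)
        rw [this, hya]
    have hyκ : y ∈ hull κ := ((h.mem_hull_of_subset (Finset.erase_subset _ _)).1 hyσ).1
    have hxy : x - y = t • (a - y) := by
      have : x - a = (1 - t) • (y - a) := by
        rw [hy, add_sub_cancel_left, smul_smul, mul_inv_cancel₀ h1t.ne', one_smul]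
      have e1 : x = a + (1 - t) • (y - a) := by rw [← this]; abel
      rw [e1, sub_smul, one_smul, smul_sub, smul_sub]; abel
    have h2 := hlip y hyκ x hx
    rw [h0 y hyσ, sub_zero, hxy, norm_smul, Real.norm_eq_abs, Real.norm_eq_abs,
      abs_of_nonneg ht0] at h2
    have h3 := hR _ ⟨y, hyκ, rfl⟩
    have h4 : C * (t * ‖a - y‖) ≤ C * (t * R) := by gcongr
    nlinarith [mul_nonneg (abs_nonneg (φ a)) ht0]

/-- The integral is the derivative at ratio `1` of `∫ φ` over shrunken copies of the simplex. The
layer lost at ratio `s` has volume `(1 - s^d)|κ|`, and there `φ = O(1 - s)`, so the left difference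
quotients tend to zero. -/
lemma integral_trace_eq_zero {a : Pt d} (ha : a ∈ κ) {φ : Pt d → ℝ} (hφ : ContDiff ℝ 1 φ)
    (h0 : ∀ x ∈ hull (κ.erase a), φ x = 0) :
    ∫ x in hull κ, (fderiv ℝ φ x (x - a) + d * φ x) = 0 := by
  obtain ⟨C, hC⟩ := h.abs_le_mul_hat ha hφ h0
  have haκ : a ∈ hull κ := subset_convexHull ℝ _ ha
  have hC0 : 0 ≤ C := by
    have := hC a haκ
    rw [h.hat_self ha, mul_one] at this
    exact (abs_nonneg _).trans this
  set G : ℝ → ℝ := fun s => s ^ d * ∫ x in hull κ, φ (a + s • (x - a)) with hG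
  have hder := hasDerivAt_scaled_integral κ a hφ
  have hslope := hasDerivAt_iff_tendsto_slope.1 hder
  have hslope' := hslope.mono_left (nhdsWithin_mono (1 : ℝ) (s := Set.Iio 1)
    (fun x hx => (ne_of_lt hx : x ≠ 1)))
  refine tendsto_nhds_unique hslope' ?_
  have hbound : ∀ s : ℝ, 0 < s → s < 1 → ‖slope G 1 s‖ ≤ C * ((1 - s ^ d) * vol κ) := by
    intro s hs0 hs1
    set S : Set (Pt d) := (fun x => a + s • (x - a)) '' hull κ with hS
    have hf' : ∀ x ∈ hull κ, HasFDerivWithinAt (fun x : Pt d => a + s • (x - a))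
        (s • ContinuousLinearMap.id ℝ (Pt d)) (hull κ) x := fun x _ =>
      ((((hasFDerivAt_id x).sub_const a).const_smul s).const_add a).hasFDerivWithinAt
    have hinj : Set.InjOn (fun x : Pt d => a + s • (x - a)) (hull κ) := by
      intro x _ y _ hxy
      simpa [hs0.ne'] using hxy
    have hdet : |(s • ContinuousLinearMap.id ℝ (Pt d)).det| = s ^ d := by
      rw [ContinuousLinearMap.det, ContinuousLinearMap.toLinearMap_smul, LinearMap.det_smul]
      simp [abs_of_pos hs0]
    have hint : ∀ ψ : Pt d → ℝ, ∫ x in S, ψ x = s ^ d * ∫ x in hull κ, ψ (a + s • (x - a)) := by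
      intro ψ
      rw [hS, integral_image_eq_integral_abs_det_fderiv_smul volume (measurableSet_hull κ) hf' hinj,
        ← integral_const_mul]
      simp only [hdet, smul_eq_mul]
    have hSc : IsCompact S := (isCompact_hull κ).image (by fun_prop)
    have hSm : MeasurableSet S := hSc.isClosed.measurableSet
    have hSsub : S ⊆ hull κ := by
      rintro _ ⟨x, hx, rfl⟩
      have := (convex_hull κ) haκ hx (by linarith : 0 ≤ 1 - s) hs0.le (by ring)
      convert this using 1
      simp only [sub_smul, one_smul, smul_sub]; abel
    -- A point with larger coordinate at `a` would still be in the simplex after dilation by `s⁻¹`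
    -- from `a`, hence would belong to the copy `S`.
    have hdiff : ∀ x ∈ hull κ \ S, hat κ a x ≤ 1 - s := by
      rintro x ⟨hx, hxS⟩
      by_contra! hlt
      apply hxS
      refine ⟨a + s⁻¹ • (x - a), ?_, by simp [smul_smul, hs0.ne']⟩
      rw [h.mem_hull]
      intro b hb
      rw [hat_eq_add κ b _ a, add_sub_cancel_left, real_inner_smul_right, ← hat_sub_hat]
      by_cases hba : b = a
      · rw [hba, h.hat_self ha]
        have : s⁻¹ * (hat κ a x - 1) ≥ s⁻¹ * (-s) :=
          mul_le_mul_of_nonneg_left (by linarith) (by positivity)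
        rw [mul_neg, inv_mul_cancel₀ hs0.ne'] at this
        linarith
      · rw [h.hat_of_ne hb ha (Ne.symm hba)]
        have := h.hat_nonneg hx hb
        simp only [sub_zero, zero_add]; positivity
    have hvolS : volume.real S = s ^ d * vol κ := by
      have := hint fun _ => 1
      simpa [vol] using this
    have hG1 : G 1 = ∫ x in hull κ, φ x := by simp [hG]
    have hGs : G s = ∫ x in S, φ x := (hint φ).symm
    have hsub : G 1 - G s = ∫ x in hull κ \ S, φ x := by
      rw [hG1, hGs, setIntegral_sdiff hSm (Continuous.integrableOn_hull hφ.continuous κ) hSsub]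
    have hle : |G 1 - G s| ≤ C * (1 - s) * volume.real (hull κ \ S) := by
      rw [hsub, ← Real.norm_eq_abs]
      refine norm_setIntegral_le_of_norm_le_const
        ((measure_mono Set.sdiff_subset).trans_lt (volume_hull_lt_top κ)) fun x hx => ?_
      exact (hC x hx.1).trans (mul_le_mul_of_nonneg_left (hdiff x hx) hC0)
    have hvol : volume.real (hull κ \ S) = (1 - s ^ d) * vol κ := by
      rw [measureReal_sdiff hSsub hSm (volume_hull_lt_top κ).ne, hvolS, vol]; ring
    rw [hvol] at hle
    have h1s : 0 < 1 - s := by linarith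
    rw [slope_def_field, norm_div, Real.norm_eq_abs, Real.norm_eq_abs, abs_sub_comm,
      abs_sub_comm s, abs_of_pos h1s, div_le_iff₀ h1s]
    linarith
  have hlim : Tendsto (fun s : ℝ => C * ((1 - s ^ d) * vol κ)) (𝓝[<] 1) (𝓝 0) := by
    have : Continuous fun s : ℝ => C * ((1 - s ^ d) * vol κ) := by fun_prop
    have h2 := this.tendsto 1
    simp only [one_pow, sub_self, zero_mul, mul_zero] at h2
    exact h2.mono_left nhdsWithin_le_nhds
  refine squeeze_zero_norm' ?_ hlim
  filter_upwards [Ioo_mem_nhdsLT (zero_lt_one' ℝ)] with s hs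
  exact hbound s hs.1 hs.2

end IsSimplex

namespace IsSimplex

variable {κ κ' : Spx d} (h : IsSimplex κ)

include h

lemma traceMean_congr {σ : Spx d} (hσ : σ ∈ facets κ) {φ ψ : Pt d → ℝ} (hφ : ContDiff ℝ 1 φ)
    (hψ : ContDiff ℝ 1 ψ) (h0 : ∀ x ∈ hull σ, φ x = ψ x) :
    traceMean κ σ φ = traceMean κ σ ψ := by
  obtain ⟨a, ha, rfl⟩ := (mem_facets h.card_eq).1 hσ
  rw [← sub_eq_zero, ← traceMean_sub _ _ hφ hψ, traceMean, opp_erase ha,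
    h.integral_trace_eq_zero ha (hφ.sub hψ) fun x hx => sub_eq_zero.2 (h0 x hx), mul_zero]

lemma traceMean_eq_zero {σ : Spx d} (hσ : σ ∈ facets κ) {φ : Pt d → ℝ} (hφ : ContDiff ℝ 1 φ)
    (h0 : ∀ x ∈ hull σ, φ x = 0) : traceMean κ σ φ = 0 := by
  obtain ⟨a, ha, rfl⟩ := (mem_facets h.card_eq).1 hσ
  rw [traceMean, opp_erase ha, h.integral_trace_eq_zero ha hφ h0, mul_zero]

omit h in
lemma traceMean_eq_mean (σ : Spx d) (φ : Pt d → ℝ) :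
    traceMean κ σ φ = (d : ℝ)⁻¹ * mean κ fun x => fderiv ℝ φ x (x - opp κ σ) + d * φ x := by
  rw [traceMean, mean, mul_inv, mul_assoc]

/-- Transport by the affine map that fixes the common face and sends one opposite vertex to the
other. The pulled-back function agrees with `φ` on the face, which is all that the trace mean sees.
-/
lemma traceMean_eq_of_common_facet (h' : IsSimplex κ') {σ : Spx d} (hσ : σ ∈ facets κ)
    (hσ' : σ ∈ facets κ') {φ : Pt d → ℝ} (hφ : ContDiff ℝ 1 φ) :
    traceMean κ' σ φ = traceMean κ σ φ := by
  obtain ⟨a, ha, rfl⟩ := (mem_facets h.card_eq).1 hσ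
  obtain ⟨a', ha', heq⟩ := (mem_facets h'.card_eq).1 hσ'
  set e : Pt d → Pt d := fun b => if b = a then a' else b with he
  have hopp : opp κ' (κ.erase a) = a' := by rw [heq, opp_erase ha']
  have hmap : ∀ b ∈ κ.erase a, e b = b := fun b hb => by
    simp only [he, if_neg (Finset.ne_of_mem_erase hb)]
  have himg : κ.image e = κ' := by
    rw [← Finset.insert_erase ha, Finset.image_insert, Finset.image_congr (g := id)
      (fun b hb => hmap b hb), Finset.image_id, heq]
    simp only [he, if_true]
    exact Finset.insert_erase ha'
  have hAa : simplexMap κ e a = a' := by rw [h.simplexMap_apply_mem e ha]; simp [he]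
  have hA1 : ContDiff ℝ 1 (simplexMap κ e) := (contDiff_simplexMap κ e).of_le (by norm_cast)
  rw [traceMean_eq_mean, h.mean_simplexMap h' himg, ← h.traceMean_congr hσ (hφ.comp hA1) hφ,
    traceMean_eq_mean, hopp, opp_erase ha]
  · congr 2
    ext x
    rw [((hφ.differentiable one_ne_zero _).hasFDerivAt.comp x
      (hasFDerivAt_simplexMap κ e x)).fderiv]
    simp only [ContinuousLinearMap.comp_apply, ← simplexMap_sub, hAa, Function.comp_apply]
  · intro x hx
    have hx' := ((h.mem_hull_of_subset (Finset.erase_subset _ _)).1 hx).2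
    have : simplexMap κ e x = x := by
      conv_rhs => rw [← h.sum_hat_smul x]
      refine Finset.sum_congr rfl fun b hb => ?_
      by_cases hba : b = a
      · rw [hba, hx' a ha (by simp), zero_smul, zero_smul]
      · rw [hmap b (Finset.mem_erase.2 ⟨hba, hb⟩)]
    simp [this]

end IsSimplex

/-! ### Face fluxes as degrees of freedom of Raviart–Thomas functions -/

/-- The flux of `q` through the face `σ` of `κ` in the direction pointing out of `κ`. -/
def flux (κ σ : Spx d) (q : RT d) : ℝ :=
  -(d * vol κ) * inner ℝ (hatGrad κ (opp κ σ)) (rtEval q (bary σ))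

lemma rtEval_add (q r : RT d) (x : Pt d) : rtEval (q + r) x = rtEval q x + rtEval r x := by
  simp only [rtEval, Prod.fst_add, Prod.snd_add, add_smul]; abel

lemma rtEval_smul (c : ℝ) (q : RT d) (x : Pt d) : rtEval (c • q) x = c • rtEval q x := by
  simp only [rtEval, Prod.smul_fst, Prod.smul_snd, smul_add, smul_smul, smul_eq_mul]

lemma rtEval_sum {ι : Type*} (s : Finset ι) (q : ι → RT d) (x : Pt d) :
    rtEval (∑ i ∈ s, q i) x = ∑ i ∈ s, rtEval (q i) x := by
  simp only [rtEval, Prod.fst_sum, Prod.snd_sum, Finset.sum_smul, Finset.sum_add_distrib]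

lemma continuous_rtEval (q : RT d) : Continuous (rtEval q) := by unfold rtEval; fun_prop

lemma flux_add (κ σ : Spx d) (q r : RT d) : flux κ σ (q + r) = flux κ σ q + flux κ σ r := by
  simp only [flux, rtEval_add, inner_add_right]; ring

lemma flux_smul (κ σ : Spx d) (c : ℝ) (q : RT d) : flux κ σ (c • q) = c * flux κ σ q := by
  simp only [flux, rtEval_smul, real_inner_smul_right]; ring

lemma flux_zero (κ σ : Spx d) : flux κ σ (0 : RT d) = 0 := by
  simp [flux, rtEval]

lemma flux_sum {ι : Type*} (κ σ : Spx d) (s : Finset ι) (q : ι → RT d) :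
    flux κ σ (∑ i ∈ s, q i) = ∑ i ∈ s, flux κ σ (q i) := by
  simp only [flux, rtEval_sum, inner_sum, Finset.mul_sum]

/-- The Raviart--Thomas basis function of the face `σ` of `κ`, with unit flux out of `κ`. -/
def rtUnit (κ σ : Spx d) : RT d := (d * vol κ)⁻¹ • ((-opp κ σ, 1) : RT d)

lemma rtEval_rtUnit (κ σ : Spx d) (x : Pt d) :
    rtEval (rtUnit κ σ) x = (d * vol κ)⁻¹ • (x - opp κ σ) := by
  rw [rtUnit, rtEval_smul, rtEval]; simp only [one_smul]; congr 1; abel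

namespace IsSimplex

variable {κ κ' : Spx d} (h : IsSimplex κ)

include h

lemma hat_bary_self {a : Pt d} (ha : a ∈ κ) : hat κ a (bary (κ.erase a)) = 0 := by
  rw [h.hat_bary ha ha, if_pos rfl]

/-- The component of a Raviart–Thomas function normal to a face is affine, constant on the planes
parallel to that face. Evaluating at the barycentre splits it into the flux and a multiple of the
coordinate. -/
lemma inner_hatGrad_rtEval {a : Pt d} (ha : a ∈ κ) (q : RT d) (x : Pt d) :
    inner ℝ (hatGrad κ a) (rtEval q x) =
      -((d * vol κ)⁻¹ * flux κ (κ.erase a) q) + q.2 * hat κ a x := by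
  have hd := h.natCast_pos
  have hv := h.vol_pos
  have h1 : rtEval q x = rtEval q (bary (κ.erase a)) + q.2 • (x - bary (κ.erase a)) := by
    simp only [rtEval, smul_sub]; abel
  rw [h1, inner_add_right, real_inner_smul_right, ← hat_sub_hat, h.hat_bary_self ha, flux,
    opp_erase ha, sub_zero]
  field_simp

lemma flux_eq {a : Pt d} (ha : a ∈ κ) (q : RT d) {x : Pt d} (hx : hat κ a x = 0) :
    flux κ (κ.erase a) q = -(d * vol κ) * inner ℝ (hatGrad κ a) (rtEval q x) := by
  have hd := h.natCast_pos
  have hv := h.vol_pos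
  rw [h.inner_hatGrad_rtEval ha, hx]
  field_simp
  ring

/-- The divergence theorem, in algebraic form: sum `inner_hatGrad_rtEval` over the vertices and use
that the coordinate gradients add up to `0` and the coordinates to `1`. -/
lemma sum_flux (q : RT d) : ∑ σ ∈ facets κ, flux κ σ q = vol κ * rtDiv q := by
  have hd := h.natCast_pos
  have hv := h.vol_pos
  have h1 := congrArg (fun v => inner ℝ v (rtEval q 0)) h.sum_hatGrad
  simp only [sum_inner, inner_zero_left] at h1
  rw [Finset.sum_congr rfl fun a ha => h.inner_hatGrad_rtEval ha q 0, Finset.sum_add_distrib,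
    Finset.sum_neg_distrib, ← Finset.mul_sum, ← Finset.mul_sum, h.sum_hat] at h1
  rw [h.sum_facets, rtDiv]
  field_simp at h1
  linarith

/-- Each coefficient is rewritten by `inner_hatGrad_rtEval`; the sum then collapses by the
barycentric expansions of the point `x` and of the vector `rtEval q x`. -/
lemma rtEval_eq_sum (q : RT d) (x : Pt d) :
    rtEval q x = ∑ σ ∈ facets κ, flux κ σ q • rtEval (rtUnit κ σ) x := by
  have hd := h.natCast_pos
  have hv := h.vol_pos
  rw [h.sum_facets]
  have h1 : ∀ a ∈ κ, flux κ (κ.erase a) q • rtEval (rtUnit κ (κ.erase a)) x =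
      (q.2 * hat κ a x - inner ℝ (hatGrad κ a) (rtEval q x)) • (x - a) := fun a ha => by
    rw [rtEval_rtUnit, opp_erase ha, smul_smul, h.inner_hatGrad_rtEval ha]
    congr 1
    ring
  rw [Finset.sum_congr rfl h1]
  simp only [sub_smul, smul_sub, Finset.sum_sub_distrib, mul_smul, ← Finset.smul_sum,
    h.sum_hat_smul, h.sum_inner_hatGrad_smul]
  rw [← Finset.sum_smul, h.sum_hat, ← Finset.sum_smul, ← sum_inner, h.sum_hatGrad, inner_zero_left]
  simp

lemma rt_ext {q r : RT d} (hqr : ∀ σ ∈ facets κ, flux κ σ q = flux κ σ r) : q = r := by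
  have hd := h.natCast_pos
  have h1 : ∀ x, rtEval q x = rtEval r x := fun x => by
    rw [h.rtEval_eq_sum q, h.rtEval_eq_sum r]
    exact Finset.sum_congr rfl fun σ hσ => by rw [hqr σ hσ]
  have h2 : q.1 = r.1 := by simpa [rtEval] using h1 0
  have h3 := h.sum_flux q
  rw [Finset.sum_congr rfl hqr, h.sum_flux r] at h3
  have h4 := mul_left_cancel₀ h.vol_pos.ne' h3
  exact Prod.ext h2 (mul_left_cancel₀ hd.ne' h4).symm

lemma flux_rtUnit {σ τ : Spx d} (hσ : σ ∈ facets κ) (hτ : τ ∈ facets κ) :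
    flux κ τ (rtUnit κ σ) = if τ = σ then 1 else 0 := by
  obtain ⟨a, ha, rfl⟩ := (mem_facets h.card_eq).1 hσ
  obtain ⟨b, hb, rfl⟩ := (mem_facets h.card_eq).1 hτ
  have hd := h.natCast_pos
  have hv := h.vol_pos
  have heq : κ.erase b = κ.erase a ↔ b = a :=
    ⟨fun e => by rw [← opp_erase ha, ← e, opp_erase hb], fun e => by rw [e]⟩
  rw [flux, rtEval_rtUnit, opp_erase ha, opp_erase hb, real_inner_smul_right, ← hat_sub_hat,
    h.hat_bary_self hb]
  simp only [heq]
  split_ifs with e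
  · rw [e, h.hat_self ha]; field_simp; ring
  · rw [h.hat_of_ne hb ha (Ne.symm e)]; simp

lemma rtDiv_rtUnit (σ : Spx d) : rtDiv (rtUnit κ σ) = (vol κ)⁻¹ := by
  have hd := h.natCast_pos
  have hv := h.vol_pos
  simp only [rtDiv, rtUnit, Prod.smul_snd, smul_eq_mul]; field_simp

/-- Green's formula without surface integrals. Expanded in the unit-flux basis, the integrand on the
left becomes the combination of trace integrands that define the face means. -/
lemma integral_rt (q : RT d) {φ : Pt d → ℝ} (hφ : ContDiff ℝ 1 φ) :
    ∫ x in hull κ, (fderiv ℝ φ x (rtEval q x) + rtDiv q * φ x) =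
      ∑ σ ∈ facets κ, flux κ σ q * traceMean κ σ φ := by
  have hd := h.natCast_pos
  have hv := h.vol_pos
  have h1 : ∀ x, fderiv ℝ φ x (rtEval q x) + rtDiv q * φ x =
      ∑ σ ∈ facets κ, (flux κ σ q * (d * vol κ)⁻¹) *
        (fderiv ℝ φ x (x - opp κ σ) + d * φ x) := fun x => by
    have h2 : rtDiv q = ∑ σ ∈ facets κ, (vol κ)⁻¹ * flux κ σ q := by
      rw [← Finset.mul_sum, h.sum_flux, inv_mul_cancel_left₀ hv.ne']
    rw [h.rtEval_eq_sum q, h2, map_sum, Finset.sum_mul, ← Finset.sum_add_distrib]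
    refine Finset.sum_congr rfl fun σ _ => ?_
    rw [map_smul, rtEval_rtUnit, map_smul, smul_eq_mul, smul_eq_mul]
    field_simp
  simp only [h1]
  rw [integral_finsetSum _ fun σ _ => ((Continuous.integrableOn_hull
    (continuous_traceIntegrand hφ _) κ).const_mul _)]
  refine Finset.sum_congr rfl fun σ _ => ?_
  rw [integral_const_mul, traceMean, mul_assoc]

omit h in
lemma fderiv_sum_hat (s : Finset (Pt d)) (Z : Pt d → ℝ) (x v : Pt d) :
    fderiv ℝ (fun x => ∑ a ∈ s, Z a * hat κ a x) x v =
      inner ℝ (∑ a ∈ s, Z a • hatGrad κ a) v := by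
  have : HasFDerivAt (fun x => ∑ a ∈ s, Z a * hat κ a x)
      (∑ a ∈ s, Z a • innerSL ℝ (hatGrad κ a)) x :=
    HasFDerivAt.fun_sum fun a _ => ((hasGradientAt_hat κ a x).hasFDerivAt.const_mul (Z a))
  rw [this.fderiv, sum_inner, _root_.sum_apply]
  exact Finset.sum_congr rfl fun a _ => by simp [real_inner_smul_left]

/-- For an affine function the trace integrand is again affine, and each coordinate has mean `1 / (d
+ 1)`. The contribution of the opposite vertex cancels, leaving the average over the face. -/
lemma traceMean_sum_hat {σ : Spx d} (hσ : σ ∈ facets κ) (Z : Pt d → ℝ) :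
    traceMean κ σ (fun x => ∑ a ∈ κ, Z a * hat κ a x) = (d : ℝ)⁻¹ * ∑ a ∈ σ, Z a := by
  have hd := h.natCast_pos
  have hv := h.vol_pos
  obtain ⟨a, ha, rfl⟩ := (mem_facets h.card_eq).1 hσ
  rw [traceMean, opp_erase ha]
  have h1 : ∀ x, fderiv ℝ (fun x => ∑ b ∈ κ, Z b * hat κ b x) x (x - a) +
      d * ∑ b ∈ κ, Z b * hat κ b x = ∑ b ∈ κ, (Z b * (d + 1)) * hat κ b x - Z a := fun x => by
    have h2 : ∑ b ∈ κ, Z b * hat κ b a = Z a := by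
      rw [Finset.sum_eq_single_of_mem a ha, h.hat_self ha, mul_one]
      intro b hb hne; rw [h.hat_of_ne hb ha hne.symm, mul_zero]
    rw [fderiv_sum_hat, sum_inner, ← h2, Finset.mul_sum, ← Finset.sum_add_distrib,
      ← Finset.sum_sub_distrib]
    refine Finset.sum_congr rfl fun b _ => ?_
    rw [real_inner_smul_left, ← hat_sub_hat]
    ring
  simp only [h1]
  have hint : ∀ b, Continuous fun x => Z b * (d + 1) * hat κ b x := fun b =>
    (continuous_hat κ b).const_mul _
  rw [integral_sub (Continuous.integrableOn_hull (by fun_prop) κ)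
    (Continuous.integrableOn_hull continuous_const κ),
    integral_finsetSum _ fun b _ => Continuous.integrableOn_hull (hint b) κ]
  have h3 : ∀ b ∈ κ, ∫ x in hull κ, Z b * (d + 1) * hat κ b x = Z b * vol κ := fun b hb => by
    rw [integral_const_mul, h.integral_hat hb]; field_simp
  rw [Finset.sum_congr rfl h3, integral_const, measureReal_restrict_apply_univ, smul_eq_mul,
    ← Finset.sum_mul, ← Finset.add_sum_erase _ _ ha]
  change _ * (_ - vol κ * _) = _
  field_simp
  ring

end IsSimplex

/-! ### Bubble functions of faces and simplices -/

/-- The product of the barycentric coordinates of the vertices in `τ`. -/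
def bubble (κ τ : Spx d) (x : Pt d) : ℝ := ∏ b ∈ τ, hat κ b x

lemma contDiff_bubble (κ τ : Spx d) : ContDiff ℝ ∞ (bubble κ τ) :=
  contDiff_prod fun b _ => contDiff_hat κ b

namespace IsSimplex

variable {κ κ' : Spx d} (h : IsSimplex κ)

include h

lemma integral_bubble_pos {τ : Spx d} (hτ : τ ⊆ κ) : 0 < ∫ x in hull κ, bubble κ τ x := by
  have hc := (contDiff_bubble κ τ).continuous
  rw [setIntegral_pos_iff_support_of_nonneg_ae]
  · refine (isOpen_interior.measure_pos volume h.interior_nonempty).trans_le (measure_mono ?_)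
    intro x hx
    refine ⟨?_, interior_subset hx⟩
    rw [h.mem_interior_hull] at hx
    exact (Finset.prod_pos fun b hb => hx b (hτ hb)).ne'
  · refine (ae_restrict_iff' (measurableSet_hull κ)).2 (Eventually.of_forall fun x hx => ?_)
    exact Finset.prod_nonneg fun b hb => h.hat_nonneg hx (hτ hb)
  · exact Continuous.integrableOn_hull hc κ

/-- This positivity is what later lets a face bubble detect the jump across its face. -/
lemma traceMean_bubble_pos {σ : Spx d} (hσ : σ ∈ facets κ) : 0 < traceMean κ σ (bubble κ σ) := by
  have hd := h.natCast_pos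
  have hv := h.vol_pos
  obtain ⟨a, ha, rfl⟩ := (mem_facets h.card_eq).1 hσ
  rw [traceMean, opp_erase ha]
  -- Each of the `d` factors vanishes at `a`, so the bubble is homogeneous of degree `d` about `a`;
  -- Euler's identity gives one of the two terms `d * bubble`.
  have h1 : ∀ x, fderiv ℝ (bubble κ (κ.erase a)) x (x - a) + d * bubble κ (κ.erase a) x =
      (2 * d) * bubble κ (κ.erase a) x := fun x => by
    have hder := HasFDerivAt.finsetProd (u := κ.erase a) (x := x)
      fun b _ => (hasGradientAt_hat κ b x).hasFDerivAt
    have : fderiv ℝ (bubble κ (κ.erase a)) x (x - a) = d * bubble κ (κ.erase a) x := by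
      rw [show bubble κ (κ.erase a) = fun y => ∏ b ∈ κ.erase a, hat κ b y from rfl, hder.fderiv,
        _root_.sum_apply]
      rw [Finset.sum_congr rfl (g := fun _ => ∏ b ∈ κ.erase a, hat κ b x), Finset.sum_const,
        h.card_erase ha, nsmul_eq_mul]
      intro b hb
      rw [Finset.mem_erase] at hb
      simp only [_root_.smul_apply, InnerProductSpace.toDual_apply_apply, smul_eq_mul]
      rw [← hat_sub_hat, h.hat_of_ne hb.2 ha (Ne.symm hb.1), sub_zero,
        Finset.prod_erase_mul _ _ (Finset.mem_erase.2 hb)]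
    rw [this]; ring
  simp only [h1]
  rw [integral_const_mul]
  have := h.integral_bubble_pos (Finset.erase_subset a κ)
  positivity

end IsSimplex

/-! ### Surface measure of the faces -/

namespace IsSimplex

variable {κ : Spx d} (h : IsSimplex κ)

include h

lemma hat_eq_one_add {a : Pt d} (ha : a ∈ κ) (x : Pt d) :
    hat κ a x = 1 + inner ℝ (hatGrad κ a) (x - a) := by
  rw [hat_eq_add κ a x a, h.hat_self ha]

lemma inner_altitude_sub {a : Pt d} (ha : a ∈ κ) (x : Pt d) :
    inner ℝ (altitude κ (κ.erase a)) (x - a) =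
      ‖altitude κ (κ.erase a)‖ ^ 2 * (hat κ a x - 1) := by
  have := norm_pos_iff.2 (h.altitude_ne_zero ha)
  rw [h.hat_eq_one_add ha, hatGrad, real_inner_smul_left]
  field_simp
  ring

/-- Level sets of a coordinate are the homothetic copies of the opposite face. The value `t = 0` is
excluded because the inverse homothety is needed; it is a null set for the slicing below. -/
lemma slice_eq {a : Pt d} (ha : a ∈ κ) {t : ℝ} (ht : 0 < t) (ht1 : t ≤ 1) :
    {x | x ∈ hull κ ∧ hat κ a x = 1 - t} = AffineMap.homothety a t '' hull (κ.erase a) := by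
  ext x
  simp only [Set.mem_ofPred_eq, Set.mem_image, AffineMap.homothety_apply, vsub_eq_sub, vadd_eq_add]
  have hhat : ∀ (s : ℝ) (b y : Pt d), hat κ b (s • (y - a) + a) =
      hat κ b a + s * (hat κ b y - hat κ b a) := fun s b y => by
    rw [hat_eq_add κ b _ a, add_sub_cancel_right, real_inner_smul_right, ← hat_sub_hat]
  constructor
  · rintro ⟨hx, hxt⟩
    refine ⟨t⁻¹ • (x - a) + a, ?_, by simp [smul_smul, ht.ne']⟩
    have h0 : hat κ a (t⁻¹ • (x - a) + a) = 0 := by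
      rw [hhat, h.hat_self ha, hxt]; field_simp; ring
    rw [h.mem_hull_of_subset (Finset.erase_subset _ _), h.mem_hull]
    refine ⟨fun b hb => ?_, fun b hb hb' => ?_⟩
    · by_cases hba : b = a
      · rw [hba, h0]
      · rw [hhat, h.hat_of_ne hb ha (Ne.symm hba)]
        have := h.hat_nonneg hx hb
        simp only [sub_zero, zero_add]; positivity
    · have : b = a := by by_contra hne; exact hb' (Finset.mem_erase.2 ⟨hne, hb⟩)
      rw [this, h0]
  · rintro ⟨y, hy, rfl⟩
    rw [h.mem_hull_of_subset (Finset.erase_subset _ _)] at hy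
    have hya : hat κ a y = 0 := hy.2 a ha (by simp)
    refine ⟨?_, by rw [hhat, h.hat_self ha, hya]; ring⟩
    have := (convex_hull κ) (subset_convexHull ℝ _ (Finset.mem_coe.2 ha)) hy.1
      (by linarith : 0 ≤ 1 - t) ht.le (by ring)
    convert this using 1
    simp only [sub_smul, one_smul, smul_sub]; abel

/-- The pyramid formula. The volume is integrated over slices orthogonal to the altitude; the slice
at fraction `t` from the apex has measure `t ^ (d - 1)` times that of the face, and `∫ t ^ (d - 1) =
1 / d` on `[0, 1]`. -/
lemma area_mul_norm_altitude {a : Pt d} (ha : a ∈ κ) :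
    area (κ.erase a) * ‖altitude κ (κ.erase a)‖ = d * vol κ := by
  have hd := h.natCast_pos
  have hne := h.altitude_ne_zero ha
  -- With this sign, `t` runs from `0` at the apex to `1` at the face.
  set v := -altitude κ (κ.erase a) with hv
  have hv0 : v ≠ 0 := neg_ne_zero.2 hne
  have key := EuclideanGeometry.euclideanHausdorffMeasure_eq_lintegral a hv0 (measurableSet_hull κ)
  rw [InnerProductSpace.euclideanHausdorffMeasure_eq_volume, finrank_euclideanSpace_fin] at key
  set A : ENNReal := (μHE[d - 1] : Measure (Pt d)) (hull (κ.erase a)) with hA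
  have hslice : ∀ t : ℝ, hull κ ∩ (AffineSubspace.mk' (t • v +ᵥ a) (ℝ ∙ v)ᗮ : Set (Pt d)) =
      {x | x ∈ hull κ ∧ hat κ a x = 1 - t} := by
    intro t
    ext x
    simp only [Set.mem_inter_iff, SetLike.mem_coe, AffineSubspace.mem_mk', Set.mem_ofPred_eq,
      Submodule.mem_orthogonal_singleton_iff_inner_right]
    refine and_congr_right fun _ => ?_
    have : x -ᵥ (t • v +ᵥ a) = (x - a) - t • v := by
      simp only [vsub_eq_sub, vadd_eq_add]; abel
    rw [this, inner_sub_right, real_inner_smul_right, real_inner_self_eq_norm_sq, hv,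
      inner_neg_left, norm_neg, h.inner_altitude_sub ha]
    have hp : 0 < ‖altitude κ (κ.erase a)‖ ^ 2 := by positivity
    constructor
    · intro e
      have : ‖altitude κ (κ.erase a)‖ ^ 2 * (hat κ a x - (1 - t)) = 0 := by linarith
      rcases mul_eq_zero.1 this with e | e
      · exact absurd e hp.ne'
      · linarith
    · intro e; rw [e]; ring
  have hint : ∀ᵐ t : ℝ, (μHE[d - 1] : Measure (Pt d))
      (hull κ ∩ (AffineSubspace.mk' (t • v +ᵥ a) (ℝ ∙ v)ᗮ : Set (Pt d))) =
      (Set.Icc (0 : ℝ) 1).indicator (fun t => ENNReal.ofReal (t ^ (d - 1)) * A) t := by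
    filter_upwards [Measure.ae_ne volume (0 : ℝ)] with t ht
    rw [hslice]
    by_cases htI : t ∈ Set.Icc (0 : ℝ) 1
    · have ht0 : 0 < t := lt_of_le_of_ne htI.1 (Ne.symm ht)
      rw [Set.indicator_of_mem htI, h.slice_eq ha ht0 htI.2,
        euclideanHausdorffMeasure_homothety_image _ _ ht, ← hA, ENNReal.smul_def, smul_eq_mul]
      congr 1
      rw [ENNReal.ofReal_pow ht0.le, ENNReal.coe_pow]
      congr 1
      rw [← enorm_eq_nnnorm, Real.enorm_of_nonneg ht0.le]
    · rw [Set.indicator_of_notMem htI]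
      suffices hemp : {x | x ∈ hull κ ∧ hat κ a x = 1 - t} = ∅ by rw [hemp, measure_empty]
      ext x
      simp only [Set.mem_ofPred_eq, Set.mem_empty_iff_false, iff_false, not_and]
      intro hx e
      have h1 := h.hat_nonneg hx ha
      have h2 := h.hat_le_one hx ha
      exact htI ⟨by linarith, by linarith⟩
  rw [lintegral_congr_ae hint, lintegral_indicator measurableSet_Icc,
    lintegral_mul_const _ (by fun_prop), ← ofReal_integral_eq_lintegral_ofReal] at key
  · rw [integral_Icc_eq_integral_Ioc, ← intervalIntegral.integral_of_le zero_le_one, integral_pow,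
      Nat.sub_add_cancel h.one_le, one_pow, zero_pow (by have := h.one_le; omega), sub_zero] at key
    have h2 := congrArg ENNReal.toReal key
    rw [ENNReal.toReal_mul, ENNReal.toReal_mul, ENNReal.toReal_ofReal (by positivity)] at h2
    change vol κ = _ * (_ * area (κ.erase a)) at h2
    rw [h2, hv, enorm_neg, toReal_enorm]
    have : ((d - 1 : ℕ) : ℝ) + 1 = d := by
      rw [Nat.cast_sub h.one_le]; simp
    rw [this]
    field_simp
  · exact (continuous_pow _).continuousOn.integrableOn_compact isCompact_Icc
  · exact (ae_restrict_iff' measurableSet_Icc).2 (Eventually.of_forall fun t ht => pow_nonneg ht.1 _)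

lemma area_pos {σ : Spx d} (hσ : σ ∈ facets κ) : 0 < area σ := by
  obtain ⟨a, ha, rfl⟩ := (mem_facets h.card_eq).1 hσ
  have h1 := h.area_mul_norm_altitude ha
  have h2 := norm_pos_iff.2 (h.altitude_ne_zero ha)
  have h3 := mul_pos h.natCast_pos h.vol_pos
  rw [← h1] at h3
  exact (pos_iff_pos_of_mul_pos h3).2 h2

lemma norm_outNormal {σ : Spx d} (hσ : σ ∈ facets κ) : ‖outNormal κ σ‖ = 1 := by
  obtain ⟨a, ha, rfl⟩ := (mem_facets h.card_eq).1 hσ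
  have h2 := norm_pos_iff.2 (h.altitude_ne_zero ha)
  rw [outNormal, norm_neg, norm_smul, norm_inv, norm_norm, inv_mul_cancel₀ h2.ne']

lemma outNormal_eq {a : Pt d} (ha : a ∈ κ) :
    outNormal κ (κ.erase a) = -(‖altitude κ (κ.erase a)‖ • hatGrad κ a) := by
  have h2 := norm_pos_iff.2 (h.altitude_ne_zero ha)
  rw [outNormal, hatGrad, smul_smul]
  congr 2
  field_simp

/-- The normals to a face form a line. Any `w` expands in the differences `b - c` with `c` a vertex
of the face, and only `b = a` contributes to its product with such a normal. -/
lemma eq_smul_hatGrad {a : Pt d} (ha : a ∈ κ) {v : Pt d}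
    (hv : ∀ b ∈ κ.erase a, ∀ c ∈ κ.erase a, inner ℝ v (b - c) = 0) :
    ∃ r : ℝ, v = r • hatGrad κ a := by
  obtain ⟨c, hc⟩ := h.erase_nonempty ha
  refine ⟨inner ℝ v (a - c), ?_⟩
  refine ext_inner_right ℝ fun w => ?_
  have h1 := h.sum_inner_hatGrad_smul w
  have h2 : ∑ b ∈ κ, inner ℝ (hatGrad κ b) w = 0 := by
    rw [← sum_inner, h.sum_hatGrad, inner_zero_left]
  have h3 : w = ∑ b ∈ κ, inner ℝ (hatGrad κ b) w • (b - c) := by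
    simp only [smul_sub, Finset.sum_sub_distrib, h1, ← Finset.sum_smul, h2, zero_smul, sub_zero]
  conv_lhs => rw [h3]
  rw [inner_sum, Finset.sum_eq_single_of_mem a ha, real_inner_smul_right, real_inner_smul_left,
    mul_comm]
  intro b hb hne
  rw [real_inner_smul_right, hv b (Finset.mem_erase.2 ⟨hne, hb⟩) c hc, mul_zero]

lemma eq_inner_smul_outNormal {σ : Spx d} (hσ : σ ∈ facets κ) {v : Pt d}
    (hv : ∀ b ∈ σ, ∀ c ∈ σ, inner ℝ v (b - c) = 0) :
    v = (inner ℝ (outNormal κ σ) v : ℝ) • outNormal κ σ := by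
  have h1 := h.norm_outNormal hσ
  obtain ⟨a, ha, rfl⟩ := (mem_facets h.card_eq).1 hσ
  have h2 := norm_pos_iff.2 (h.altitude_ne_zero ha)
  obtain ⟨r, hr⟩ := h.eq_smul_hatGrad ha hv
  have h3 : v = (-(r * ‖altitude κ (κ.erase a)‖⁻¹)) • outNormal κ (κ.erase a) := by
    rw [h.outNormal_eq ha, smul_neg, neg_smul, neg_neg, smul_smul, mul_assoc,
      inv_mul_cancel₀ h2.ne', mul_one]
    exact hr
  have h4 : (inner ℝ (outNormal κ (κ.erase a)) v : ℝ) = -(r * ‖altitude κ (κ.erase a)‖⁻¹) := by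
    rw [h3, real_inner_smul_right, real_inner_self_eq_norm_sq, h1]; ring
  rw [h4]; exact h3

lemma inner_outNormal_sq {σ : Spx d} (hσ : σ ∈ facets κ) {v : Pt d} (hv1 : ‖v‖ = 1)
    (hv : ∀ b ∈ σ, ∀ c ∈ σ, inner ℝ v (b - c) = 0) :
    (inner ℝ (outNormal κ σ) v : ℝ) * inner ℝ (outNormal κ σ) v = 1 := by
  have h1 := congrArg norm (h.eq_inner_smul_outNormal hσ hv)
  rw [norm_smul, h.norm_outNormal hσ, hv1, mul_one, Real.norm_eq_abs] at h1
  rw [← abs_mul_abs_self, ← h1, mul_one]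

lemma area_mul_inner {σ : Spx d} (hσ : σ ∈ facets κ) (q : RT d) {x : Pt d} (hx : x ∈ hull σ) :
    area σ * inner ℝ (rtEval q x) (outNormal κ σ) = flux κ σ q := by
  obtain ⟨a, ha, rfl⟩ := (mem_facets h.card_eq).1 hσ
  have h2 := norm_pos_iff.2 (h.altitude_ne_zero ha)
  have hx0 : hat κ a x = 0 :=
    ((h.mem_hull_of_subset (Finset.erase_subset _ _)).1 hx).2 a ha (by simp)
  rw [h.flux_eq ha q hx0, ← h.area_mul_norm_altitude ha, h.outNormal_eq ha, inner_neg_right,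
    real_inner_smul_right, real_inner_comm]
  ring

/-- The normal component is constant on the face, so the surface integral is the area times that
constant, which `area_mul_inner` identifies with the algebraic flux. -/
lemma integral_inner_normal {σ : Spx d} (hσ : σ ∈ facets κ) (q : RT d) {v : Pt d}
    (hv : ∀ b ∈ σ, ∀ c ∈ σ, inner ℝ v (b - c) = 0) :
    ∫ x in hull σ, inner ℝ (rtEval q x) v ∂μHE[d - 1] =
      inner ℝ (outNormal κ σ) v * flux κ σ q := by
  have hA := h.area_pos hσ
  have h1 : ∀ x ∈ hull σ, (inner ℝ (rtEval q x) v : ℝ) =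
      inner ℝ (outNormal κ σ) v * ((area σ)⁻¹ * flux κ σ q) := fun x hx => by
    conv_lhs => rw [h.eq_inner_smul_outNormal hσ hv]
    rw [real_inner_smul_right, ← h.area_mul_inner hσ q hx, inv_mul_cancel_left₀ hA.ne']
  rw [setIntegral_congr_fun (isClosed_hull σ).measurableSet h1, integral_const,
    measureReal_restrict_apply_univ, smul_eq_mul]
  change area σ * _ = _
  field_simp

end IsSimplex

open scoped Convolution

/-! ### Lipschitz functions vanishing outside a bounded open set belong to `H¹₀` -/

/-- Dominated convergence: a uniform bound on a finite measure space upgrades almost everywhere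
convergence to `L²` convergence. -/
lemma tendsto_eLpNorm_sub_of_bounded {E : Type*} [NormedAddCommGroup E]
    {μ : Measure (Pt d)} [IsFiniteMeasure μ] {f : ℕ → Pt d → E} {g : Pt d → E} {B : ℝ}
    (hf : ∀ n, AEStronglyMeasurable (f n) μ) (hg : AEStronglyMeasurable g μ)
    (hB : ∀ n x, ‖f n x‖ ≤ B) (hgB : ∀ x, ‖g x‖ ≤ B)
    (hlim : ∀ᵐ x ∂μ, Tendsto (fun n => f n x) atTop (𝓝 (g x))) :
    Tendsto (fun n => eLpNorm (fun x => f n x - g x) 2 μ) atTop (𝓝 0) := by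
  have key : Tendsto (fun n => ∫⁻ x, ‖f n x - g x‖ₑ ^ (2 : ℝ) ∂μ) atTop
      (𝓝 (∫⁻ _, 0 ∂μ)) := by
    refine tendsto_lintegral_of_dominated_convergence' (fun _ => ENNReal.ofReal (2 * B) ^ (2 : ℝ))
      (fun n => ((hf n).sub hg).enorm.pow_const _) (fun n => Eventually.of_forall fun x => ?_) ?_ ?_
    · refine ENNReal.rpow_le_rpow ?_ (by norm_num)
      rw [← ofReal_norm]
      refine ENNReal.ofReal_le_ofReal ((norm_sub_le _ _).trans ?_)
      linarith [hB n x, hgB x]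
    · rw [lintegral_const]
      exact ENNReal.mul_ne_top (ENNReal.rpow_ne_top_of_nonneg (by norm_num) ENNReal.ofReal_ne_top)
        (measure_ne_top _ _)
    · filter_upwards [hlim] with x hx
      have h1 : Tendsto (fun n => ‖f n x - g x‖ₑ) atTop (𝓝 0) := by
        have := (tendsto_sub_nhds_zero_iff.2 hx).enorm
        simpa using this
      have := h1.ennrpow_const 2
      simpa using this
  rw [lintegral_zero] at key
  have h2 := key.ennrpow_const (1 / 2)
  have h3 : ((0 : ENNReal) ^ (1 / 2 : ℝ)) = 0 := by simp
  rw [h3] at h2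
  refine h2.congr fun n => ?_
  rw [eLpNorm_eq_lintegral_rpow_enorm_toReal (by norm_num) (by norm_num)]
  simp

lemma norm_convolution_normed_le {E : Type*} [NormedAddCommGroup E] [NormedSpace ℝ E]
    (ρ : ContDiffBump (0 : Pt d)) {g : Pt d → E} {B : ℝ} (hB : ∀ x, ‖g x‖ ≤ B) (x : Pt d) :
    ‖(ρ.normed volume ⋆[ContinuousLinearMap.lsmul ℝ ℝ, volume] g) x‖ ≤ B := by
  have h1 : B = ∫ t, ρ.normed volume t * B := by
    rw [integral_mul_const, ρ.integral_normed, one_mul]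
  rw [h1]
  refine norm_integral_le_of_norm_le (ρ.integrable_normed.mul_const B)
    (Eventually.of_forall fun t => ?_)
  rw [ContinuousLinearMap.lsmul_apply, norm_smul, Real.norm_of_nonneg (ρ.nonneg_normed t)]
  exact mul_le_mul_of_nonneg_left (hB _) (ρ.nonneg_normed t)

/-- By Rademacher's theorem `w` is differentiable almost everywhere, and the Lipschitz constant
dominates the difference quotients. The derivative may therefore fall on `w` instead of on the
mollifier. -/
lemma hasFDerivAt_convolution_of_lipschitz (ρ : ContDiffBump (0 : Pt d)) {w : Pt d → ℝ}
    {C : NNReal} (hw : LipschitzWith C w) (x₀ : Pt d) :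
    HasFDerivAt (ρ.normed volume ⋆[ContinuousLinearMap.lsmul ℝ ℝ, volume] w)
      ((ρ.normed volume ⋆[ContinuousLinearMap.lsmul ℝ ℝ, volume] (fderiv ℝ w)) x₀) x₀ := by
  have hρc : Continuous (ρ.normed volume) := ρ.continuous_normed
  have hdiff : ∀ᵐ t : Pt d, DifferentiableAt ℝ w (x₀ - t) :=
    (Measure.measurePreserving_sub_left volume x₀).quasiMeasurePreserving.ae
      hw.ae_differentiableAt
  refine (hasFDerivAt_integral_of_dominated_loc_of_lip (s := Set.univ) (μ := volume)
    (F := fun x t => ρ.normed volume t • w (x - t))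
    (F' := fun t => ρ.normed volume t • fderiv ℝ w (x₀ - t))
    (bound := fun t => ρ.normed volume t * C) univ_mem
    (Eventually.of_forall fun x => ?_) ?_ ?_ (Eventually.of_forall fun t => ?_)
    (ρ.integrable_normed.mul_const _) ?_).2
  · have := hw.continuous
    exact (show Continuous fun t => ρ.normed volume t • w (x - t) by fun_prop).aestronglyMeasurable
  · have := hw.continuous
    exact (show Continuous fun t => ρ.normed volume t • w (x₀ - t) by
      fun_prop).integrable_of_hasCompactSupport ρ.hasCompactSupport_normed.smul_right
  · exact hρc.aestronglyMeasurable.smul ((measurable_fderiv ℝ w).comp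
      (measurable_const.sub measurable_id)).aestronglyMeasurable
  · refine LipschitzWith.lipschitzOnWith (LipschitzWith.of_dist_le_mul fun x y => ?_)
    have h1 := hw.dist_le_mul (x - t) (y - t)
    rw [dist_sub_right] at h1
    rw [dist_smul₀, Real.norm_of_nonneg (ρ.nonneg_normed t)]
    have h2 : (Real.nnabs (ρ.normed volume t * C) : ℝ) = ρ.normed volume t * C := by
      rw [Real.coe_nnabs]
      exact abs_of_nonneg (mul_nonneg (ρ.nonneg_normed t) C.2)
    rw [h2, mul_assoc]
    exact mul_le_mul_of_nonneg_left h1 (ρ.nonneg_normed t)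
  · filter_upwards [hdiff] with t ht
    have h1 : HasFDerivAt (fun x => w (x - t)) (fderiv ℝ w (x₀ - t)) x₀ := by
      exact ht.hasFDerivAt.comp x₀ ((hasFDerivAt_id x₀).sub_const t)
    exact h1.fun_const_smul _

lemma eLpNorm_gradient_sub (μ : Measure (Pt d)) (φ w : Pt d → ℝ) :
    eLpNorm (fun x => gradient φ x - gradient w x) 2 μ =
      eLpNorm (fun x => fderiv ℝ φ x - fderiv ℝ w x) 2 μ := by
  refine eLpNorm_congr_norm_ae (Eventually.of_forall fun x => ?_)
  rw [gradient, gradient, ← map_sub, LinearIsometryEquiv.norm_map]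

/-- Mollification of a Lipschitz function with compact support in `O`. -/
lemma exists_test_seq_of_lipschitz {O : Set (Pt d)} (hO : IsOpen O) (hOb : volume O < ⊤)
    {w : Pt d → ℝ} {C : NNReal} (hw : LipschitzWith C w) (hc : HasCompactSupport w)
    (hs : tsupport w ⊆ O) :
    ∃ φ : ℕ → Pt d → ℝ, (∀ n, IsTest O (φ n)) ∧
      Tendsto (fun n => eLpNorm (fun x => φ n x - w x) 2 (volume.restrict O)) atTop (𝓝 0) ∧
      Tendsto (fun n => eLpNorm (fun x => gradient (φ n) x - gradient w x) 2 (volume.restrict O))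
        atTop (𝓝 0) := by
  have : IsFiniteMeasure (volume.restrict O) := ⟨by simpa using hOb⟩
  obtain ⟨δ, hδ, hδO⟩ := IsCompact.exists_cthickening_subset_open hc hO hs
  -- Outer radii are at most `δ`, keeping the supports inside `O`, and tend to zero; the fixed ratio
  -- of inner to outer radius is what almost everywhere convergence of the mollifications requires.
  let ρ : ℕ → ContDiffBump (0 : Pt d) := fun n =>
    { rIn := δ / (n + 1) / 2
      rOut := δ / (n + 1)
      rIn_pos := by positivity
      rIn_lt_rOut := half_lt_self (by positivity) }
  have hout : Tendsto (fun n => (ρ n).rOut) atTop (𝓝 0) :=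
    tendsto_const_div_atTop_nhds_zero_nat δ |>.comp (tendsto_add_atTop_nat 1) |>.congr fun n => by
      simp [ρ]
  have hK : ∀ᶠ n in atTop, (ρ n).rOut ≤ 2 * (ρ n).rIn := Eventually.of_forall fun n => by
    simp only [ρ]; linarith
  obtain ⟨B, hB⟩ := (hc.isCompact_range hw.continuous).isBounded.exists_norm_le
  have hB' : ∀ x, ‖w x‖ ≤ B := fun x => hB _ ⟨x, rfl⟩
  have hC : ∀ x, ‖fderiv ℝ w x‖ ≤ C := fun x => norm_fderiv_le_of_lipschitz ℝ hw
  have hwl : LocallyIntegrable w volume := hw.continuous.locallyIntegrable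
  have hfm : AEStronglyMeasurable (fderiv ℝ w) volume :=
    (measurable_fderiv ℝ w).aestronglyMeasurable
  have hfl : LocallyIntegrable (fderiv ℝ w) volume :=
    (memLp_top_of_bound hfm C (Eventually.of_forall hC)).locallyIntegrable le_top
  set φ : ℕ → Pt d → ℝ := fun n =>
    (ρ n).normed volume ⋆[ContinuousLinearMap.lsmul ℝ ℝ, volume] w with hφ
  have hderiv : ∀ n x, fderiv ℝ (φ n) x =
      ((ρ n).normed volume ⋆[ContinuousLinearMap.lsmul ℝ ℝ, volume] (fderiv ℝ w)) x := fun n x =>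
    (hasFDerivAt_convolution_of_lipschitz (ρ n) hw x).fderiv
  have hcd : ∀ n, ContDiff ℝ ∞ (φ n) := fun n =>
    (ρ n).hasCompactSupport_normed.contDiff_convolution_left _ (ρ n).contDiff_normed hwl
  have hsupp : ∀ n, Function.support (φ n) ⊆ Metric.cthickening δ (tsupport w) := by
    intro n x hx
    by_contra hx'
    apply hx
    refine integral_eq_zero_of_ae (Eventually.of_forall fun t => ?_)
    change (ρ n).normed volume t • w (x - t) = 0
    by_cases ht : (ρ n).normed volume t = 0
    · rw [ht, zero_smul]
    · have ht' : t ∈ Metric.ball (0 : Pt d) (ρ n).rOut := by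
        rw [← (ρ n).support_normed_eq (μ := volume)]; exact ht
      have : w (x - t) = 0 := by
        by_contra hne
        apply hx'
        refine Metric.mem_cthickening_of_dist_le x (x - t) δ _ (subset_tsupport w hne) ?_
        rw [dist_eq_norm, sub_sub_cancel]
        rw [mem_ball_zero_iff] at ht'
        refine ht'.le.trans ?_
        exact div_le_self hδ.le (by linarith [Nat.cast_nonneg (α := ℝ) n])
      rw [this, smul_zero]
  have hts : ∀ n, tsupport (φ n) ⊆ Metric.cthickening δ (tsupport w) := fun n =>
    closure_minimal (hsupp n) Metric.isClosed_cthickening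
  refine ⟨φ, fun n => ⟨hcd n, ?_, (hts n).trans hδO⟩, ?_, ?_⟩
  · exact (IsCompact.cthickening hc).of_isClosed_subset (isClosed_tsupport _) (hts n)
  · refine tendsto_eLpNorm_sub_of_bounded (B := B)
      (fun n => (hcd n).continuous.aestronglyMeasurable) hw.continuous.aestronglyMeasurable
      (fun n x => norm_convolution_normed_le _ hB' x) hB' ?_
    exact ae_restrict_of_ae
      (ContDiffBump.ae_convolution_tendsto_right_of_locallyIntegrable hout hK hwl)
  · simp only [eLpNorm_gradient_sub]
    refine tendsto_eLpNorm_sub_of_bounded (B := C)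
      (fun n => ((hcd n).continuous_fderiv (by simp)).aestronglyMeasurable)
      (measurable_fderiv ℝ w).aestronglyMeasurable
      (fun n x => ?_) hC ?_
    · rw [hderiv]; exact norm_convolution_normed_le _ hC x
    · simp only [hderiv]
      exact ae_restrict_of_ae
        (ContDiffBump.ae_convolution_tendsto_right_of_locallyIntegrable hout hK hfl)

/-! ### Truncation near the zero set and membership in `H¹₀` -/

/-- Truncation of small values: `t ↦ sign t * max (|t| - ε) 0`. -/
def truncate (ε t : ℝ) : ℝ := max (t - ε) 0 - max (-t - ε) 0

lemma abs_truncate_sub_le (ε s t : ℝ) : |truncate ε s - truncate ε t| ≤ 2 * |s - t| := by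
  have h1 := abs_max_sub_max_le_abs (s - ε) (t - ε) 0
  have h2 := abs_max_sub_max_le_abs (-s - ε) (-t - ε) 0
  have e1 : |s - ε - (t - ε)| = |s - t| := by congr 1; ring
  have e2 : |-s - ε - (-t - ε)| = |s - t| := by
    rw [← abs_neg]; congr 1; ring
  rw [e1] at h1
  rw [e2] at h2
  calc |truncate ε s - truncate ε t|
      = |(max (s - ε) 0 - max (t - ε) 0) - (max (-s - ε) 0 - max (-t - ε) 0)| := by
        congr 1; unfold truncate; ring
    _ ≤ _ := (abs_sub _ _).trans (by linarith)

lemma truncate_of_abs_le {ε t : ℝ} (h : |t| ≤ ε) : truncate ε t = 0 := by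
  rw [abs_le] at h
  rw [truncate, max_eq_right (by linarith), max_eq_right (by linarith), sub_zero]

lemma truncate_of_lt {ε t : ℝ} (hε : 0 ≤ ε) (h : ε < t) : truncate ε t = t - ε := by
  rw [truncate, max_eq_left (by linarith), max_eq_right (by linarith), sub_zero]

lemma truncate_of_lt_neg {ε t : ℝ} (hε : 0 ≤ ε) (h : t < -ε) : truncate ε t = t + ε := by
  rw [truncate, max_eq_right (by linarith), max_eq_left (by linarith)]; ring

lemma abs_truncate_sub_self {ε t : ℝ} (hε : 0 ≤ ε) : |truncate ε t - t| ≤ ε := by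
  rcases lt_trichotomy t (-ε) with h | h | h
  · rw [truncate_of_lt_neg hε h, add_sub_cancel_left, abs_of_nonneg hε]
  · rw [truncate_of_abs_le (by rw [h, abs_neg, abs_of_nonneg hε]), zero_sub, abs_neg, h, abs_neg,
      abs_of_nonneg hε]
  · rcases le_or_gt t ε with h' | h'
    · rw [truncate_of_abs_le (abs_le.2 ⟨h.le, h'⟩), zero_sub, abs_neg]
      exact abs_le.2 ⟨h.le, h'⟩
    · rw [truncate_of_lt hε h', sub_sub_cancel_left, abs_neg, abs_of_nonneg hε]

/-- Where `w x ≠ 0` the truncation eventually differs from `w` by a constant near `x`; where `w x =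
0` it vanishes near `x`. The derivatives are thus eventually constant. -/
lemma tendsto_fderiv_truncate {w : Pt d → ℝ} (hw : Continuous w) {ε : ℕ → ℝ} (hε : ∀ n, 0 < ε n)
    (hlim : Tendsto ε atTop (𝓝 0)) {x : Pt d} (hx : w x = 0 → fderiv ℝ w x = 0) :
    Tendsto (fun n => fderiv ℝ (fun y => truncate (ε n) (w y)) x) atTop (𝓝 (fderiv ℝ w x)) := by
  rcases lt_trichotomy (w x) 0 with h | h | h
  · refine tendsto_const_nhds.congr' ?_
    filter_upwards [hlim.eventually (gt_mem_nhds (neg_pos.2 h))] with n hn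
    have : (fun y => truncate (ε n) (w y)) =ᶠ[𝓝 x] fun y => w y + ε n := by
      filter_upwards [hw.continuousAt.eventually (gt_mem_nhds (show w x < -ε n by linarith))] with
        y hy using truncate_of_lt_neg (hε n).le hy
    rw [this.fderiv_eq, fderiv_add_const]
  · rw [hx h]
    refine tendsto_const_nhds.congr fun n => ?_
    have : (fun y => truncate (ε n) (w y)) =ᶠ[𝓝 x] fun _ => 0 := by
      have hn : |w x| < ε n := by rw [h, abs_zero]; exact hε n
      filter_upwards [hw.abs.continuousAt.eventually (gt_mem_nhds hn)] with
        y hy using truncate_of_abs_le hy.le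
    rw [this.fderiv_eq]; simp
  · refine tendsto_const_nhds.congr' ?_
    filter_upwards [hlim.eventually (gt_mem_nhds h)] with n hn
    have : (fun y => truncate (ε n) (w y)) =ᶠ[𝓝 x] fun y => w y - ε n := by
      filter_upwards [hw.continuousAt.eventually (lt_mem_nhds hn)] with
        y hy using truncate_of_lt (hε n).le hy
    rw [this.fderiv_eq, fderiv_sub_const]

lemma IsTest.lipschitz {O : Set (Pt d)} {φ : Pt d → ℝ} (h : IsTest O φ) :
    ∃ C, LipschitzWith C φ :=
  ⟨_, (ContDiff.lipschitzWith_of_hasCompactSupport h.2.1 h.1 (by simp)).choose_spec⟩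

lemma gradient_apply (φ : Pt d → ℝ) (x : Pt d) (i : Fin d) :
    gradient φ x i = fderiv ℝ φ x (EuclideanSpace.single i 1) := by
  rw [← inner_gradient_left, EuclideanSpace.inner_single_right]; simp

/-- Vanishing outside `O` lets both integrals be taken over the whole space, where integration by
parts against a Lipschitz function is available. -/
lemma hasWeakGrad_of_lipschitz {O : Set (Pt d)} (hOb : volume O < ⊤)
    {w : Pt d → ℝ} {C : NNReal} (hw : LipschitzWith C w) {B : ℝ} (hB : ∀ x, ‖w x‖ ≤ B)
    (h0 : ∀ x, x ∉ O → w x = 0) : HasWeakGrad O w (gradient w) := by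
  have : IsFiniteMeasure (volume.restrict O) := ⟨by simpa using hOb⟩
  have hC : ∀ x, ‖gradient w x‖ ≤ C := fun x => by
    rw [gradient, LinearIsometryEquiv.norm_map]; exact norm_fderiv_le_of_lipschitz ℝ hw
  have hgm : Measurable (gradient w) :=
    (InnerProductSpace.toDual ℝ (Pt d)).symm.continuous.measurable.comp (measurable_fderiv ℝ w)
  refine ⟨MemLp.of_bound hw.continuous.aestronglyMeasurable B (Eventually.of_forall hB),
    MemLp.of_bound hgm.aestronglyMeasurable C (Eventually.of_forall hC), fun φ hφ i => ?_⟩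
  obtain ⟨D, hD⟩ := hφ.lipschitz
  have hφ0 : ∀ x, x ∉ O → φ x = 0 := fun x hx =>
    image_eq_zero_of_notMem_tsupport fun h => hx (hφ.2.2 h)
  have key := hw.integral_lineDeriv_mul_eq (μ := volume) hD hφ.2.1 (EuclideanSpace.single i 1)
  rw [setIntegral_eq_integral_of_forall_compl_eq_zero fun x hx => by rw [h0 x hx, zero_mul],
    setIntegral_eq_integral_of_forall_compl_eq_zero fun x hx => by rw [hφ0 x hx, mul_zero],
    ← integral_neg]
  have e1 : ∫ x, -(gradient w x i * φ x) =
      -∫ x, lineDeriv ℝ w x (EuclideanSpace.single i 1) * φ x := by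
    rw [← integral_neg]
    refine integral_congr_ae ?_
    filter_upwards [hw.ae_differentiableAt] with x hx
    rw [gradient_apply, hx.lineDeriv_eq_fderiv]
  rw [e1, key, ← integral_neg]
  refine integral_congr_ae (Eventually.of_forall fun x => ?_)
  have hx : DifferentiableAt ℝ φ x := (hφ.1.differentiable (by simp)) x
  simp only [gradient_apply, hx.lineDeriv_eq_fderiv, map_neg]
  ring

/-- Truncating values below `ε` moves the support into `O`, after which mollification gives test
functions. The hypothesis on the zero set provides convergence of the gradients there; for piecewise
polynomial functions it is checked directly. -/
lemma memH10_of_lipschitz {O : Set (Pt d)} (hO : IsOpen O) (hOb : Bornology.IsBounded O)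
    {w : Pt d → ℝ} {C : NNReal} (hw : LipschitzWith C w) (h0 : ∀ x, x ∉ O → w x = 0)
    (hz : ∀ᵐ x ∂volume.restrict O, w x = 0 → fderiv ℝ w x = 0) : MemH10 O w (gradient w) := by
  have hOf : volume O < ⊤ := hOb.measure_lt_top
  have : IsFiniteMeasure (volume.restrict O) := ⟨by simpa using hOf⟩
  have hcs : HasCompactSupport w :=
    HasCompactSupport.intro hOb.isCompact_closure fun x hx => h0 x fun h => hx (subset_closure h)
  obtain ⟨B, hB⟩ := (hcs.isCompact_range hw.continuous).isBounded.exists_norm_le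
  have hB' : ∀ x, ‖w x‖ ≤ B := fun x => hB _ ⟨x, rfl⟩
  refine ⟨hasWeakGrad_of_lipschitz hOf hw hB' h0, ?_⟩
  set ε : ℕ → ℝ := fun n => 1 / ((n : ℝ) + 1) with hε
  have hεpos : ∀ n, 0 < ε n := fun n => by simp only [hε]; positivity
  have hεlim : Tendsto ε atTop (𝓝 0) := tendsto_one_div_add_atTop_nhds_zero_nat
  have hε1 : ∀ n, ε n ≤ 1 := fun n => by
    simp only [hε]; exact div_le_one_of_le₀ (by linarith [Nat.cast_nonneg (α := ℝ) n]) (by positivity)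
  set W : ℕ → Pt d → ℝ := fun n x => truncate (ε n) (w x) with hW
  have hWlip : ∀ n, LipschitzWith (2 * C) (W n) := fun n =>
    LipschitzWith.of_dist_le_mul fun x y => by
      have h1 := hw.dist_le_mul x y
      rw [Real.dist_eq] at h1 ⊢
      refine (abs_truncate_sub_le _ _ _).trans ?_
      push_cast
      linarith
  have hWsupp : ∀ n, tsupport (W n) ⊆ {x | ε n ≤ |w x|} := fun n => by
    refine closure_minimal (fun x hx => ?_) (isClosed_le continuous_const hw.continuous.abs)
    by_contra hlt
    simp only [Set.mem_ofPred_eq, not_le] at hlt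
    exact hx (truncate_of_abs_le hlt.le)
  have hWO : ∀ n, tsupport (W n) ⊆ O := fun n x hx => by
    by_contra hxO
    have := hWsupp n hx
    simp only [Set.mem_ofPred_eq, h0 x hxO, abs_zero] at this
    linarith [hεpos n]
  have hWc : ∀ n, HasCompactSupport (W n) := fun n =>
    hOb.isCompact_closure.of_isClosed_subset (isClosed_tsupport _) ((hWO n).trans subset_closure)
  have hl1 : Tendsto (fun n => eLpNorm (fun x => W n x - w x) 2 (volume.restrict O)) atTop
      (𝓝 0) := by
    refine tendsto_eLpNorm_sub_of_bounded (B := B + 1)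
      (fun n => (hWlip n).continuous.aestronglyMeasurable) hw.continuous.aestronglyMeasurable
      (fun n x => ?_) (fun x => (hB' x).trans (by linarith)) (Eventually.of_forall fun x => ?_)
    · have h1 := abs_truncate_sub_self (t := w x) (hεpos n).le
      have h2 := norm_add_le (W n x - w x) (w x)
      rw [sub_add_cancel] at h2
      rw [← Real.norm_eq_abs] at h1
      linarith [hB' x, hε1 n]
    · refine tendsto_sub_nhds_zero_iff.1 (squeeze_zero_norm (fun n => ?_) hεlim)
      exact abs_truncate_sub_self (hεpos n).le
  have hl2 : Tendsto (fun n => eLpNorm (fun x => gradient (W n) x - gradient w x) 2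
      (volume.restrict O)) atTop (𝓝 0) := by
    simp only [eLpNorm_gradient_sub]
    refine tendsto_eLpNorm_sub_of_bounded (B := (2 * C : NNReal))
      (fun n => (measurable_fderiv ℝ _).aestronglyMeasurable)
      (measurable_fderiv ℝ w).aestronglyMeasurable
      (fun n x => norm_fderiv_le_of_lipschitz ℝ (hWlip n))
      (fun x => (norm_fderiv_le_of_lipschitz ℝ hw).trans ?_) ?_
    · push_cast; linarith [C.2]
    · filter_upwards [hz] with x hx
      exact tendsto_fderiv_truncate hw.continuous hεpos hεlim hx
  -- A diagonal choice: the `n`-th truncation is mollified until its error in both norms is at most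
  -- `ε n`.
  have happ : ∀ n, ∃ φ, IsTest O φ ∧
      eLpNorm (fun x => φ x - W n x) 2 (volume.restrict O) ≤ ENNReal.ofReal (ε n) ∧
      eLpNorm (fun x => gradient φ x - gradient (W n) x) 2 (volume.restrict O) ≤
        ENNReal.ofReal (ε n) := fun n => by
    obtain ⟨φ, ht, h1, h2⟩ := exists_test_seq_of_lipschitz hO hOf (hWlip n) (hWc n) (hWO n)
    have hpos : (0 : ENNReal) < ENNReal.ofReal (ε n) := ENNReal.ofReal_pos.2 (hεpos n)
    obtain ⟨k, hk1, hk2⟩ := ((h1.eventually (ge_mem_nhds hpos)).and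
      (h2.eventually (ge_mem_nhds hpos))).exists
    exact ⟨φ k, ht k, hk1, hk2⟩
  choose φ hφt hφ1 hφ2 using happ
  have hεlim' : Tendsto (fun n => ENNReal.ofReal (ε n)) atTop (𝓝 0) := by
    have := ENNReal.tendsto_ofReal hεlim
    simpa using this
  have hgm : ∀ u : Pt d → ℝ, AEStronglyMeasurable (gradient u) (volume.restrict O) := fun u =>
    ((InnerProductSpace.toDual ℝ (Pt d)).symm.continuous.measurable.comp
      (measurable_fderiv ℝ u)).aestronglyMeasurable
  refine ⟨φ, hφt, ?_, ?_⟩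
  · refine tendsto_of_tendsto_of_tendsto_of_le_of_le tendsto_const_nhds
      (by simpa using hεlim'.add hl1) (fun _ => zero_le) fun n => ?_
    have e : (fun x => φ n x - w x) = (fun x => φ n x - W n x) + fun x => W n x - w x := by
      ext x; simp
    rw [e]
    refine (eLpNorm_add_le ?_ ?_ (by norm_num)).trans (add_le_add_left (hφ1 n) _)
    · exact ((hφt n).1.continuous.sub (hWlip n).continuous).aestronglyMeasurable
    · exact ((hWlip n).continuous.sub hw.continuous).aestronglyMeasurable
  · refine tendsto_of_tendsto_of_tendsto_of_le_of_le tendsto_const_nhds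
      (by simpa using hεlim'.add hl2) (fun _ => zero_le) fun n => ?_
    have e : (fun x => gradient (φ n) x - gradient w x) =
        (fun x => gradient (φ n) x - gradient (W n) x) + fun x => gradient (W n) x - gradient w x := by
      ext x; simp
    rw [e]
    exact (eLpNorm_add_le ((hgm _).sub (hgm _)) ((hgm _).sub (hgm _)) (by norm_num)).trans
      (add_le_add_left (hφ2 n) _)

/-! ### Testing the weak divergence with functions of `H¹₀` -/

lemma lintegral_enorm_inner_le {V : Type*} [NormedAddCommGroup V] [InnerProductSpace ℝ V]
    {μ : Measure (Pt d)} {v g : Pt d → V} (hv : AEStronglyMeasurable v μ)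
    (hg : AEStronglyMeasurable g μ) :
    ∫⁻ x, ‖(inner ℝ (v x) (g x) : ℝ)‖ₑ ∂μ ≤ eLpNorm v 2 μ * eLpNorm g 2 μ := by
  have := eLpNorm_le_eLpNorm_mul_eLpNorm_of_nnnorm (p := 2) (q := 2) (r := 1)
    hv hg (fun a b => (inner ℝ a b : ℝ)) 1
    (Eventually.of_forall fun x => by
      rw [one_mul]; exact nnnorm_inner_le_nnnorm _ _)
  rw [eLpNorm_one_eq_lintegral_enorm, ENNReal.coe_one, one_mul] at this
  exact this

lemma integrable_inner_of_memLp {V : Type*} [NormedAddCommGroup V] [InnerProductSpace ℝ V]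
    {μ : Measure (Pt d)} {v g : Pt d → V} (hv : MemLp v 2 μ) (hg : MemLp g 2 μ) :
    Integrable (fun x => (inner ℝ (v x) (g x) : ℝ)) μ :=
  ⟨hv.1.inner hg.1, (lintegral_enorm_inner_le hv.1 hg.1).trans_lt (ENNReal.mul_lt_top hv.2 hg.2)⟩

lemma tendsto_integral_inner_of_eLpNorm {V : Type*} [NormedAddCommGroup V] [InnerProductSpace ℝ V]
    {μ : Measure (Pt d)} {v g : Pt d → V} {h : ℕ → Pt d → V} (hv : MemLp v 2 μ) (hg : MemLp g 2 μ)
    (hh : ∀ n, AEStronglyMeasurable (h n) μ)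
    (hlim : Tendsto (fun n => eLpNorm (fun x => h n x - g x) 2 μ) atTop (𝓝 0)) :
    Tendsto (fun n => ∫ x, (inner ℝ (v x) (h n x) : ℝ) ∂μ) atTop (𝓝 (∫ x, inner ℝ (v x) (g x) ∂μ)) := by
  have hbound : ∀ n, ∫⁻ x, ‖(inner ℝ (v x) (h n x - g x) : ℝ)‖ₑ ∂μ ≤
      eLpNorm v 2 μ * eLpNorm (fun x => h n x - g x) 2 μ := fun n =>
    lintegral_enorm_inner_le hv.1 ((hh n).sub hg.1)
  have h0 : Tendsto (fun n => ∫⁻ x, ‖(inner ℝ (v x) (h n x - g x) : ℝ)‖ₑ ∂μ) atTop (𝓝 0) := by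
    refine tendsto_of_tendsto_of_tendsto_of_le_of_le tendsto_const_nhds ?_ (fun _ => zero_le) hbound
    have := ENNReal.Tendsto.const_mul hlim (Or.inr hv.2.ne) (a := eLpNorm v 2 μ)
    rwa [mul_zero] at this
  have hev : ∀ᶠ n in atTop, Integrable (fun x => (inner ℝ (v x) (h n x) : ℝ)) μ := by
    filter_upwards [h0.eventually (gt_mem_nhds (show (0 : ENNReal) < 1 by simp))] with n hn
    have h1 : Integrable (fun x => (inner ℝ (v x) (h n x - g x) : ℝ)) μ :=
      ⟨hv.1.inner ((hh n).sub hg.1), hn.trans (by simp)⟩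
    refine (h1.add (integrable_inner_of_memLp hv hg)).congr (Eventually.of_forall fun x => ?_)
    simp only [Pi.add_apply, inner_sub_right, sub_add_cancel]
  refine tendsto_integral_of_L1 _ (integrable_inner_of_memLp hv hg).1 hev ?_
  refine h0.congr fun n => lintegral_congr fun x => ?_
  rw [inner_sub_right]

/-- Both sides are continuous for the `H¹` norm, and test functions are dense in `H¹₀` by
definition. -/
lemma HasWeakDiv.integral_inner_eq {O : Set (Pt d)} {v : Pt d → Pt d} {c : Pt d → ℝ}
    (hv : HasWeakDiv O v c) {s : Pt d → ℝ} {g : Pt d → Pt d} (hs : MemH10 O s g) :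
    ∫ x in O, inner ℝ (v x) (g x) = -∫ x in O, c x * s x := by
  obtain ⟨⟨hs2, hg2, -⟩, φ, hφ, h1, h2⟩ := hs
  have e1 := tendsto_integral_inner_of_eLpNorm (h := fun n => gradient (φ n)) hv.1 hg2
    (fun n => (((InnerProductSpace.toDual ℝ (Pt d)).symm.continuous.comp
      ((hφ n).1.continuous_fderiv (by simp))).aestronglyMeasurable :
      AEStronglyMeasurable (gradient (φ n)) _)) h2
  have e2 := tendsto_integral_inner_of_eLpNorm hv.2.1 hs2
    (fun n => (hφ n).1.continuous.aestronglyMeasurable) h1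
  have e3 := e2.neg
  refine (tendsto_nhds_unique e1 (e3.congr fun n => ?_)).trans ?_
  · rw [hv.2.2 _ (hφ n)]
    simp only [RCLike.inner_apply, conj_trivial, mul_comm]
  · simp only [RCLike.inner_apply, conj_trivial, mul_comm]

/-! ### Conforming collections of simplices -/

/-- A collection of nondegenerate simplices, any two of which meet in a common face. -/
structure Conforming (K : Coll d) : Prop where
  isSimplex : ∀ κ ∈ K, IsSimplex κ
  inter_eq : ∀ κ ∈ K, ∀ κ' ∈ K, hull κ ∩ hull κ' = hull (κ ∩ κ')

lemma isClosed_region (K : Coll d) : IsClosed (region K) :=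
  K.finite_toSet.isClosed_biUnion fun κ _ => isClosed_hull κ

lemma isCompact_region (K : Coll d) : IsCompact (region K) :=
  K.finite_toSet.isCompact_biUnion fun κ _ => isCompact_hull κ

lemma mem_region {K : Coll d} {x : Pt d} : x ∈ region K ↔ ∃ κ ∈ K, x ∈ hull κ := by
  simp [region]

lemma hull_subset_region {K : Coll d} {κ : Spx d} (hκ : κ ∈ K) : hull κ ⊆ region K :=
  fun _ hx => mem_region.2 ⟨κ, hκ, hx⟩

lemma interior_hull_subset {K : Coll d} {κ : Spx d} (hκ : κ ∈ K) :
    interior (hull κ) ⊆ interior (region K) := interior_mono (hull_subset_region hκ)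

lemma volume_frontier_region (K : Coll d) : volume (frontier (region K)) = 0 := by
  have hsub : frontier (region K) ⊆ ⋃ κ ∈ K, frontier (hull κ) := by
    intro x hx
    rw [(isClosed_region K).frontier_eq] at hx
    obtain ⟨κ, hκ, hxκ⟩ := mem_region.1 hx.1
    simp only [Set.mem_iUnion]
    refine ⟨κ, hκ, ?_⟩
    rw [(isClosed_hull κ).frontier_eq]
    exact ⟨hxκ, fun h => hx.2 (interior_hull_subset hκ h)⟩
  refine measure_mono_null hsub ?_
  exact (measure_biUnion_null_iff K.countable_toSet).2 fun κ _ => volume_frontier_hull κ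

lemma interior_region_ae_eq (K : Coll d) : interior (region K) =ᵐ[volume] region K :=
  interior_ae_eq_of_null_frontier (volume_frontier_region K)

lemma ae_mem_interior_hull (K : Coll d) :
    ∀ᵐ x ∂volume.restrict (region K), ∃ κ ∈ K, x ∈ interior (hull κ) := by
  rw [ae_restrict_iff' (isClosed_region K).measurableSet]
  have : ∀ᵐ x : Pt d, ∀ κ ∈ K, x ∉ frontier (hull κ) :=
    (ae_ball_iff K.countable_toSet).2 fun κ _ => measure_eq_zero_iff_ae_notMem.1
      (volume_frontier_hull κ)
  filter_upwards [this] with x hx hxK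
  obtain ⟨κ, hκ, hxκ⟩ := mem_region.1 hxK
  refine ⟨κ, hκ, ?_⟩
  have := hx κ hκ
  rw [(isClosed_hull κ).frontier_eq] at this
  by_contra h
  exact this ⟨hxκ, h⟩

lemma IsSimplex.hat_combo_of_subset {κ τ : Spx d} (h : IsSimplex κ) (hτ : τ ⊆ κ) {w : Pt d → ℝ}
    (hw : ∑ i ∈ τ, w i = 1) {a : Pt d} (ha : a ∈ τ) : hat κ a (∑ i ∈ τ, w i • i) = w a := by
  rw [IsSimplex.hat_sum _ _ hw, Finset.sum_eq_single_of_mem a ha, h.hat_self (hτ ha), mul_one]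
  intro b hb hne
  rw [h.hat_of_ne (hτ ha) (hτ hb) hne, mul_zero]

lemma eventually_mem_hull_imp (K : Coll d) (x : Pt d) :
    ∀ᶠ y in 𝓝 x, ∀ κ ∈ K, y ∈ hull κ → x ∈ hull κ := by
  rw [Filter.eventually_all_finset]
  intro κ _
  by_cases hx : x ∈ hull κ
  · exact Eventually.of_forall fun _ _ => hx
  · filter_upwards [(isClosed_hull κ).isOpen_compl.mem_nhds hx] with y hy hy'
    exact absurd hy' hy

namespace Conforming

variable {K : Coll d} (hK : Conforming K)

include hK

lemma mono {L : Coll d} (hL : L ⊆ K) : Conforming L :=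
  ⟨fun κ hκ => hK.isSimplex κ (hL hκ), fun κ hκ κ' hκ' => hK.inter_eq κ (hL hκ) κ' (hL hκ')⟩

/-- The main use of conformity: a common point of two simplices is carried by their common vertices,
so a vertex with positive weight is shared. -/
lemma mem_of_hat_pos {κ κ' : Spx d} (hκ : κ ∈ K) (hκ' : κ' ∈ K) {x : Pt d} (hx : x ∈ hull κ)
    (hx' : x ∈ hull κ') {b : Pt d} (hb : b ∈ κ) (hpos : 0 < hat κ b x) : b ∈ κ' := by
  have h1 : x ∈ hull (κ ∩ κ') := hK.inter_eq κ hκ κ' hκ' ▸ ⟨hx, hx'⟩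
  rw [(hK.isSimplex κ hκ).mem_hull_of_subset Finset.inter_subset_left] at h1
  by_contra hb'
  have := h1.2 b hb (fun h => hb' (Finset.mem_inter.1 h).2)
  linarith

lemma hat_eq_hat {κ κ' : Spx d} (hκ : κ ∈ K) (hκ' : κ' ∈ K) {x : Pt d} (hx : x ∈ hull κ)
    (hx' : x ∈ hull κ') {b : Pt d} (hb : b ∈ κ) (hb' : b ∈ κ') : hat κ b x = hat κ' b x := by
  have h1 : x ∈ hull (κ ∩ κ') := hK.inter_eq κ hκ κ' hκ' ▸ ⟨hx, hx'⟩
  rw [hull, Finset.mem_convexHull'] at h1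
  obtain ⟨w, -, hw1, rfl⟩ := h1
  rw [(hK.isSimplex κ hκ).hat_combo_of_subset Finset.inter_subset_left hw1
    (Finset.mem_inter.2 ⟨hb, hb'⟩), (hK.isSimplex κ' hκ').hat_combo_of_subset
    Finset.inter_subset_right hw1 (Finset.mem_inter.2 ⟨hb, hb'⟩)]

lemma eq_of_subset {κ κ' : Spx d} (hκ : κ ∈ K) (hκ' : κ' ∈ K) (hs : κ ⊆ κ') : κ = κ' :=
  Finset.eq_of_subset_of_card_le hs
    (by rw [(hK.isSimplex κ hκ).card_eq, (hK.isSimplex κ' hκ').card_eq])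

lemma eq_of_mem_interior {κ κ' : Spx d} (hκ : κ ∈ K) (hκ' : κ' ∈ K) {x : Pt d}
    (hx : x ∈ interior (hull κ)) (hx' : x ∈ hull κ') : κ = κ' :=
  hK.eq_of_subset hκ hκ' fun b hb => hK.mem_of_hat_pos hκ hκ' (interior_subset hx) hx' hb
    ((hK.isSimplex κ hκ).mem_interior_hull.1 hx b hb)

lemma pw_apply {V : Type*} [AddCommMonoid V] {κ : Spx d} (hκ : κ ∈ K) (g : Spx d → Pt d → V)
    {x : Pt d} (hx : x ∈ interior (hull κ)) : pw K g x = g κ x := by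
  rw [pw, Finset.sum_eq_single_of_mem κ hκ, Set.indicator_of_mem hx]
  intro κ' hκ' hne
  refine Set.indicator_of_notMem (fun h => hne ?_) _
  exact hK.eq_of_mem_interior hκ' hκ h (interior_subset hx)

/-- Agreement on the open simplices is enough, because the skeleton is null. This absorbs the value
zero that `pw` takes there. -/
lemma setIntegral_region {V : Type*} [NormedAddCommGroup V] [NormedSpace ℝ V]
    {H : Pt d → V} {G : Spx d → Pt d → V}
    (hG : ∀ κ ∈ K, IntegrableOn (G κ) (hull κ))
    (hH : ∀ κ ∈ K, ∀ x ∈ interior (hull κ), H x = G κ x) :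
    ∫ x in region K, H x = ∑ κ ∈ K, ∫ x in hull κ, G κ x := by
  have h1 : H =ᵐ[volume.restrict (region K)] pw K G := by
    filter_upwards [ae_mem_interior_hull K] with x ⟨κ, hκ, hx⟩
    rw [hH κ hκ x hx, hK.pw_apply hκ G hx]
  have hi : ∀ κ ∈ K, Integrable ((interior (hull κ)).indicator (G κ)) := fun κ hκ =>
    ((hG κ hκ).mono_set interior_subset).integrable_indicator isOpen_interior.measurableSet
  rw [integral_congr_ae h1]
  simp only [pw]
  rw [integral_finsetSum _ fun κ hκ => (hi κ hκ).integrableOn]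
  refine Finset.sum_congr rfl fun κ hκ => ?_
  rw [setIntegral_indicator isOpen_interior.measurableSet,
    Set.inter_eq_self_of_subset_right (interior_subset.trans (hull_subset_region hκ)),
    setIntegral_congr_set (interior_hull_ae_eq κ)]

lemma setIntegral_interior_region {V : Type*} [NormedAddCommGroup V] [NormedSpace ℝ V]
    {H : Pt d → V} {G : Spx d → Pt d → V}
    (hG : ∀ κ ∈ K, IntegrableOn (G κ) (hull κ))
    (hH : ∀ κ ∈ K, ∀ x ∈ interior (hull κ), H x = G κ x) :
    ∫ x in interior (region K), H x = ∑ κ ∈ K, ∫ x in hull κ, G κ x := by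
  rw [setIntegral_congr_set (interior_region_ae_eq K), hK.setIntegral_region hG hH]

lemma memLp_region {V : Type*} [NormedAddCommGroup V]
    {H : Pt d → V} {G : Spx d → Pt d → V} (hG : ∀ κ ∈ K, Continuous (G κ))
    (hH : ∀ κ ∈ K, ∀ x ∈ interior (hull κ), H x = G κ x) :
    MemLp H 2 (volume.restrict (region K)) := by
  have h1 : pw K G =ᵐ[volume.restrict (region K)] H := by
    filter_upwards [ae_mem_interior_hull K] with x ⟨κ, hκ, hx⟩
    rw [hH κ hκ x hx, hK.pw_apply hκ G hx]
  refine MemLp.ae_eq h1 ?_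
  unfold pw
  refine memLp_finsetSum _ fun κ hκ => MemLp.restrict _ ?_
  rw [memLp_indicator_iff_restrict isOpen_interior.measurableSet]
  obtain ⟨C, hC⟩ := ((isCompact_hull κ).image (hG κ hκ)).isBounded.exists_norm_le
  have : IsFiniteMeasure (volume.restrict (interior (hull κ))) :=
    ⟨by simpa using (measure_mono interior_subset).trans_lt (volume_hull_lt_top κ)⟩
  refine MemLp.of_bound ?_ C ?_
  · exact (((hG κ hκ).continuousOn.aestronglyMeasurable (measurableSet_hull κ)).mono_measure
      (Measure.restrict_mono interior_subset le_rfl))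
  · exact (ae_restrict_iff' isOpen_interior.measurableSet).2 (Eventually.of_forall fun x hx =>
      hC _ ⟨x, interior_subset hx, rfl⟩)

/-! ### Simplices sharing a face -/

/-- The union of the simplices looks the same, up to translation, near any two points of the
relative interior of a face. If some point of the closed face is interior to the region, so is every
point of its relative interior. -/
lemma mem_interior_region_of_face {κ τ : Spx d} (hκ : κ ∈ K) (hτ : τ ⊆ κ) {x z : Pt d}
    (hx : x ∈ hull τ) (hpos : ∀ b ∈ τ, 0 < hat κ b x) (hz : z ∈ hull τ)
    (hzi : z ∈ interior (region K)) : x ∈ interior (region K) := by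
  have hsκ := hK.isSimplex κ hκ
  have hxκ := (hsκ.mem_hull_of_subset hτ).1 hx
  have hzκ := (hsκ.mem_hull_of_subset hτ).1 hz
  have hcont : Continuous fun t : ℝ => z + t • (x - z) := by fun_prop
  have hev : ∀ᶠ t in 𝓝 (0 : ℝ), z + t • (x - z) ∈ interior (region K) :=
    hcont.continuousAt.eventually (isOpen_interior.mem_nhds (by simpa using hzi))
  -- The point `z` may lie on the relative boundary of the face; a short move towards `x` makes all
  -- its face coordinates positive without leaving the interior.
  obtain ⟨t, ht, ht0, ht1⟩ : ∃ t : ℝ, z + t • (x - z) ∈ interior (region K) ∧ 0 < t ∧ t < 1 := by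
    have h1 : ∀ᶠ t in 𝓝[>] (0 : ℝ), z + t • (x - z) ∈ interior (region K) ∧ t ∈ Set.Ioo (0 : ℝ) 1 :=
      (hev.filter_mono nhdsWithin_le_nhds).and (Ioo_mem_nhdsGT one_pos)
    obtain ⟨t, h, h'⟩ := h1.exists
    exact ⟨t, h, h'⟩
  set z' := z + t • (x - z) with hz'
  have hz'τ : z' ∈ hull τ := (convex_hull τ).add_smul_sub_mem hz hx ⟨ht0.le, ht1.le⟩
  have hz'pos : ∀ b ∈ τ, 0 < hat κ b z' := fun b hb => by
    rw [hat_eq_add κ b z' z, hz', add_sub_cancel_left, real_inner_smul_right, ← hat_sub_hat]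
    have h1 := hsκ.hat_nonneg hzκ.1 (hτ hb)
    have h2 := hpos b hb
    nlinarith
  have hz'κ := ((hsκ.mem_hull_of_subset hτ).1 hz'τ).1
  rw [mem_interior_iff_mem_nhds]
  -- A simplex containing the translated point contains `z'`, hence all of `τ`. Then `y` lies in it
  -- too: its coordinates on `τ` are positive near `x`, and the remaining ones are unchanged by the
  -- translation.
  have hshift : Tendsto (fun y => z' + (y - x)) (𝓝 x) (𝓝 z') := by
    have : Continuous fun y => z' + (y - x) := by fun_prop
    simpa using this.tendsto x
  have hev1 := hshift.eventually (isOpen_interior.mem_nhds ht)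
  have hev2 := hshift.eventually (eventually_mem_hull_imp K z')
  have hev3 : ∀ᶠ y in 𝓝 x, ∀ κ' ∈ K.filter (τ ⊆ ·), ∀ b ∈ τ, 0 < hat κ' b y := by
    rw [Filter.eventually_all_finset]
    intro κ' hκ'
    rw [Filter.eventually_all_finset]
    intro b hb
    rw [Finset.mem_filter] at hκ'
    have hxκ' : x ∈ hull κ' := convexHull_mono (by exact_mod_cast hκ'.2) hx
    have : 0 < hat κ' b x := by
      rw [← hK.hat_eq_hat hκ hκ'.1 hxκ.1 hxκ' (hτ hb) (hκ'.2 hb)]; exact hpos b hb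
    exact (continuous_hat κ' b).continuousAt.eventually (lt_mem_nhds this)
  filter_upwards [hev1, hev2, hev3] with y hy1 hy2 hy3
  obtain ⟨κ', hκ', hyκ'⟩ := mem_region.1 (interior_subset hy1)
  have hz'κ' := hy2 κ' hκ' hyκ'
  have hτκ' : τ ⊆ κ' := fun b hb => hK.mem_of_hat_pos hκ hκ' hz'κ hz'κ' (hτ hb) (hz'pos b hb)
  have hs' := hK.isSimplex κ' hκ'
  refine mem_region.2 ⟨κ', hκ', hs'.mem_hull.2 fun b hb => ?_⟩
  by_cases hbτ : b ∈ τ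
  · exact (hy3 κ' (Finset.mem_filter.2 ⟨hκ', hτκ'⟩) b hbτ).le
  · have h1 := ((hs'.mem_hull_of_subset hτκ').1 hx).2 b hb hbτ
    have h2 := ((hs'.mem_hull_of_subset hτκ').1 hz'τ).2 b hb hbτ
    have h3 := hs'.hat_nonneg hyκ' hb
    rw [hat_eq_add κ' b _ z', add_sub_cancel_left, ← hat_sub_hat, h1, h2] at h3
    linarith

-- Both coordinates vanish on the common face, so one is a multiple of the other; evaluation at the
-- second opposite vertex gives the factor.
omit hK in
lemma hat_eq_mul {κ κ' : Spx d} (h : IsSimplex κ) (h' : IsSimplex κ') {σ : Spx d}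
    (hσ : σ ∈ facets κ) (hσ' : σ ∈ facets κ') (x : Pt d) :
    hat κ (opp κ σ) x = hat κ' (opp κ' σ) x * hat κ (opp κ σ) (opp κ' σ) := by
  obtain ⟨a, ha, rfl⟩ := (mem_facets h.card_eq).1 hσ
  obtain ⟨a', ha', heq⟩ := (mem_facets h'.card_eq).1 hσ'
  have ho : opp κ' (κ.erase a) = a' := by rw [heq, opp_erase ha']
  rw [opp_erase ha, ho]
  conv_lhs => rw [← h'.sum_hat_smul x]
  rw [IsSimplex.hat_sum _ (fun b => hat κ' b x) (h'.sum_hat x), Finset.sum_eq_single_of_mem a' ha']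
  intro b hb hne
  have hb' : b ∈ κ.erase a := heq ▸ Finset.mem_erase.2 ⟨hne, hb⟩
  rw [Finset.mem_erase] at hb'
  rw [h.hat_of_ne ha hb'.2 hb'.1, mul_zero]

omit hK in
lemma opp_mem {κ σ : Spx d} (h : IsSimplex κ) (hσ : σ ∈ facets κ) : opp κ σ ∈ κ := by
  obtain ⟨a, ha, rfl⟩ := (mem_facets h.card_eq).1 hσ
  rwa [opp_erase ha]

omit hK in
lemma erase_opp {κ σ : Spx d} (h : IsSimplex κ) (hσ : σ ∈ facets κ) : κ.erase (opp κ σ) = σ := by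
  obtain ⟨a, ha, rfl⟩ := (mem_facets h.card_eq).1 hσ
  rw [opp_erase ha]

/-- Two simplices with a common facet lie on opposite sides of it. Otherwise a short step from the
barycentre of the facet towards the second apex stays in both simplices with positive weight at that
apex, making it a common vertex. -/
lemma hat_opp_neg {κ κ' : Spx d} (hκ : κ ∈ K) (hκ' : κ' ∈ K) (hne : κ ≠ κ') {σ : Spx d}
    (hσ : σ ∈ facets κ) (hσ' : σ ∈ facets κ') : hat κ (opp κ σ) (opp κ' σ) < 0 := by
  have h := hK.isSimplex κ hκ
  have h' := hK.isSimplex κ' hκ'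
  have hmul := hat_eq_mul h h' hσ hσ' (opp κ σ)
  rw [h.hat_self (opp_mem h hσ)] at hmul
  by_contra! hge
  have hpos : 0 < hat κ (opp κ σ) (opp κ' σ) :=
    lt_of_le_of_ne hge fun e => by rw [← e, mul_zero] at hmul; exact one_ne_zero hmul
  set a' := opp κ' σ with ha'
  have ha'm : a' ∈ κ' := opp_mem h' hσ'
  have hbσ : bary σ ∈ hull σ := by
    rw [← erase_opp h hσ]; exact h.bary_mem_hull (opp_mem h hσ)
  have hσκ : σ ⊆ κ := by rw [← erase_opp h hσ]; exact Finset.erase_subset _ _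
  have hσκ' : σ ⊆ κ' := by rw [← erase_opp h' hσ']; exact Finset.erase_subset _ _
  have hbκ' := (h'.mem_hull_of_subset hσκ').1 hbσ
  have hcont : Continuous fun t : ℝ => bary σ + t • (a' - bary σ) := by fun_prop
  have hd := h.natCast_pos
  have hev : ∀ᶠ t in 𝓝 (0 : ℝ), ∀ b ∈ σ, 0 < hat κ b (bary σ + t • (a' - bary σ)) := by
    rw [Filter.eventually_all_finset]
    intro b hb
    refine ((continuous_hat κ b).comp hcont).continuousAt.eventually (lt_mem_nhds ?_)
    have hb' : b ∈ κ.erase (opp κ σ) := by rw [erase_opp h hσ]; exact hb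
    have := h.hat_bary (opp_mem h hσ) (hσκ hb)
    rw [erase_opp h hσ, if_neg (Finset.ne_of_mem_erase hb')] at this
    simp only [Function.comp_apply, zero_smul, add_zero, this]
    positivity
  obtain ⟨t, ht, ht0, ht1⟩ : ∃ t : ℝ, (∀ b ∈ σ, 0 < hat κ b (bary σ + t • (a' - bary σ))) ∧
      0 < t ∧ t < 1 := by
    have h1 := (hev.filter_mono nhdsWithin_le_nhds).and (Ioo_mem_nhdsGT (zero_lt_one' ℝ))
    obtain ⟨t, h, h'⟩ := h1.exists
    exact ⟨t, h, h'⟩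
  set y := bary σ + t • (a' - bary σ) with hy
  have hhat : ∀ κ₁ b, hat κ₁ b y = hat κ₁ b (bary σ) + t * (hat κ₁ b a' - hat κ₁ b (bary σ)) :=
    fun κ₁ b => by
      rw [hat_eq_add κ₁ b y (bary σ), hy, add_sub_cancel_left, real_inner_smul_right, ← hat_sub_hat]
  have hyκ' : y ∈ hull κ' := (convex_hull κ').add_smul_sub_mem hbκ'.1
    (subset_convexHull ℝ _ (Finset.mem_coe.2 ha'm)) ⟨ht0.le, ht1.le⟩
  have hyκ : y ∈ hull κ := h.mem_hull.2 fun b hb => by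
    by_cases hbσ' : b ∈ σ
    · exact (ht b hbσ').le
    · have hbo : b = opp κ σ := by
        by_contra hne'
        exact hbσ' (erase_opp h hσ ▸ Finset.mem_erase.2 ⟨hne', hb⟩)
      have h0 : hat κ b (bary σ) = 0 := ((h.mem_hull_of_subset hσκ).1 hbσ).2 b hb hbσ'
      rw [hhat, h0, hbo]
      nlinarith
  have hpos' : 0 < hat κ' a' y := by
    have h0 : hat κ' a' (bary σ) = 0 := hbκ'.2 a' ha'm (by
      rw [← erase_opp h' hσ']; simp [ha'])
    rw [hhat, h0, h'.hat_self ha'm]; linarith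
  have ha'κ := hK.mem_of_hat_pos hκ' hκ hyκ' hyκ ha'm hpos'
  apply hne
  symm
  refine hK.eq_of_subset hκ' hκ fun b hb => ?_
  by_cases hba : b = a'
  · rw [hba]; exact ha'κ
  · exact hσκ (erase_opp h' hσ' ▸ Finset.mem_erase.2 ⟨hba, hb⟩)

/-- Three simplices on one facet would be pairwise on opposite sides; the multiplicativity of
`hat_eq_mul` turns this into a negative number equal to a product of two negative ones. -/
lemma eq_or_eq_of_common_facet {κ₁ κ₂ κ₃ σ : Spx d} (h₁ : κ₁ ∈ K) (h₂ : κ₂ ∈ K) (h₃ : κ₃ ∈ K)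
    (hσ₁ : σ ∈ facets κ₁) (hσ₂ : σ ∈ facets κ₂) (hσ₃ : σ ∈ facets κ₃) (hne : κ₁ ≠ κ₂) :
    κ₃ = κ₁ ∨ κ₃ = κ₂ := by
  by_contra! hcon
  have e1 := hK.hat_opp_neg h₁ h₂ hne hσ₁ hσ₂
  have e2 := hK.hat_opp_neg h₁ h₃ hcon.1.symm hσ₁ hσ₃
  have e3 := hK.hat_opp_neg h₂ h₃ hcon.2.symm hσ₂ hσ₃
  have := hat_eq_mul (hK.isSimplex _ h₁) (hK.isSimplex _ h₂) hσ₁ hσ₂ (opp κ₃ σ)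
  nlinarith [mul_pos_of_neg_of_neg e3 e1]

lemma outNormal_eq_neg {κ κ' : Spx d} (hκ : κ ∈ K) (hκ' : κ' ∈ K) (hne : κ ≠ κ') {σ : Spx d}
    (hσ : σ ∈ facets κ) (hσ' : σ ∈ facets κ') : outNormal κ' σ = -outNormal κ σ := by
  have h := hK.isSimplex κ hκ
  have h' := hK.isSimplex κ' hκ'
  have hneg := hK.hat_opp_neg hκ hκ' hne hσ hσ'
  set c := hat κ (opp κ σ) (opp κ' σ)
  have hg : hatGrad κ (opp κ σ) = c • hatGrad κ' (opp κ' σ) := by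
    refine ext_inner_right ℝ fun v => ?_
    have h1 := hat_eq_mul h h' hσ hσ' v
    have h2 := hat_eq_mul h h' hσ hσ' 0
    have e1 := hat_sub_hat κ (opp κ σ) v 0
    have e2 := hat_sub_hat κ' (opp κ' σ) v 0
    rw [sub_zero] at e1 e2
    rw [real_inner_smul_left, ← e1, ← e2, h1, h2]
    ring
  have key : ∀ κ₁ : Spx d, IsSimplex κ₁ → σ ∈ facets κ₁ →
      outNormal κ₁ σ = -(‖hatGrad κ₁ (opp κ₁ σ)‖⁻¹ • hatGrad κ₁ (opp κ₁ σ)) := fun κ₁ h₁ hσ₁ => by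
    have e1 := h₁.outNormal_eq (opp_mem h₁ hσ₁)
    rw [erase_opp h₁ hσ₁] at e1
    have e2 := h₁.norm_outNormal hσ₁
    have e3 := norm_pos_iff.2 (h₁.hatGrad_ne_zero (opp_mem h₁ hσ₁))
    rw [e1, norm_neg, norm_smul, norm_norm] at e2
    rw [e1, eq_inv_of_mul_eq_one_left e2]
  rw [key κ' h' hσ', key κ h hσ, hg, norm_smul, Real.norm_of_nonpos hneg.le, smul_smul]
  have : (-c * ‖hatGrad κ' (opp κ' σ)‖)⁻¹ * c = -‖hatGrad κ' (opp κ' σ)‖⁻¹ := by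
    have e3 := norm_pos_iff.2 (h'.hatGrad_ne_zero (opp_mem h' hσ'))
    have := hneg.ne
    field_simp
  rw [this, neg_smul, neg_neg]

/-- The barycentre of the facet is interior to the region, so one can step across the facet, away
from `κ`. A simplex met there contains the barycentre and hence the facet, and is not `κ`, whose
coordinate at the opposite vertex has become negative. -/
lemma exists_ne_of_not_subset_frontier {κ σ : Spx d} (hκ : κ ∈ K) (hσ : σ ∈ facets κ)
    (hf : ¬ hull σ ⊆ frontier (region K)) : ∃ κ' ∈ K, κ' ≠ κ ∧ σ ∈ facets κ' := by
  have h := hK.isSimplex κ hκ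
  have hd := h.natCast_pos
  have hσκ : σ ⊆ κ := by rw [← erase_opp h hσ]; exact Finset.erase_subset _ _
  obtain ⟨z, hz, hzf⟩ := Set.not_subset.1 hf
  have hzi : z ∈ interior (region K) := by
    rw [(isClosed_region K).frontier_eq] at hzf
    by_contra hni
    exact hzf ⟨hull_subset_region hκ ((h.mem_hull_of_subset hσκ).1 hz).1, hni⟩
  have hbσ : bary σ ∈ hull σ := by
    rw [← erase_opp h hσ]; exact h.bary_mem_hull (opp_mem h hσ)
  have hpos : ∀ b ∈ σ, 0 < hat κ b (bary σ) := fun b hb => by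
    have hb' : b ∈ κ.erase (opp κ σ) := by rw [erase_opp h hσ]; exact hb
    have := h.hat_bary (opp_mem h hσ) (hσκ hb)
    rw [erase_opp h hσ, if_neg (Finset.ne_of_mem_erase hb')] at this
    rw [this]; positivity
  have hbκ := ((h.mem_hull_of_subset hσκ).1 hbσ)
  have hbi := hK.mem_interior_region_of_face hκ hσκ hbσ hpos hz hzi
  have hcont : Tendsto (fun t : ℝ => bary σ - t • (opp κ σ - bary σ)) (𝓝[>] 0) (𝓝 (bary σ)) := by
    have : Continuous fun t : ℝ => bary σ - t • (opp κ σ - bary σ) := by fun_prop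
    have := this.tendsto 0
    simp only [zero_smul, sub_zero] at this
    exact this.mono_left nhdsWithin_le_nhds
  obtain ⟨t, ⟨ht1, ht2⟩, ht0⟩ := (((hcont.eventually (isOpen_interior.mem_nhds hbi)).and
    (hcont.eventually (eventually_mem_hull_imp K (bary σ)))).and self_mem_nhdsWithin).exists
  obtain ⟨κ', hκ', hy⟩ := mem_region.1 (interior_subset ht1)
  have hbκ' := ht2 κ' hκ' hy
  have hσκ' : σ ⊆ κ' := fun b hb =>
    hK.mem_of_hat_pos hκ hκ' hbκ.1 hbκ' (hσκ hb) (hpos b hb)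
  refine ⟨κ', hκ', ?_, Finset.mem_powersetCard.2 ⟨hσκ', (Finset.mem_powersetCard.1 hσ).2⟩⟩
  rintro rfl
  have h1 := h.hat_nonneg hy (opp_mem h hσ)
  have h0 : hat κ' (opp κ' σ) (bary σ) = 0 := hbκ.2 _ (opp_mem h hσ) (by
    intro hmem
    have := Finset.notMem_erase (opp κ' σ) κ'
    rw [erase_opp h hσ] at this
    exact this hmem)
  rw [hat_eq_add κ' _ _ (bary σ), sub_sub_cancel_left, inner_neg_right, real_inner_smul_right,
    ← hat_sub_hat, h0, h.hat_self (opp_mem h hσ)] at h1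
  have : 0 < t := ht0
  linarith

end Conforming

/-! ### Gluing functions given on the simplices of a conforming collection -/

/-- Continuous induction along the segment joining two points: the set of parameters at which the
bound from the start holds is closed and can be extended to the right. -/
lemma lipschitzWith_of_eventually {w : Pt d → ℝ} {C : NNReal}
    (hw : ∀ x, ∀ᶠ y in 𝓝 x, |w y - w x| ≤ C * ‖y - x‖) : LipschitzWith C w := by
  have hcont : Continuous w := continuous_iff_continuousAt.2 fun x => by
    refine tendsto_sub_nhds_zero_iff.1 ?_
    have hlim : Tendsto (fun y => C * ‖y - x‖) (𝓝 x) (𝓝 0) := by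
      have : Continuous fun y => (C : ℝ) * ‖y - x‖ := by fun_prop
      simpa using this.tendsto x
    exact squeeze_zero_norm' (hw x) hlim
  refine LipschitzWith.of_dist_le_mul fun y x => ?_
  rw [dist_eq_norm, dist_eq_norm]
  set f : ℝ → Pt d := fun t => x + t • (y - x) with hf
  have hfc : Continuous f := by fun_prop
  set S : Set ℝ := {t | |w (f t) - w x| ≤ C * (t * ‖y - x‖)} with hS
  have hclosed : IsClosed S :=
    isClosed_le (by fun_prop) (by fun_prop)
  have hsub : Set.Icc (0 : ℝ) 1 ⊆ S := by
    refine IsClosed.Icc_subset_of_forall_mem_nhdsWithin (hclosed.inter isClosed_Icc) ?_ ?_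
    · simp [hS, hf]
    · rintro t ⟨ht, ht0⟩
      filter_upwards [(hfc.continuousAt.eventually (hw (f t))).filter_mono nhdsWithin_le_nhds,
        self_mem_nhdsWithin] with s hs hst
      have hst' : t < s := hst
      have h1 : f s - f t = (s - t) • (y - x) := by simp only [hf, sub_smul]; abel
      rw [h1, norm_smul, Real.norm_of_nonneg (by linarith)] at hs
      simp only [hS, Set.mem_ofPred_eq] at ht ⊢
      have h2 := abs_sub_le (w (f s)) (w (f t)) (w x)
      calc _ ≤ _ := h2
        _ ≤ C * ((s - t) * ‖y - x‖) + C * (t * ‖y - x‖) := add_le_add hs ht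
        _ = _ := by ring
  have h1 := hsub (Set.right_mem_Icc.2 zero_le_one)
  simpa [hS, hf] using h1

/-- A family of functions on the simplices of `K` that fit together to a function which vanishes on
the boundary of `K`. -/
structure IsFitting (K : Coll d) (g : Spx d → Pt d → ℝ) : Prop where
  contDiff : ∀ κ ∈ K, ContDiff ℝ ∞ (g κ)
  agree : ∀ κ ∈ K, ∀ κ' ∈ K, ∀ x ∈ hull κ, x ∈ hull κ' → g κ x = g κ' x
  eq_zero : ∀ κ ∈ K, ∀ x ∈ hull κ, x ∈ frontier (region K) → g κ x = 0

/-- The function equal to `g κ` on each simplex `κ` of `K` and to zero elsewhere. -/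
def glue (K : Coll d) (g : Spx d → Pt d → ℝ) (x : Pt d) : ℝ :=
  if h : ∃ κ ∈ K, x ∈ hull κ then g h.choose x else 0

namespace IsFitting

variable {K : Coll d} {g : Spx d → Pt d → ℝ} (hg : IsFitting K g)

include hg

lemma contDiff_one {κ : Spx d} (hκ : κ ∈ K) : ContDiff ℝ 1 (g κ) :=
  (hg.contDiff κ hκ).of_le (by norm_cast)

lemma glue_eq {κ : Spx d} (hκ : κ ∈ K) {x : Pt d} (hx : x ∈ hull κ) : glue K g x = g κ x := by
  have h : ∃ κ ∈ K, x ∈ hull κ := ⟨κ, hκ, hx⟩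
  rw [glue, dif_pos h]
  exact hg.agree _ h.choose_spec.1 _ hκ x h.choose_spec.2 hx

lemma glue_eq_zero {x : Pt d} (hx : x ∉ interior (region K)) : glue K g x = 0 := by
  by_cases h : ∃ κ ∈ K, x ∈ hull κ
  · obtain ⟨κ, hκ, hxκ⟩ := h
    rw [hg.glue_eq hκ hxκ]
    refine hg.eq_zero κ hκ x hxκ ?_
    rw [(isClosed_region K).frontier_eq]
    exact ⟨hull_subset_region hκ hxκ, hx⟩
  · rw [glue, dif_neg h]

/-- Only nearby pairs need comparison: every simplex containing a point close to `x` also contains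
`x`. The Lipschitz constant of that simplex then applies, and the sum of all of them is uniform. -/
lemma exists_lipschitzWith_glue : ∃ C, LipschitzWith C (glue K g) := by
  have hC : ∀ κ ∈ K, ∃ C : NNReal, LipschitzOnWith C (g κ) (hull κ) := fun κ hκ => by
    obtain ⟨C, hC⟩ := ((isCompact_hull κ).image
      ((hg.contDiff_one hκ).continuous_fderiv one_ne_zero)).isBounded.exists_norm_le
    refine ⟨C.toNNReal, (convex_hull κ).lipschitzOnWith_of_nnnorm_fderiv_le
      (fun x _ => (hg.contDiff_one hκ).differentiable one_ne_zero x) fun x hx => ?_⟩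
    rw [← NNReal.coe_le_coe, coe_nnnorm]
    exact (hC _ ⟨x, hx, rfl⟩).trans (Real.le_coe_toNNReal C)
  choose! C hC using hC
  refine ⟨∑ κ ∈ K, C κ, lipschitzWith_of_eventually fun x => ?_⟩
  by_cases hx : x ∈ region K
  · have hint : ∀ᶠ y in 𝓝 x, x ∈ interior (region K) → y ∈ interior (region K) := by
      by_cases hxi : x ∈ interior (region K)
      · filter_upwards [isOpen_interior.mem_nhds hxi] with y hy _ using hy
      · exact Eventually.of_forall fun _ h => absurd h hxi
    filter_upwards [eventually_mem_hull_imp K x, hint] with y hy hyi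
    by_cases hyK : y ∈ region K
    · obtain ⟨κ, hκ, hyκ⟩ := mem_region.1 hyK
      have hxκ := hy κ hκ hyκ
      rw [hg.glue_eq hκ hxκ, hg.glue_eq hκ hyκ, ← Real.dist_eq, ← dist_eq_norm]
      refine ((hC κ hκ).dist_le_mul y hyκ x hxκ).trans ?_
      refine mul_le_mul_of_nonneg_right ?_ dist_nonneg
      exact_mod_cast Finset.single_le_sum (f := C) (fun _ _ => zero_le) hκ
    · rw [hg.glue_eq_zero fun h => hyK (interior_subset h),
        hg.glue_eq_zero fun h => hyK (interior_subset (hyi h)), sub_zero, abs_zero]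
      positivity
  · filter_upwards [(isClosed_region K).isOpen_compl.mem_nhds hx] with y hy
    rw [hg.glue_eq_zero fun h => hx (interior_subset h),
      hg.glue_eq_zero fun h => hy (interior_subset h), sub_zero, abs_zero]
    positivity

lemma glue_eventuallyEq {κ : Spx d} (hκ : κ ∈ K) {x : Pt d} (hx : x ∈ interior (hull κ)) :
    glue K g =ᶠ[𝓝 x] g κ := by
  filter_upwards [isOpen_interior.mem_nhds hx] with y hy
  exact hg.glue_eq hκ (interior_subset hy)

lemma gradient_glue {κ : Spx d} (hκ : κ ∈ K) {x : Pt d} (hx : x ∈ interior (hull κ)) :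
    gradient (glue K g) x = gradient (g κ) x := by
  rw [gradient, gradient, (hg.glue_eventuallyEq hκ hx).fderiv_eq]

lemma memH10_glue (hz : ∀ κ ∈ K, ∀ᵐ x, x ∈ interior (hull κ) → g κ x = 0 → fderiv ℝ (g κ) x = 0) :
    MemH10 (interior (region K)) (glue K g) (gradient (glue K g)) := by
  obtain ⟨C, hC⟩ := hg.exists_lipschitzWith_glue
  refine memH10_of_lipschitz isOpen_interior
    ((isCompact_region K).isBounded.subset interior_subset) hC (fun x hx => hg.glue_eq_zero hx) ?_
  rw [Measure.restrict_congr_set (interior_region_ae_eq K)]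
  filter_upwards [ae_mem_interior_hull K,
    ae_restrict_of_ae ((ae_ball_iff K.countable_toSet).2 hz)] with x ⟨κ, hκ, hx⟩ hx2 h0
  rw [(hg.glue_eventuallyEq hκ hx).fderiv_eq]
  refine hx2 κ hκ hx ?_
  rwa [hg.glue_eq hκ (interior_subset hx)] at h0

end IsFitting

/-! ### The weak divergence of broken Raviart--Thomas functions -/

/-- The sum of the outward fluxes through `σ` over the simplices of `K` having the face `σ`. -/
def jump (K : Coll d) (v : Spx d → RT d) (σ : Spx d) : ℝ :=
  ∑ κ ∈ K with σ ∈ facets κ, flux κ σ (v κ)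

/-- The mean over the face `σ` of a function given on the simplices of `K`. -/
def faceMean (K : Coll d) (g : Spx d → Pt d → ℝ) (σ : Spx d) : ℝ :=
  if h : ∃ κ ∈ K, σ ∈ facets κ then traceMean h.choose σ (g h.choose) else 0

lemma mem_intFacets {K : Coll d} {σ : Spx d} :
    σ ∈ intFacets K ↔ (∃ κ ∈ K, σ ∈ facets κ) ∧ ¬ hull σ ⊆ frontier (region K) := by
  simp [intFacets]

lemma mem_extFacets {K : Coll d} {σ : Spx d} :
    σ ∈ extFacets K ↔ (∃ κ ∈ K, σ ∈ facets κ) ∧ hull σ ⊆ frontier (region K) := by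
  simp [extFacets]

lemma hull_facet_subset {κ σ : Spx d} (hσ : σ ∈ facets κ) : hull σ ⊆ hull κ :=
  convexHull_mono (by exact_mod_cast (Finset.mem_powersetCard.1 hσ).1)

lemma facet_subset {κ σ : Spx d} (hσ : σ ∈ facets κ) : σ ⊆ κ := (Finset.mem_powersetCard.1 hσ).1

namespace Conforming

variable {K : Coll d} (hK : Conforming K)

include hK

/-- Shows that the arbitrary choice of an adjacent simplex in `faceMean` is immaterial. -/
lemma traceMean_eq_faceMean {g : Spx d → Pt d → ℝ} (hg : IsFitting K g) {κ σ : Spx d} (hκ : κ ∈ K)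
    (hσ : σ ∈ facets κ) : traceMean κ σ (g κ) = faceMean K g σ := by
  have h : ∃ κ ∈ K, σ ∈ facets κ := ⟨κ, hκ, hσ⟩
  rw [faceMean, dif_pos h]
  obtain ⟨h1, h2⟩ := h.choose_spec
  set κ' := h.choose
  rw [(hK.isSimplex κ hκ).traceMean_congr hσ (hg.contDiff_one hκ) (hg.contDiff_one h1)
    fun x hx => hg.agree κ hκ κ' h1 x (hull_facet_subset hσ hx) (hull_facet_subset h2 hx)]
  exact (hK.isSimplex κ' h1).traceMean_eq_of_common_facet (hK.isSimplex κ hκ) h2 hσ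
    (hg.contDiff_one h1)

/-- Integration by parts over `K`; only the jumps over the interior faces remain. -/
lemma sum_integral_rt {g : Spx d → Pt d → ℝ} (hg : IsFitting K g) (v : Spx d → RT d) :
    ∑ κ ∈ K, ∫ x in hull κ, (fderiv ℝ (g κ) x (rtEval (v κ) x) + rtDiv (v κ) * g κ x) =
      ∑ σ ∈ intFacets K, faceMean K g σ * jump K v σ := by
  have h1 : ∀ κ ∈ K, ∫ x in hull κ, (fderiv ℝ (g κ) x (rtEval (v κ) x) + rtDiv (v κ) * g κ x) =
      ∑ σ ∈ intFacets K, if σ ∈ facets κ then faceMean K g σ * flux κ σ (v κ) else 0 := by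
    intro κ hκ
    have h := hK.isSimplex κ hκ
    rw [h.integral_rt _ (hg.contDiff_one hκ), ← Finset.sum_filter]
    symm
    refine Finset.sum_subset_zero_on_sdiff (fun σ hσ => (Finset.mem_filter.1 hσ).2) ?_ ?_
    · intro σ hσ
      rw [Finset.mem_sdiff, Finset.mem_filter, mem_intFacets] at hσ
      have hfr : hull σ ⊆ frontier (region K) := by
        by_contra hn; exact hσ.2 ⟨⟨⟨κ, hκ, hσ.1⟩, hn⟩, hσ.1⟩
      rw [h.traceMean_eq_zero hσ.1 (hg.contDiff_one hκ) fun x hx =>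
        hg.eq_zero κ hκ x (hull_facet_subset hσ.1 hx) (hfr hx), mul_zero]
    · intro σ hσ
      rw [hK.traceMean_eq_faceMean hg hκ (Finset.mem_filter.1 hσ).2, mul_comm]
  rw [Finset.sum_congr rfl h1, Finset.sum_comm]
  refine Finset.sum_congr rfl fun σ _ => ?_
  rw [← Finset.sum_filter, jump, Finset.mul_sum]

omit hK in
lemma isFitting_of_isTest {φ : Pt d → ℝ} (hφ : IsTest (interior (region K)) φ) :
    IsFitting K fun _ => φ where
  contDiff _ _ := hφ.1
  agree _ _ _ _ _ _ _ := rfl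
  eq_zero _ _ x _ hx := by
    refine image_eq_zero_of_notMem_tsupport fun h => ?_
    rw [(isClosed_region K).frontier_eq] at hx
    exact hx.2 (hφ.2.2 h)

lemma hasWeakDiv_of_jump_eq_zero {v : Spx d → RT d} {W : Pt d → ℝ}
    (hW : ∀ κ ∈ K, ∀ x ∈ interior (hull κ), W x = rtDiv (v κ))
    (hj : ∀ σ ∈ intFacets K, jump K v σ = 0) :
    HasWeakDiv (interior (region K)) (rtField K v) W := by
  have hv : ∀ κ ∈ K, ∀ x ∈ interior (hull κ), rtField K v x = rtEval (v κ) x :=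
    fun κ hκ x hx => hK.pw_apply hκ _ hx
  rw [HasWeakDiv, Measure.restrict_congr_set (interior_region_ae_eq K)]
  refine ⟨hK.memLp_region (fun κ _ => continuous_rtEval (v κ)) hv,
    hK.memLp_region (G := fun κ _ => rtDiv (v κ)) (fun κ _ => continuous_const) hW, fun φ hφ => ?_⟩
  have hφ1 : ContDiff ℝ 1 φ := hφ.1.of_le (by norm_cast)
  have hφ0 := hφ1.continuous
  have hφ' := hφ1.continuous_fderiv one_ne_zero
  have hc1 : ∀ κ, Continuous fun x => fderiv ℝ φ x (rtEval (v κ) x) := fun κ => by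
    have := continuous_rtEval (v κ); fun_prop
  have hc2 : ∀ κ, Continuous fun x => rtDiv (v κ) * φ x := fun κ => by fun_prop
  have key := hK.sum_integral_rt (isFitting_of_isTest hφ) v
  rw [Finset.sum_eq_zero (s := intFacets K) fun σ hσ => by rw [hj σ hσ, mul_zero]] at key
  rw [hK.setIntegral_region (G := fun κ x => fderiv ℝ φ x (rtEval (v κ) x))
    (fun κ _ => Continuous.integrableOn_hull (hc1 κ) κ) (fun κ hκ x hx => by
      rw [hv κ hκ x hx, real_inner_comm, inner_gradient_left]),
    hK.setIntegral_region (G := fun κ x => rtDiv (v κ) * φ x)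
    (fun κ _ => Continuous.integrableOn_hull (hc2 κ) κ) (fun κ hκ x hx => by
      rw [hW κ hκ x hx]), ← add_eq_zero_iff_eq_neg, ← Finset.sum_add_distrib, ← key]
  exact Finset.sum_congr rfl fun κ _ => (integral_add (Continuous.integrableOn_hull (hc1 κ) κ)
    (Continuous.integrableOn_hull (hc2 κ) κ)).symm

/-- The bubble functions of a face `τ` which is not contained in the boundary fit together. -/
lemma isFitting_bubble {τ : Spx d} (hf : ¬ hull τ ⊆ frontier (region K)) :
    IsFitting K fun κ => if τ ⊆ κ then bubble κ τ else 0 where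
  contDiff κ _ := by
    split_ifs
    · exact contDiff_bubble κ τ
    · exact contDiff_const
  agree := by
    have aux : ∀ κ ∈ K, ∀ κ' ∈ K, ∀ x ∈ hull κ, x ∈ hull κ' → τ ⊆ κ → ¬ τ ⊆ κ' →
        bubble κ τ x = 0 := fun κ hκ κ' hκ' x hx hx' h h' => by
      obtain ⟨b, hb, hb'⟩ := Finset.not_subset.1 h'
      refine Finset.prod_eq_zero hb ?_
      by_contra hne
      exact hb' (hK.mem_of_hat_pos hκ hκ' hx hx' (h hb)
        (lt_of_le_of_ne ((hK.isSimplex κ hκ).hat_nonneg hx (h hb)) (Ne.symm hne)))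
    intro κ hκ κ' hκ' x hx hx'
    split_ifs with h h' h'
    · exact Finset.prod_congr rfl fun b hb => hK.hat_eq_hat hκ hκ' hx hx' (h hb) (h' hb)
    · exact aux κ hκ κ' hκ' x hx hx' h h'
    · exact (aux κ' hκ' κ hκ x hx' hx h' h).symm
    · rfl
  eq_zero κ hκ x hx hxf := by
    split_ifs with h
    · by_contra hne
      have hs := hK.isSimplex κ hκ
      have hpos : ∀ b ∈ τ, 0 < hat κ b x := fun b hb =>
        lt_of_le_of_ne (hs.hat_nonneg hx (h hb)) fun e => hne (Finset.prod_eq_zero hb e.symm)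
      obtain ⟨z, hz, hzf⟩ := Set.not_subset.1 hf
      -- The face carrying `x` in its relative interior. It contains `τ` when the bubble is nonzero
      -- at `x`; since `τ` has a point interior to the region, `x` would be interior as well.
      set τ' := κ.filter fun b => 0 < hat κ b x with hτ'
      have hsub : τ ⊆ τ' := fun b hb => Finset.mem_filter.2 ⟨h hb, hpos b hb⟩
      have hτκ : τ' ⊆ κ := Finset.filter_subset _ _
      have hzτ' : z ∈ hull τ' := convexHull_mono (by exact_mod_cast hsub) hz
      have hxτ' : x ∈ hull τ' := (hs.mem_hull_of_subset hτκ).2 ⟨hx, fun b hb hb' => by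
        by_contra hne'
        exact hb' (Finset.mem_filter.2 ⟨hb, lt_of_le_of_ne (hs.hat_nonneg hx hb) (Ne.symm hne')⟩)⟩
      have hzi : z ∈ interior (region K) := by
        rw [(isClosed_region K).frontier_eq] at hzf
        by_contra hni
        exact hzf ⟨hull_subset_region hκ ((hs.mem_hull_of_subset hτκ).1 hzτ').1, hni⟩
      have := hK.mem_interior_region_of_face hκ hτκ hxτ'
        (fun b hb => (Finset.mem_filter.1 hb).2) hzτ' hzi
      rw [(isClosed_region K).frontier_eq] at hxf
      exact hxf.2 this
    · rfl

/-- Compares two integrations by parts for the same bubble: the weak one, with right-hand side `c`,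
and the elementwise one, with the true divergences and the jumps. -/
lemma sum_integral_bubble_eq_zero {v : Spx d → RT d} {c : ℝ}
    (hv : HasWeakDiv (interior (region K)) (rtField K v) fun _ => c)
    {τ : Spx d} (hf : ¬ hull τ ⊆ frontier (region K)) :
    ∑ σ ∈ intFacets K, faceMean K (fun κ => if τ ⊆ κ then bubble κ τ else 0) σ * jump K v σ =
      ∑ κ ∈ K with τ ⊆ κ, (rtDiv (v κ) - c) * ∫ x in hull κ, bubble κ τ x := by
  set g : Spx d → Pt d → ℝ := fun κ => if τ ⊆ κ then bubble κ τ else 0 with hgdef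
  have hg : IsFitting K g := hK.isFitting_bubble hf
  -- On an open simplex the bubble is either positive or identically zero, so the condition on the
  -- zero set is immediate.
  have hH := hg.memH10_glue fun κ hκ => Eventually.of_forall fun x hx h0 => by
    by_cases h : τ ⊆ κ
    · simp only [hgdef, if_pos h] at h0
      exact absurd h0 (Finset.prod_pos fun b hb =>
        (hK.isSimplex κ hκ).mem_interior_hull.1 hx b (h hb)).ne'
    · simp only [hgdef, if_neg h]; rw [fderiv_zero]; rfl
  have key := hv.integral_inner_eq hH
  have hc0 : ∀ κ ∈ K, Continuous (g κ) := fun κ hκ => (hg.contDiff κ hκ).continuous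
  have hc1 : ∀ κ ∈ K, Continuous fun x => fderiv ℝ (g κ) x (rtEval (v κ) x) := fun κ hκ => by
    have h1 := continuous_rtEval (v κ)
    have h2 := (hg.contDiff_one hκ).continuous_fderiv one_ne_zero
    fun_prop
  rw [hK.setIntegral_interior_region (G := fun κ x => fderiv ℝ (g κ) x (rtEval (v κ) x))
    (fun κ hκ => Continuous.integrableOn_hull (hc1 κ hκ) κ) (fun κ hκ x hx => by
      rw [hg.gradient_glue hκ hx, real_inner_comm, inner_gradient_left]
      congr 1
      exact hK.pw_apply hκ _ hx),
    hK.setIntegral_interior_region (G := fun κ x => c * g κ x)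
    (fun κ hκ => Continuous.integrableOn_hull ((hc0 κ hκ).const_mul c) κ) (fun κ hκ x hx => by
      rw [hg.glue_eq hκ (interior_subset hx)])] at key
  rw [← hK.sum_integral_rt hg, Finset.sum_filter]
  rw [Finset.sum_congr rfl fun κ hκ => integral_add
    (Continuous.integrableOn_hull (hc1 κ hκ) κ)
    (Continuous.integrableOn_hull ((hc0 κ hκ).const_mul (rtDiv (v κ))) κ),
    Finset.sum_add_distrib, key, neg_add_eq_sub, ← Finset.sum_sub_distrib]
  refine Finset.sum_congr rfl fun κ hκ => ?_
  rw [integral_const_mul, integral_const_mul, ← sub_mul]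
  split_ifs with h
  · simp only [hgdef, if_pos h]
  · simp [hgdef, if_neg h]

lemma faceMean_bubble_eq_zero {τ σ : Spx d} (hf : ¬ hull τ ⊆ frontier (region K)) (hσ : σ ∈ intFacets K) (hτσ : ¬ τ ⊆ σ) :
    faceMean K (fun κ => if τ ⊆ κ then bubble κ τ else 0) σ = 0 := by
  have hg := hK.isFitting_bubble hf
  obtain ⟨⟨κ, hκ, hσκ⟩, -⟩ := mem_intFacets.1 hσ
  rw [← hK.traceMean_eq_faceMean hg hκ hσκ]
  refine (hK.isSimplex κ hκ).traceMean_eq_zero hσκ (hg.contDiff_one hκ) fun x hx => ?_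
  split_ifs with h
  · obtain ⟨b, hb, hbσ⟩ := Finset.not_subset.1 hτσ
    exact Finset.prod_eq_zero hb
      (((hK.isSimplex κ hκ).mem_hull_of_subset (facet_subset hσκ)).1 hx |>.2 b (h hb) hbσ)
  · rfl

/-- Test with the bubble of the whole simplex: it vanishes on every facet, so no jump contributes,
and only this simplex contains all its vertices. -/
lemma rtDiv_eq_of_hasWeakDiv {v : Spx d → RT d} {c : ℝ}
    (hv : HasWeakDiv (interior (region K)) (rtField K v) fun _ => c) {κ : Spx d} (hκ : κ ∈ K) :
    rtDiv (v κ) = c := by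
  have h := hK.isSimplex κ hκ
  have hf : ¬ hull κ ⊆ frontier (region K) := fun hsub => by
    obtain ⟨x, hx⟩ := h.interior_nonempty
    have := hsub (interior_subset hx)
    rw [(isClosed_region K).frontier_eq] at this
    exact this.2 (interior_hull_subset hκ hx)
  have key := hK.sum_integral_bubble_eq_zero hv hf
  rw [Finset.sum_eq_zero fun σ hσ => ?_, Finset.sum_eq_single_of_mem κ (by simp [hκ])] at key
  · have := mul_eq_zero.1 key.symm
    have hp := h.integral_bubble_pos (τ := κ) subset_rfl
    rcases this with h1 | h1
    · linarith
    · exact absurd h1 hp.ne'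
  · intro κ' hκ' hne
    rw [Finset.mem_filter] at hκ'
    exact absurd (hK.eq_of_subset hκ hκ'.1 hκ'.2).symm hne
  · rw [hK.faceMean_bubble_eq_zero hf hσ, zero_mul]
    obtain ⟨⟨κ', hκ', hσκ⟩, -⟩ := mem_intFacets.1 hσ
    intro hsub
    have h1 := Finset.card_le_card hsub
    rw [h.card_eq, (Finset.mem_powersetCard.1 hσκ).2] at h1
    omega

/-- Test with the bubble of the facet itself. The divergence terms are already known to cancel, and
every other facet has face mean zero because it misses one of the vertices. -/
lemma jump_eq_zero_of_hasWeakDiv {v : Spx d → RT d} {c : ℝ}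
    (hv : HasWeakDiv (interior (region K)) (rtField K v) fun _ => c) {σ : Spx d}
    (hσ : σ ∈ intFacets K) : jump K v σ = 0 := by
  obtain ⟨⟨κ, hκ, hσκ⟩, hf⟩ := mem_intFacets.1 hσ
  have h := hK.isSimplex κ hκ
  have key := hK.sum_integral_bubble_eq_zero hv hf
  rw [Finset.sum_eq_zero (s := K.filter _) fun κ' hκ' => by
      rw [hK.rtDiv_eq_of_hasWeakDiv hv (Finset.mem_filter.1 hκ').1, sub_self, zero_mul],
    Finset.sum_eq_single_of_mem σ hσ,
    ← hK.traceMean_eq_faceMean (hK.isFitting_bubble hf) hκ hσκ,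
    if_pos (facet_subset hσκ)] at key
  · exact (mul_eq_zero.1 key).resolve_left (h.traceMean_bubble_pos hσκ).ne'
  · intro σ' hσ' hne
    rw [hK.faceMean_bubble_eq_zero hf hσ', zero_mul]
    obtain ⟨⟨κ', hκ', hσκ'⟩, -⟩ := mem_intFacets.1 hσ'
    intro hsub
    refine hne (Finset.eq_of_subset_of_card_le hsub ?_).symm
    rw [(Finset.mem_powersetCard.1 hσκ').2, (Finset.mem_powersetCard.1 hσκ).2]

/-! ### Connectivity through interior faces -/

/-- If `K` has connected interior, then a nonempty set of simplices of `K` closed under passing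
through interior faces is all of `K`. -/
lemma eq_of_closed_under_adjacency (hconn : IsPreconnected (interior (region K))) {S : Coll d}
    (hSK : S ⊆ K) (hS : S.Nonempty)
    (hadj : ∀ κ ∈ S, ∀ κ' ∈ K, ∀ σ ∈ intFacets K, σ ∈ facets κ → σ ∈ facets κ' → κ' ∈ S) :
    S = K := by
  by_contra hne
  have hd : (K \ S).Nonempty := by
    rw [Finset.sdiff_nonempty]
    exact fun h => hne (Finset.Subset.antisymm hSK h)
  obtain ⟨κa, hκa⟩ := hS
  obtain ⟨κb, hκb⟩ := hd
  have hcover : region K ⊆ region S ∪ region (K \ S) := fun x hx => by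
    obtain ⟨κ, hκ, hxκ⟩ := mem_region.1 hx
    by_cases hκS : κ ∈ S
    · exact Or.inl (mem_region.2 ⟨κ, hκS, hxκ⟩)
    · exact Or.inr (mem_region.2 ⟨κ, Finset.mem_sdiff.2 ⟨hκ, hκS⟩, hxκ⟩)
  have hint : ∀ L ⊆ K, ∀ κ ∈ L, (interior (region K) ∩ region L).Nonempty := fun L hL κ hκ => by
    obtain ⟨x, hx⟩ := (hK.isSimplex κ (hL hκ)).interior_nonempty
    exact ⟨x, interior_hull_subset (hL hκ) hx, hull_subset_region hκ (interior_subset hx)⟩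
  obtain ⟨x, hxU, hxS, hxT⟩ := isPreconnected_closed_iff.1 hconn _ _ (isClosed_region S)
    (isClosed_region (K \ S)) (interior_subset.trans hcover) (hint S hSK κa hκa)
    (hint _ Finset.sdiff_subset κb hκb)
  obtain ⟨κ, hκ, hxκ⟩ := mem_region.1 hxS
  obtain ⟨κ', hκ', hxκ'⟩ := mem_region.1 hxT
  rw [Finset.mem_sdiff] at hκ'
  obtain ⟨r, hr, hball⟩ := Metric.isOpen_iff.1 isOpen_interior x hxU
  have hnear : ∀ κ₁ ∈ K, x ∈ hull κ₁ → (interior (hull κ₁) ∩ Metric.ball x r).Nonempty :=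
    fun κ₁ hκ₁ hx₁ => by
      have hcl : x ∈ closure (interior (hull κ₁)) := by
        rw [(convex_hull κ₁).closure_interior_eq_closure_of_nonempty_interior
          (hK.isSimplex κ₁ hκ₁).interior_nonempty, (isClosed_hull κ₁).closure_eq]
        exact hx₁
      obtain ⟨y, hy, hy'⟩ := mem_closure_iff.1 hcl _ Metric.isOpen_ball (Metric.mem_ball_self hr)
      exact ⟨y, hy', hy⟩
  obtain ⟨y, hyκ, hyr⟩ := hnear κ (hSK hκ) hxκ
  -- A face with fewer than `d` vertices spans, together with `y`, a proper affine subspace. A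
  -- target `y'` outside all these null sets is joined to `y` by a segment that can meet such a face
  -- only at `y` itself.
  obtain ⟨N, hN⟩ : ∃ N : Set (Pt d), N = ⋃ κ₁ ∈ K, ⋃ τ ∈ κ₁.powerset.filter (·.card < d),
    (affineSpan ℝ ((insert y τ : Spx d) : Set (Pt d)) : Set (Pt d)) := ⟨_, rfl⟩
  have hN0 : volume N = 0 := by
    rw [hN]
    refine (measure_biUnion_null_iff K.countable_toSet).2 fun κ₁ _ => ?_
    refine (measure_biUnion_null_iff (Finset.countable_toSet _)).2 fun τ hτ => ?_
    refine Measure.addHaar_affineSubspace volume _ fun htop => ?_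
    have hcard : (insert y τ : Spx d).card ≤ d :=
      (Finset.card_insert_le _ _).trans (Finset.mem_filter.1 (Finset.mem_coe.1 hτ)).2
    have h1 : Module.finrank ℝ (vectorSpan ℝ ((insert y τ : Spx d) : Set (Pt d))) = d := by
      rw [← direction_affineSpan, htop, AffineSubspace.direction_top, finrank_top,
        finrank_euclideanSpace_fin]
    have hpos : 0 < (insert y τ : Spx d).card := Finset.card_pos.2 ⟨y, Finset.mem_insert_self _ _⟩
    have h2 := finrank_vectorSpan_image_finset_le ℝ (id : Pt d → Pt d) (insert y τ)
      (n := (insert y τ : Spx d).card - 1) (by omega)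
    rw [Finset.image_id, h1] at h2
    omega
  obtain ⟨y', ⟨hyκ', hyr'⟩, hyN⟩ :
      ((interior (hull κ') ∩ Metric.ball x r) \ N).Nonempty := by
    rw [Set.nonempty_iff_ne_empty]
    intro hemp
    have hle := measure_mono_null (Set.sdiff_eq_empty.1 hemp) hN0
    exact ((isOpen_interior.inter Metric.isOpen_ball).measure_pos volume
      (hnear κ' hκ'.1 hxκ')).ne' hle
  have hseg : segment ℝ y y' ⊆ interior (region K) :=
    ((convex_ball x r).segment_subset hyr hyr').trans hball
  -- The segment leaves the region of `S` at a point shared with a simplex outside `S`; by general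
  -- position this point lies on a common facet, which is interior.
  obtain ⟨z, hz, hzS, hzT⟩ := isPreconnected_closed_iff.1
    (convex_segment y y').isPreconnected _ _ (isClosed_region S) (isClosed_region (K \ S))
    (hseg.trans (interior_subset.trans hcover))
    ⟨y, left_mem_segment ℝ y y', mem_region.2 ⟨κ, hκ, interior_subset hyκ⟩⟩
    ⟨y', right_mem_segment ℝ y y', mem_region.2 ⟨κ', Finset.mem_sdiff.2 hκ', interior_subset hyκ'⟩⟩
  obtain ⟨κ₁, hκ₁, hz₁⟩ := mem_region.1 hzS
  obtain ⟨κ₂, hκ₂, hz₂⟩ := mem_region.1 hzT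
  rw [Finset.mem_sdiff] at hκ₂
  have hne12 : κ₁ ≠ κ₂ := fun e => hκ₂.2 (e ▸ hκ₁)
  have hzτ : z ∈ hull (κ₁ ∩ κ₂) := hK.inter_eq κ₁ (hSK hκ₁) κ₂ hκ₂.1 ▸ ⟨hz₁, hz₂⟩
  have hcard1 := (hK.isSimplex κ₁ (hSK hκ₁)).card_eq
  have hcard2 := (hK.isSimplex κ₂ hκ₂.1).card_eq
  have hlt : (κ₁ ∩ κ₂).card < d + 1 := by
    rw [← hcard1]
    refine Finset.card_lt_card (Finset.inter_subset_left.ssubset_of_ne fun e => hne12 ?_)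
    exact hK.eq_of_subset (hSK hκ₁) hκ₂.1 (Finset.inter_eq_left.1 e)
  rcases lt_or_ge (κ₁ ∩ κ₂).card d with hlt' | hge
  · apply hyN
    rw [hN]
    simp only [Set.mem_iUnion]
    refine ⟨κ₁, hSK hκ₁, κ₁ ∩ κ₂, Finset.mem_filter.2
      ⟨Finset.mem_powerset.2 Finset.inter_subset_left, hlt'⟩, ?_⟩
    have hys : y ∈ affineSpan ℝ ((insert y (κ₁ ∩ κ₂) : Spx d) : Set (Pt d)) :=
      subset_affineSpan ℝ _ (by simp)
    have hzs : z ∈ affineSpan ℝ ((insert y (κ₁ ∩ κ₂) : Spx d) : Set (Pt d)) :=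
      affineSpan_mono ℝ (by simp) (convexHull_subset_affineSpan _ hzτ)
    obtain ⟨a, b, -, -, hab, hzab⟩ := hz
    -- If the crossing point were `y`, interior to a single simplex, both crossing simplices would
    -- coincide.
    have hb : b ≠ 0 := by
      rintro rfl
      have ha : a = 1 := by linarith
      rw [ha, one_smul, zero_smul, add_zero] at hzab
      rw [← hzab] at hz₁ hz₂
      have e1 := hK.eq_of_mem_interior (hSK hκ) (hSK hκ₁) hyκ hz₁
      have e2 := hK.eq_of_mem_interior (hSK hκ) hκ₂.1 hyκ hz₂
      exact hne12 (e1.symm.trans e2)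
    have : y' = AffineMap.lineMap y z b⁻¹ := by
      rw [AffineMap.lineMap_apply, vsub_eq_sub, vadd_eq_add, ← hzab]
      have ha : a = 1 - b := by linarith
      rw [ha, sub_smul, one_smul]
      have : y - b • y + b • y' - y = b • (y' - y) := by rw [smul_sub]; abel
      rw [this, smul_smul, inv_mul_cancel₀ hb, one_smul]; abel
    rw [this]
    exact AffineMap.lineMap_mem _ hys hzs
  · have hc : (κ₁ ∩ κ₂).card = d := by omega
    have hf1 : κ₁ ∩ κ₂ ∈ facets κ₁ := Finset.mem_powersetCard.2 ⟨Finset.inter_subset_left, hc⟩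
    have hf2 : κ₁ ∩ κ₂ ∈ facets κ₂ := Finset.mem_powersetCard.2 ⟨Finset.inter_subset_right, hc⟩
    refine hκ₂.2 (hadj κ₁ hκ₁ κ₂ hκ₂.1 _ (mem_intFacets.2 ⟨⟨κ₁, hSK hκ₁, hf1⟩, fun hsub => ?_⟩)
      hf1 hf2)
    have := hsub hzτ
    rw [(isClosed_region K).frontier_eq] at this
    exact this.2 (hseg hz)

end Conforming

/-! ### Elements and faces of a polytopal mesh -/

namespace PolytopalMesh

variable {Ω : Set (Pt d)} (M : PolytopalMesh d Ω)

lemma conforming (hd : 1 ≤ d) : Conforming M.Th :=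
  ⟨fun κ hκ => ⟨hd, M.isMesh.card_eq κ hκ, M.isMesh.affineIndependent κ hκ⟩, M.isMesh.inter_eq⟩

lemma interior_region_Th (hΩ : interior (closure Ω) = Ω) : interior (region M.Th) = Ω := by
  rw [M.isMesh.cover, hΩ]

lemma cell_subset {K : Coll d} (hK : K ∈ M.cells) : K ⊆ M.Th := M.TH.le hK

lemma conforming_cell (hd : 1 ≤ d) {K : Coll d} (hK : K ∈ M.cells) : Conforming K :=
  (M.conforming hd).mono (M.cell_subset hK)

lemma cell_nonempty {K : Coll d} (hK : K ∈ M.cells) : K.Nonempty :=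
  M.TH.nonempty_of_mem_parts hK

lemma cell_unique {K K' : Coll d} (hK : K ∈ M.cells) (hK' : K' ∈ M.cells) {κ : Spx d}
    (hκ : κ ∈ K) (hκ' : κ ∈ K') : K = K' := M.TH.eq_of_mem_parts hK hK' hκ hκ'

lemma exists_cell {κ : Spx d} (hκ : κ ∈ M.Th) : ∃ K ∈ M.cells, κ ∈ K := M.TH.exists_mem hκ

lemma sum_cells {V : Type*} [AddCommMonoid V] (G : Spx d → V) :
    ∑ κ ∈ M.Th, G κ = ∑ K ∈ M.cells, ∑ κ ∈ K, G κ := by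
  conv_lhs => rw [← M.TH.biUnion_parts]
  exact Finset.sum_biUnion M.TH.disjoint

lemma pwc_apply (hd : 1 ≤ d) {V : Type*} [AddCommMonoid V] (c : Coll d → V) {K : Coll d}
    (hK : K ∈ M.cells) {κ : Spx d} (hκ : κ ∈ K) {x : Pt d} (hx : x ∈ interior (hull κ)) :
    M.pwc c x = c K := by
  rw [pwc, Finset.sum_eq_single_of_mem K hK, Set.indicator_of_mem (interior_hull_subset hκ hx)]
  intro K' hK' hne
  refine Set.indicator_of_notMem (fun h => hne ?_) _
  obtain ⟨κ', hκ', hx'⟩ := mem_region.1 (interior_subset h)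
  have := (M.conforming hd).eq_of_mem_interior (M.cell_subset hK hκ) (M.cell_subset hK' hκ') hx hx'
  exact M.cell_unique hK' hK hκ' (this ▸ hκ)

section ExtFacets

variable {K : Coll d} (hK : K ∈ M.cells) {σ : Spx d} (hσ : σ ∈ extFacets K)

include hK hσ

lemma part_mem : M.FH.part σ ∈ M.FH.parts :=
  M.FH.part_mem.2 (Finset.mem_biUnion.2 ⟨K, hK, hσ⟩)

lemma mem_part : σ ∈ M.FH.part σ := M.FH.mem_part (Finset.mem_biUnion.2 ⟨K, hK, hσ⟩)

lemma part_subset : M.FH.part σ ⊆ extFacets K :=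
  M.face_entire _ (M.part_mem hK hσ) K hK σ (M.mem_part hK hσ) hσ

lemma cellNormal_part {κ : Spx d} (hκ : κ ∈ K) (hσκ : σ ∈ facets κ) :
    M.cellNormal K (M.FH.part σ) = outNormal κ σ :=
  M.cellNormal_eq K hK _ (M.part_mem hK hσ) (M.part_subset hK hσ) σ (M.mem_part hK hσ) κ hκ hσκ

/-- Two adjacent simplices have opposite outward normals on the facet, whereas the mesh structure
assigns one normal to both on an exterior face. -/
lemma eq_of_mem_extFacets (hd : 1 ≤ d) {κ κ' : Spx d} (hκ : κ ∈ K) (hκ' : κ' ∈ K)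
    (hσκ : σ ∈ facets κ) (hσκ' : σ ∈ facets κ') : κ = κ' := by
  by_contra hne
  have hc := M.conforming_cell hd hK
  have h1 := hc.outNormal_eq_neg hκ hκ' hne hσκ hσκ'
  rw [← M.cellNormal_part hK hσ hκ hσκ, ← M.cellNormal_part hK hσ hκ' hσκ'] at h1
  have h2 := (hc.isSimplex κ hκ).norm_outNormal hσκ
  have h3 : M.cellNormal K (M.FH.part σ) = 0 := by
    have : (2 : ℝ) • M.cellNormal K (M.FH.part σ) = 0 := by
      rw [two_smul]; exact eq_neg_iff_add_eq_zero.1 h1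
    simpa using this
  rw [← M.cellNormal_part hK hσ hκ hσκ, h3, norm_zero] at h2
  exact zero_ne_one h2

lemma inner_outNormal_normal_sq (hd : 1 ≤ d) {κ : Spx d} (hκ : κ ∈ K) (hσκ : σ ∈ facets κ) :
    inner ℝ (outNormal κ σ) (M.normal (M.FH.part σ)) *
      inner ℝ (outNormal κ σ) (M.normal (M.FH.part σ)) = 1 :=
  ((M.conforming_cell hd hK).isSimplex κ hκ).inner_outNormal_sq hσκ
    (M.normal_unit _ (M.part_mem hK hσ)) fun b hb c hc =>
      M.normal_orthogonal _ (M.part_mem hK hσ) σ (M.mem_part hK hσ) σ (M.mem_part hK hσ) b hb c hc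

/-- The fixed and the outward normals differ by a sign of square one, so multiplying by it passes
between the two orientations. -/
lemma integral_normal_eq_subFlux_iff (hd : 1 ≤ d) {κ : Spx d} (hκ : κ ∈ K) (hσκ : σ ∈ facets κ)
    (U : Coll d → ℝ) (r : RT d) :
    ∫ x in hull σ, inner ℝ (rtEval r x) (M.normal (M.FH.part σ)) ∂μHE[d - 1] = M.subFlux U σ ↔
      flux κ σ r = M.extFlux U K ⟨σ, hσ⟩ := by
  have h1 := M.inner_outNormal_normal_sq hK hσ hd hκ hσκ
  rw [((M.conforming_cell hd hK).isSimplex κ hκ).integral_inner_normal hσκ r fun b hb c hc =>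
    M.normal_orthogonal _ (M.part_mem hK hσ) σ (M.mem_part hK hσ) σ (M.mem_part hK hσ) b hb c hc,
    extFlux, M.cellNormal_part hK hσ hκ hσκ]
  set o : ℝ := inner ℝ (outNormal κ σ) (M.normal (M.FH.part σ))
  constructor
  · intro h; rw [← h, ← mul_assoc, h1, one_mul]
  · intro h; rw [h, ← mul_assoc, h1, one_mul]

end ExtFacets

/-- Replaces the analytic constraints by linear equations in the face fluxes; from here on the local
problem is linear algebra. -/
lemma isAdmissible_iff (hd : 1 ≤ d) {K : Coll d} (hK : K ∈ M.cells) {U : Coll d → ℝ} {c : ℝ}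
    {v : Spx d → RT d} : M.IsAdmissible U K c v ↔
      (∀ κ ∈ K, rtDiv (v κ) = c) ∧ (∀ σ ∈ intFacets K, jump K v σ = 0) ∧
        ∀ κ ∈ K, ∀ σ : extFacets K, (σ : Spx d) ∈ facets κ → flux κ σ (v κ) = M.extFlux U K σ := by
  have hc := M.conforming_cell hd hK
  constructor
  · rintro ⟨h1, h2⟩
    exact ⟨fun κ hκ => hc.rtDiv_eq_of_hasWeakDiv h1 hκ,
      fun σ hσ => hc.jump_eq_zero_of_hasWeakDiv h1 hσ, fun κ hκ σ hσκ =>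
      (M.integral_normal_eq_subFlux_iff hK σ.2 hd hκ hσκ U (v κ)).1 (h2 κ hκ σ hσκ σ.2)⟩
  · rintro ⟨h1, h2, h3⟩
    exact ⟨hc.hasWeakDiv_of_jump_eq_zero (fun κ hκ _ _ => (h1 κ hκ).symm) h2,
      fun κ hκ σ hσκ hσ =>
        (M.integral_normal_eq_subFlux_iff hK hσ hd hκ hσκ U (v κ)).2 (h3 κ hκ ⟨σ, hσ⟩ hσκ)⟩

lemma cellFaces_pairwiseDisjoint (K : Coll d) :
    Set.PairwiseDisjoint (M.cellFaces K : Set (Coll d)) id :=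
  M.FH.disjoint.subset (by exact_mod_cast Finset.filter_subset _ _)

lemma biUnion_cellFaces {K : Coll d} (hK : K ∈ M.cells) :
    (M.cellFaces K).biUnion id = extFacets K := by
  ext σ
  simp only [Finset.mem_biUnion, id, cellFaces, Finset.mem_filter]
  constructor
  · rintro ⟨F, ⟨-, hF⟩, hσ⟩
    exact hF hσ
  · intro hσ
    exact ⟨_, ⟨M.part_mem hK hσ, M.part_subset hK hσ⟩, M.mem_part hK hσ⟩

/-- The flux of a polytopal face is distributed in proportion to area, so its pieces recombine. The
result is the compatibility condition of the local Neumann problem. -/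
lemma sum_extFlux (hd : 1 ≤ d) {K : Coll d} (hK : K ∈ M.cells) {f U : Coll d → ℝ}
    (hU : M.FluxBalance f U) : ∑ σ : extFacets K, M.extFlux U K σ = M.load f K := by
  rw [← hU K hK]
  have h1 : ∑ σ : extFacets K, M.extFlux U K σ = ∑ σ ∈ extFacets K,
      inner ℝ (M.cellNormal K (M.FH.part σ)) (M.normal (M.FH.part σ)) * M.subFlux U σ :=
    Finset.sum_coe_sort (extFacets K) fun σ =>
      inner ℝ (M.cellNormal K (M.FH.part σ)) (M.normal (M.FH.part σ)) * M.subFlux U σ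
  rw [h1, ← M.biUnion_cellFaces hK, Finset.sum_biUnion (M.cellFaces_pairwiseDisjoint K)]
  refine Finset.sum_congr rfl fun F hF => ?_
  simp only [cellFaces, Finset.mem_filter] at hF
  have hpart : ∀ σ ∈ F, M.FH.part σ = F := fun σ hσ => M.FH.part_eq_of_mem hF.1 hσ
  have hpos : ∀ σ ∈ F, 0 < area σ := fun σ hσ => by
    obtain ⟨⟨κ, hκ, hσκ⟩, -⟩ := mem_extFacets.1 (hF.2 hσ)
    exact ((M.conforming_cell hd hK).isSimplex κ hκ).area_pos hσκ
  have hS : 0 < ∑ τ ∈ F, area τ := Finset.sum_pos hpos (M.FH.nonempty_of_mem_parts hF.1)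
  rw [id, Finset.sum_congr rfl fun σ hσ => by rw [subFlux, hpart σ hσ], ← Finset.mul_sum,
    ← Finset.mul_sum, div_mul_cancel₀ _ hS.ne', mul_comm]

lemma load_eq (hd : 1 ≤ d) {K : Coll d} (hK : K ∈ M.cells) (f : Coll d → ℝ) :
    M.load f K = f K * ∑ κ ∈ K, vol κ := by
  rw [load, (M.conforming_cell hd hK).setIntegral_region (G := fun _ _ => f K)
    (fun κ _ => Continuous.integrableOn_hull continuous_const κ)
    (fun κ hκ x hx => M.pwc_apply hd f hK hκ hx), Finset.mul_sum]
  refine Finset.sum_congr rfl fun κ _ => ?_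
  rw [setIntegral_const, smul_eq_mul, mul_comm, vol]

lemma volume_region (hd : 1 ≤ d) {K : Coll d} (hK : K ∈ M.cells) :
    volume.real (region K) = ∑ κ ∈ K, vol κ := by
  have := (M.conforming_cell hd hK).setIntegral_region (H := fun _ => (1 : ℝ)) (G := fun _ _ => 1)
    (fun κ _ => Continuous.integrableOn_hull continuous_const κ) (fun _ _ _ _ => rfl)
  simpa [vol] using this

lemma sum_vol_pos (hd : 1 ≤ d) {K : Coll d} (hK : K ∈ M.cells) : 0 < ∑ κ ∈ K, vol κ :=
  Finset.sum_pos (fun κ hκ => ((M.conforming_cell hd hK).isSimplex κ hκ).vol_pos)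
    (M.cell_nonempty hK)

end PolytopalMesh

/-! ### Saddle-point matrices -/

section Saddle

open Matrix

variable {ι κ ε : Type*} [Fintype ι] [Fintype κ] [Fintype ε] [DecidableEq (ι ⊕ κ)]
  {A : Matrix ι ι ℝ} {B : Matrix κ ι ℝ}

/-- For `(x, y)` in the kernel, `x · Ax = -(Bx) · y = 0`, so definiteness removes `x`, and
injectivity of the transpose removes `y`. -/
lemma isUnit_fromBlocks_saddle (hA : ∀ x, x ⬝ᵥ A *ᵥ x ≤ 0 → x = 0)
    (hB : ∀ y, Bᵀ *ᵥ y = 0 → y = 0) : IsUnit (fromBlocks A Bᵀ B 0) := by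
  rw [← mulVec_injective_iff_isUnit]
  refine (injective_iff_map_eq_zero (mulVecLin (fromBlocks A Bᵀ B 0))).2 fun z hz => ?_
  rw [mulVecLin_apply, fromBlocks_mulVec, zero_mulVec, add_zero] at hz
  have h1 : A *ᵥ (z ∘ Sum.inl) + Bᵀ *ᵥ (z ∘ Sum.inr) = 0 := by
    ext i; exact congrFun hz (Sum.inl i)
  have h2 : B *ᵥ (z ∘ Sum.inl) = 0 := by ext i; exact congrFun hz (Sum.inr i)
  have h3 : z ∘ Sum.inl = 0 := hA _ <| by
    rw [eq_neg_of_add_eq_zero_left h1, dotProduct_neg, dotProduct_mulVec, vecMul_transpose, h2,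
      zero_dotProduct, neg_zero]
  rw [h3, mulVec_zero, zero_add] at h1
  have h4 := hB _ h1
  ext (i | i)
  · exact congrFun h3 i
  · exact congrFun h4 i

/-- The minimizer is minus the first block of the solution with right-hand side `(C₁ U, C₂ U)`. The
last identity has no linear term in `y - x`: this difference lies in the kernel of `B`, on which the
Lagrange multiplier acts trivially. -/
lemma exists_saddle_solution (hA : Aᵀ = A) (hS : IsUnit (fromBlocks A Bᵀ B 0))
    (A₀ : Matrix ε ε ℝ) (C₁ : Matrix ι ε ℝ) (C₂ : Matrix κ ε ℝ) (U : ε → ℝ) :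
    ∃ x, C₂ *ᵥ U + B *ᵥ x = 0 ∧
      U ⬝ᵥ A₀ *ᵥ U + 2 * (x ⬝ᵥ C₁ *ᵥ U) + x ⬝ᵥ A *ᵥ x =
        U ⬝ᵥ (A₀ - (fromRows C₁ C₂)ᵀ * (fromBlocks A Bᵀ B 0)⁻¹ * fromRows C₁ C₂) *ᵥ U ∧
      ∀ y, C₂ *ᵥ U + B *ᵥ y = 0 →
        U ⬝ᵥ A₀ *ᵥ U + 2 * (y ⬝ᵥ C₁ *ᵥ U) + y ⬝ᵥ A *ᵥ y =
          U ⬝ᵥ A₀ *ᵥ U + 2 * (x ⬝ᵥ C₁ *ᵥ U) + x ⬝ᵥ A *ᵥ x + (y - x) ⬝ᵥ A *ᵥ (y - x) := by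
  set z := (fromBlocks A Bᵀ B 0)⁻¹ *ᵥ (fromRows C₁ C₂ *ᵥ U) with hz
  set z₁ := z ∘ Sum.inl with hz₁
  set z₂ := z ∘ Sum.inr with hz₂
  have hSz : fromBlocks A Bᵀ B 0 *ᵥ z = fromRows C₁ C₂ *ᵥ U := by
    rw [hz, mulVec_mulVec, mul_nonsing_inv _ ((isUnit_iff_isUnit_det _).1 hS), one_mulVec]
  rw [fromBlocks_mulVec, zero_mulVec, add_zero, fromRows_mulVec] at hSz
  have h1 : A *ᵥ z₁ + Bᵀ *ᵥ z₂ = C₁ *ᵥ U := by ext i; exact congrFun hSz (Sum.inl i)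
  have h2 : B *ᵥ z₁ = C₂ *ᵥ U := by ext i; exact congrFun hSz (Sum.inr i)
  have hsym : ∀ a b : ι → ℝ, a ⬝ᵥ A *ᵥ b = b ⬝ᵥ A *ᵥ a := fun a b => by
    rw [dotProduct_mulVec, ← mulVec_transpose, hA, dotProduct_comm]
  have hBt : ∀ a : ι → ℝ, a ⬝ᵥ Bᵀ *ᵥ z₂ = (B *ᵥ a) ⬝ᵥ z₂ := fun a => by
    rw [dotProduct_mulVec, vecMul_transpose]
  have hC : ∀ a : ι → ℝ, a ⬝ᵥ C₁ *ᵥ U = a ⬝ᵥ A *ᵥ z₁ + (B *ᵥ a) ⬝ᵥ z₂ := fun a => by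
    rw [← h1, dotProduct_add, hBt]
  refine ⟨-z₁, ?_, ?_, fun y hy => ?_⟩
  · rw [mulVec_neg, h2, add_neg_cancel]
  · have h3 : U ⬝ᵥ ((fromRows C₁ C₂)ᵀ * (fromBlocks A Bᵀ B 0)⁻¹ * fromRows C₁ C₂) *ᵥ U =
        z₁ ⬝ᵥ C₁ *ᵥ U + z₂ ⬝ᵥ C₂ *ᵥ U := by
      rw [Matrix.mul_assoc, ← mulVec_mulVec, ← mulVec_mulVec, ← hz, dotProduct_mulVec,
        vecMul_transpose, dotProduct_comm, fromRows_mulVec, dotProduct, Fintype.sum_sum_type]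
      rfl
    rw [sub_mulVec, dotProduct_sub, h3, neg_dotProduct, mulVec_neg, neg_dotProduct, dotProduct_neg,
      hC z₁, h2, dotProduct_comm z₂]
    ring
  · have hy' : B *ᵥ y = -(B *ᵥ z₁) := by rw [h2]; exact eq_neg_of_add_eq_zero_right hy
    rw [sub_neg_eq_add, neg_dotProduct, mulVec_neg, neg_dotProduct, dotProduct_neg, hC y, hC z₁, hy',
      neg_dotProduct, mulVec_add, dotProduct_add, add_dotProduct, add_dotProduct, hsym z₁ y]
    ring

end Saddle

/-! ### The energy form on Raviart--Thomas functions -/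

lemma continuous_inner_map_rtEval (T : Pt d →ₗ[ℝ] Pt d) (q r : RT d) :
    Continuous fun x => (inner ℝ (T (rtEval q x)) (rtEval r x) : ℝ) :=
  (T.continuous_of_finiteDimensional.comp (continuous_rtEval q)).inner (continuous_rtEval r)

/-- The bilinear form `∑_{κ ∈ K} (T v, w)_κ`. -/
def cellForm (T : Pt d →ₗ[ℝ] Pt d) (K : Coll d) :
    (Spx d → RT d) →ₗ[ℝ] (Spx d → RT d) →ₗ[ℝ] ℝ :=
  LinearMap.mk₂ ℝ (fun v w => ∑ κ ∈ K, ∫ x in hull κ, inner ℝ (T (rtEval (v κ) x)) (rtEval (w κ) x))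
    (fun v v' w => by
      rw [← Finset.sum_add_distrib]
      refine Finset.sum_congr rfl fun κ _ => ?_
      rw [← integral_add
        (Continuous.integrableOn_hull (continuous_inner_map_rtEval T (v κ) (w κ)) κ)
        (Continuous.integrableOn_hull (continuous_inner_map_rtEval T (v' κ) (w κ)) κ)]
      simp only [Pi.add_apply, rtEval_add, map_add, inner_add_left])
    (fun c v w => by
      simp only [Pi.smul_apply, rtEval_smul, map_smul, real_inner_smul_left, integral_const_mul,
        Finset.mul_sum, smul_eq_mul])
    (fun v w w' => by
      rw [← Finset.sum_add_distrib]
      refine Finset.sum_congr rfl fun κ _ => ?_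
      rw [← integral_add
        (Continuous.integrableOn_hull (continuous_inner_map_rtEval T (v κ) (w κ)) κ)
        (Continuous.integrableOn_hull (continuous_inner_map_rtEval T (v κ) (w' κ)) κ)]
      simp only [Pi.add_apply, rtEval_add, inner_add_right])
    (fun c v w => by
      simp only [Pi.smul_apply, rtEval_smul, real_inner_smul_right, integral_const_mul,
        Finset.mul_sum, smul_eq_mul])

lemma cellForm_apply (T : Pt d →ₗ[ℝ] Pt d) (K : Coll d) (v w : Spx d → RT d) :
    cellForm T K v w =
      ∑ κ ∈ K, ∫ x in hull κ, inner ℝ (T (rtEval (v κ) x)) (rtEval (w κ) x) := rfl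

lemma cellForm_comm {T : Pt d →ₗ[ℝ] Pt d} (hT : T.IsSymmetric) (K : Coll d) (v w : Spx d → RT d) :
    cellForm T K v w = cellForm T K w v := by
  simp only [cellForm_apply]
  refine Finset.sum_congr rfl fun κ _ => integral_congr_ae (Eventually.of_forall fun x => ?_)
  simp only
  rw [hT, real_inner_comm]

lemma Conforming.integral_region_rtField {K : Coll d} (hK : Conforming K) (T : Pt d →ₗ[ℝ] Pt d)
    (v w : Spx d → RT d) :
    ∫ x in region K, inner ℝ (T (rtField K v x)) (rtField K w x) = cellForm T K v w :=
  hK.setIntegral_region (fun κ _ => Continuous.integrableOn_hull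
    (continuous_inner_map_rtEval T (v κ) (w κ)) κ) fun κ hκ x hx => by
      rw [rtField, rtField, hK.pw_apply hκ _ hx, hK.pw_apply hκ _ hx]

lemma IsSimplex.eq_zero_of_rtEval {κ : Spx d} (h : IsSimplex κ) {q : RT d}
    (hq : ∀ x ∈ hull κ, rtEval q x = 0) : q = 0 := by
  refine h.rt_ext fun σ hσ => ?_
  have hb : bary σ ∈ hull κ := by
    obtain ⟨a, ha, rfl⟩ := (mem_facets h.card_eq).1 hσ
    exact convexHull_mono (by exact_mod_cast Finset.erase_subset a κ) (h.bary_mem_hull ha)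
  rw [flux, hq _ hb, inner_zero_right, mul_zero, flux_zero]

/-- A sum of integrals of continuous nonnegative functions that is not positive forces each to
vanish on its whole simplex, and a Raviart–Thomas polynomial vanishing on a simplex is zero. -/
lemma Conforming.eq_zero_of_cellForm_le {K : Coll d} (hK : Conforming K) {T : Pt d →ₗ[ℝ] Pt d}
    (hT : ∀ x ≠ 0, 0 < (inner ℝ (T x) x : ℝ)) {v : Spx d → RT d} (hv : cellForm T K v v ≤ 0)
    {κ : Spx d} (hκ : κ ∈ K) : v κ = 0 := by
  have hT0 : ∀ x, 0 ≤ (inner ℝ (T x) x : ℝ) := fun x => by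
    by_cases hx : x = 0
    · simp [hx]
    · exact (hT x hx).le
  have h := hK.isSimplex κ hκ
  have hnn : ∀ κ ∈ K, 0 ≤ ∫ x in hull κ, (inner ℝ (T (rtEval (v κ) x)) (rtEval (v κ) x) : ℝ) :=
    fun κ _ => integral_nonneg fun x => hT0 _
  have h0 := (Finset.sum_eq_zero_iff_of_nonneg hnn).1
    (le_antisymm hv (Finset.sum_nonneg hnn)) κ hκ
  have hc := continuous_inner_map_rtEval T (v κ) (v κ)
  rw [integral_eq_zero_iff_of_nonneg (fun x => hT0 _) (Continuous.integrableOn_hull hc κ)] at h0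
  have h1 := Measure.eqOn_of_ae_eq h0 hc.continuousOn continuousOn_const (by
    rw [(convex_hull κ).closure_interior_eq_closure_of_nonempty_interior h.interior_nonempty]
    exact subset_closure)
  refine h.eq_zero_of_rtEval fun x hx => ?_
  by_contra hne
  exact (hT _ hne).ne' (h1 hx)

section PosDef

variable {A : Matrix (Fin d) (Fin d) ℝ} (hA : A.PosDef)

include hA

lemma isSymmetric_toEuclideanLin_of_posDef : (Matrix.toEuclideanLin A).IsSymmetric :=
  Matrix.isSymmetric_toEuclideanLin_iff.2 hA.isHermitian

lemma inner_toEuclideanLin_pos {x : Pt d} (hx : x ≠ 0) :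
    0 < (inner ℝ (Matrix.toEuclideanLin A x) x : ℝ) := by
  have h1 := hA.dotProduct_mulVec_pos (x := x.ofLp) (by simpa using hx)
  rw [Matrix.toLpLin_apply, EuclideanSpace.inner_eq_star_dotProduct, dotProduct_comm]
  simpa [dotProduct_comm] using h1

lemma toEuclideanLin_inv_apply (x : Pt d) :
    Matrix.toEuclideanLin A⁻¹ (Matrix.toEuclideanLin A x) = x := by
  rw [Matrix.toLpLin_apply, Matrix.toLpLin_apply]
  simp only [Matrix.mulVec_mulVec]
  rw [Matrix.nonsing_inv_mul _ ((Matrix.isUnit_iff_isUnit_det _).1 hA.isUnit), Matrix.one_mulVec]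

end PosDef

/-! ### Fluxes on a conforming collection -/

lemma sum_sum_facets (K : Coll d) {V : Type*} [AddCommMonoid V] (G : Spx d → Spx d → V) :
    ∑ κ ∈ K, ∑ σ ∈ facets κ, G κ σ =
      ∑ σ ∈ extFacets K, ∑ κ ∈ K with σ ∈ facets κ, G κ σ +
        ∑ σ ∈ intFacets K, ∑ κ ∈ K with σ ∈ facets κ, G κ σ := by
  rw [extFacets, intFacets, Finset.sum_filter_add_sum_filter_not]
  refine Finset.sum_comm' fun κ σ => ?_
  simp only [Finset.mem_filter, Finset.mem_biUnion]
  constructor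
  · rintro ⟨h1, h2⟩; exact ⟨⟨h1, h2⟩, κ, h1, h2⟩
  · rintro ⟨⟨h1, h2⟩, -⟩; exact ⟨h1, h2⟩

lemma sum_sum_flux (K : Coll d) (v : Spx d → RT d) (t : Spx d → ℝ) :
    ∑ κ ∈ K, ∑ σ ∈ facets κ, flux κ σ (v κ) * t σ =
      ∑ σ ∈ extFacets K, jump K v σ * t σ + ∑ σ ∈ intFacets K, jump K v σ * t σ := by
  rw [sum_sum_facets]
  simp only [jump, Finset.sum_mul]

lemma filter_facets_eq_pair {K : Coll d} (hK : Conforming K) {κ κ' σ : Spx d} (hκ : κ ∈ K)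
    (hκ' : κ' ∈ K) (hσ : σ ∈ facets κ) (hσ' : σ ∈ facets κ') (hne : κ ≠ κ') :
    (K.filter fun κ => σ ∈ facets κ) = {κ, κ'} := by
  ext τ
  simp only [Finset.mem_filter, Finset.mem_insert, Finset.mem_singleton]
  constructor
  · rintro ⟨h1, h2⟩
    exact hK.eq_or_eq_of_common_facet hκ hκ' h1 hσ hσ' h2 hne
  · rintro (rfl | rfl)
    · exact ⟨hκ, hσ⟩
    · exact ⟨hκ', hσ'⟩

lemma Conforming.jump_eq_add {K : Coll d} (hK : Conforming K) {κ κ' σ : Spx d} (hκ : κ ∈ K)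
    (hκ' : κ' ∈ K) (hσ : σ ∈ facets κ) (hσ' : σ ∈ facets κ') (hne : κ ≠ κ') (v : Spx d → RT d) :
    jump K v σ = flux κ σ (v κ) + flux κ' σ (v κ') := by
  rw [jump, filter_facets_eq_pair hK hκ hκ' hσ hσ' hne, Finset.sum_pair hne]

namespace PolytopalMesh

variable {Ω : Set (Pt d)} (M : PolytopalMesh d Ω)

/-- The sign of the basis function of the face `σ` in the simplex `κ` of `K`. -/
def faceSign (K : Coll d) (κ σ : Spx d) : ℝ :=
  if σ ∈ extFacets K then 1 else inner ℝ (outNormal κ σ) (M.simplexNormal σ)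

lemma rtBasis_eq (K : Coll d) (σ κ : Spx d) :
    M.rtBasis K σ κ = if σ ∈ facets κ then M.faceSign K κ σ • rtUnit κ σ else 0 := by
  rw [rtBasis, faceSign, rtUnit, smul_smul, div_eq_mul_inv]

/-- The field with the given coefficients in the basis associated with the faces in `S`. -/
def combo (K : Coll d) (S : Finset (Spx d)) (c : S → ℝ) : Spx d → RT d :=
  ∑ σ : S, c σ • M.rtBasis K σ

section Cell

variable {K : Coll d} (hK : K ∈ M.cells) (hd : 1 ≤ d)

include hK hd

lemma faceSign_mul_self {κ σ : Spx d} (hκ : κ ∈ K) (hσ : σ ∈ facets κ) :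
    M.faceSign K κ σ * M.faceSign K κ σ = 1 := by
  rw [faceSign]
  split_ifs
  · norm_num
  · have hm : σ ∈ M.Th.biUnion facets := Finset.mem_biUnion.2 ⟨κ, M.cell_subset hK hκ, hσ⟩
    exact ((M.conforming_cell hd hK).isSimplex κ hκ).inner_outNormal_sq hσ
      (M.simplexNormal_unit σ hm) (M.simplexNormal_orthogonal σ hm)

lemma faceSign_neg {κ κ' σ : Spx d} (hκ : κ ∈ K) (hκ' : κ' ∈ K) (hne : κ ≠ κ')
    (hσ : σ ∈ facets κ) (hσ' : σ ∈ facets κ') : M.faceSign K κ' σ = -M.faceSign K κ σ := by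
  have hi : σ ∉ extFacets K := fun h => hne (M.eq_of_mem_extFacets hK h hd hκ hκ' hσ hσ')
  rw [faceSign, faceSign, if_neg hi, if_neg hi,
    (M.conforming_cell hd hK).outNormal_eq_neg hκ hκ' hne hσ hσ', inner_neg_left]

lemma flux_rtBasis {κ σ τ : Spx d} (hκ : κ ∈ K) (hτ : τ ∈ facets κ) :
    flux κ τ (M.rtBasis K σ κ) = if τ = σ then M.faceSign K κ τ else 0 := by
  rw [rtBasis_eq]
  by_cases hσ : σ ∈ facets κ
  · rw [if_pos hσ, flux_smul, ((M.conforming_cell hd hK).isSimplex κ hκ).flux_rtUnit hσ hτ]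
    split_ifs with h
    · rw [h, mul_one]
    · rw [mul_zero]
  · rw [if_neg hσ, flux_zero, if_neg]
    rintro rfl
    exact hσ hτ

lemma flux_combo {S : Finset (Spx d)} (c : S → ℝ) {κ τ : Spx d} (hκ : κ ∈ K) (hτ : τ ∈ facets κ) :
    flux κ τ (M.combo K S c κ) = if h : τ ∈ S then M.faceSign K κ τ * c ⟨τ, h⟩ else 0 := by
  rw [combo, Finset.sum_apply, flux_sum]
  simp only [Pi.smul_apply, flux_smul, M.flux_rtBasis hK hd hκ hτ]
  split_ifs with h
  · rw [Finset.sum_eq_single ⟨τ, h⟩, if_pos rfl, mul_comm]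
    · intro σ _ hne
      rw [if_neg fun e => hne (Subtype.ext e.symm), mul_zero]
    · simp
  · refine Finset.sum_eq_zero fun σ _ => ?_
    rw [if_neg fun e : τ = σ => h (e ▸ σ.2), mul_zero]

/-- The vectors of face fluxes determine the fields with normal traces that are continuous in the
interior of the element. -/
lemma exists_eq_combo {v : Spx d → RT d} {c : extFacets K → ℝ}
    (hj : ∀ σ ∈ intFacets K, jump K v σ = 0)
    (hv : ∀ κ ∈ K, ∀ σ : extFacets K, (σ : Spx d) ∈ facets κ → flux κ σ (v κ) = c σ) :
    ∃ x : intFacets K → ℝ, ∀ κ ∈ K,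
      v κ = (M.combo K (extFacets K) c + M.combo K (intFacets K) x) κ := by
  have hc := M.conforming_cell hd hK
  choose κ₀ hκ₀ hσ₀ using fun σ : intFacets K => (mem_intFacets.1 σ.2).1
  -- The coefficient is read off on one chosen side `κ₀`. On the other side the sign of the basis
  -- function and the flux of `v` both change, so it is correct there too.
  refine ⟨fun σ => M.faceSign K (κ₀ σ) σ * flux (κ₀ σ) σ (v (κ₀ σ)), fun κ hκ => ?_⟩
  refine (hc.isSimplex κ hκ).rt_ext fun σ hσ => ?_
  rw [Pi.add_apply, flux_add, M.flux_combo hK hd _ hκ hσ, M.flux_combo hK hd _ hκ hσ]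
  by_cases he : σ ∈ extFacets K
  · have hi : σ ∉ intFacets K := fun h => (mem_intFacets.1 h).2 (mem_extFacets.1 he).2
    rw [dif_pos he, dif_neg hi, add_zero, hv κ hκ ⟨σ, he⟩ hσ, faceSign, if_pos he, one_mul]
  · have hi : σ ∈ intFacets K := mem_intFacets.2
      ⟨⟨κ, hκ, hσ⟩, fun h => he (mem_extFacets.2 ⟨⟨κ, hκ, hσ⟩, h⟩)⟩
    rw [dif_neg he, dif_pos hi, zero_add]
    have hs := M.faceSign_mul_self hK hd (hκ₀ ⟨σ, hi⟩) (hσ₀ ⟨σ, hi⟩)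
    by_cases hne : κ₀ ⟨σ, hi⟩ = κ
    · rw [hne] at hs ⊢
      rw [← mul_assoc, hs, one_mul]
    · have h1 := hj σ hi
      rw [hc.jump_eq_add (hκ₀ ⟨σ, hi⟩) hκ (hσ₀ ⟨σ, hi⟩) hσ hne] at h1
      rw [M.faceSign_neg hK hd (hκ₀ ⟨σ, hi⟩) hκ hne (hσ₀ ⟨σ, hi⟩) hσ, ← mul_assoc, neg_mul, hs]
      linarith

lemma jump_combo (c : extFacets K → ℝ) (x : intFacets K → ℝ) {σ : Spx d} (hσ : σ ∈ intFacets K) :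
    jump K (M.combo K (extFacets K) c + M.combo K (intFacets K) x) σ = 0 := by
  have hc := M.conforming_cell hd hK
  obtain ⟨⟨κ, hκ, hσκ⟩, hf⟩ := mem_intFacets.1 hσ
  obtain ⟨κ', hκ', hne, hσκ'⟩ := hc.exists_ne_of_not_subset_frontier hκ hσκ hf
  have he : σ ∉ extFacets K := fun h => hf (mem_extFacets.1 h).2
  rw [hc.jump_eq_add hκ hκ' hσκ hσκ' hne.symm, Pi.add_apply, Pi.add_apply, flux_add, flux_add,
    M.flux_combo hK hd _ hκ hσκ, M.flux_combo hK hd _ hκ hσκ, M.flux_combo hK hd _ hκ' hσκ',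
    M.flux_combo hK hd _ hκ' hσκ', dif_neg he, dif_neg he, dif_pos hσ, dif_pos hσ,
    M.faceSign_neg hK hd hκ hκ' hne.symm hσκ hσκ']
  ring

lemma flux_combo_ext (c : extFacets K → ℝ) (x : intFacets K → ℝ) {κ : Spx d} (hκ : κ ∈ K)
    (σ : extFacets K) (hσκ : (σ : Spx d) ∈ facets κ) :
    flux κ σ ((M.combo K (extFacets K) c + M.combo K (intFacets K) x) κ) = c σ := by
  have hi : (σ : Spx d) ∉ intFacets K :=
    fun h => (mem_intFacets.1 h).2 (mem_extFacets.1 σ.2).2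
  rw [Pi.add_apply, flux_add, M.flux_combo hK hd _ hκ hσκ, M.flux_combo hK hd _ hκ hσκ,
    dif_pos σ.2, dif_neg hi, add_zero, faceSign, if_pos σ.2, one_mul]

lemma jump_ext {v : Spx d → RT d} {c : extFacets K → ℝ}
    (hv : ∀ κ ∈ K, ∀ σ : extFacets K, (σ : Spx d) ∈ facets κ → flux κ σ (v κ) = c σ)
    (σ : extFacets K) : jump K v σ = c σ := by
  obtain ⟨⟨κ, hκ, hσκ⟩, -⟩ := mem_extFacets.1 σ.2
  rw [jump, Finset.sum_eq_single_of_mem κ (Finset.mem_filter.2 ⟨hκ, hσκ⟩)]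
  · exact hv κ hκ σ hσκ
  · intro κ' hκ' hne
    rw [Finset.mem_filter] at hκ'
    exact absurd (M.eq_of_mem_extFacets hK σ.2 hd hκ'.1 hκ hκ'.2 hσκ) hne

lemma sum_sum_flux_cell {v : Spx d → RT d} {c : extFacets K → ℝ}
    (hj : ∀ σ ∈ intFacets K, jump K v σ = 0)
    (hv : ∀ κ ∈ K, ∀ σ : extFacets K, (σ : Spx d) ∈ facets κ → flux κ σ (v κ) = c σ)
    (t : Spx d → ℝ) :
    ∑ κ ∈ K, ∑ σ ∈ facets κ, flux κ σ (v κ) * t σ = ∑ σ : extFacets K, c σ * t σ := by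
  rw [sum_sum_flux, Finset.sum_eq_zero (s := intFacets K) fun σ hσ => by rw [hj σ hσ, zero_mul],
    add_zero, ← Finset.sum_coe_sort]
  exact Finset.sum_congr rfl fun σ _ => by rw [M.jump_ext hK hd hv]

/-- The divergence theorem on the polytope: in the sum over simplices the interior fluxes cancel. -/
lemma sum_vol_rtDiv {v : Spx d → RT d} {c : extFacets K → ℝ}
    (hj : ∀ σ ∈ intFacets K, jump K v σ = 0)
    (hv : ∀ κ ∈ K, ∀ σ : extFacets K, (σ : Spx d) ∈ facets κ → flux κ σ (v κ) = c σ) :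
    ∑ κ ∈ K, vol κ * rtDiv (v κ) = ∑ σ, c σ := by
  have h1 := M.sum_sum_flux_cell hK hd hj hv fun _ => 1
  simp only [mul_one] at h1
  rw [← h1]
  exact Finset.sum_congr rfl fun κ hκ =>
    (((M.conforming_cell hd hK).isSimplex κ hκ).sum_flux _).symm

lemma vol_mul_rtDiv_rtBasis {κ σ : Spx d} (hκ : κ ∈ K) :
    vol κ * rtDiv (M.rtBasis K σ κ) = if σ ∈ facets κ then M.faceSign K κ σ else 0 := by
  have h := (M.conforming_cell hd hK).isSimplex κ hκ
  have hv := h.vol_pos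
  rw [rtBasis_eq]
  split_ifs
  · have h1 := h.rtDiv_rtUnit σ
    simp only [rtDiv, Prod.smul_snd, smul_eq_mul] at h1 ⊢
    rw [mul_left_comm (d : ℝ), h1]
    field_simp
  · simp [rtDiv]

end Cell

end PolytopalMesh

/-! ### The local mixed finite element problem -/

section MeanZero

variable {K : Coll d} {n : ℕ} (q : Module.Basis (Fin n) ℝ (Q0 K))

lemma mem_Q0 {z : K → ℝ} : z ∈ Q0 K ↔ ∑ κ : K, vol (κ : Spx d) * z κ = 0 := by
  simp [Q0, LinearMap.sum_apply]

/-- A piecewise constant orthogonal to `Q0` is constant. -/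
lemma eq_of_orthogonal_Q0 (hK : ∀ κ ∈ K, 0 < vol κ) {w : K → ℝ}
    (hw : ∀ i, ∑ κ : K, vol (κ : Spx d) * w κ * (q i : K → ℝ) κ = 0) (κ : K) :
    (∑ κ : K, vol (κ : Spx d)) * w κ = ∑ κ : K, vol (κ : Spx d) * w κ := by
  set m : ℝ := (∑ κ : K, vol (κ : Spx d) * w κ) / ∑ κ : K, vol (κ : Spx d) with hm
  have hpos : 0 < ∑ κ : K, vol (κ : Spx d) :=
    Finset.sum_pos (fun κ _ => hK κ κ.2) ⟨κ, Finset.mem_univ _⟩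
  -- The function minus its mean is an admissible test function; tested against it, `w` has a
  -- vanishing variance.
  have hmem : (fun κ => w κ - m) ∈ Q0 K := by
    rw [mem_Q0]
    simp only [mul_sub, Finset.sum_sub_distrib, ← Finset.sum_mul]
    rw [hm, mul_div_cancel₀ _ hpos.ne', sub_self]
  have horth : ∀ z : Q0 K, ∑ κ : K, vol (κ : Spx d) * w κ * (z : K → ℝ) κ = 0 := fun z => by
    rw [← q.sum_repr z]
    simp only [Submodule.coe_sum, Submodule.coe_smul, Finset.sum_apply, Pi.smul_apply, smul_eq_mul,
      Finset.mul_sum]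
    rw [Finset.sum_comm]
    refine Finset.sum_eq_zero fun i _ => ?_
    rw [← mul_zero (q.repr z i), ← hw i, Finset.mul_sum]
    exact Finset.sum_congr rfl fun κ _ => by ring
  have hz := horth ⟨_, hmem⟩
  have h0 : ∑ κ : K, vol (κ : Spx d) * (w κ - m) ^ 2 = 0 := by
    rw [mem_Q0] at hmem
    calc _ = ∑ κ : K, vol (κ : Spx d) * w κ * (w κ - m) -
          m * ∑ κ : K, vol (κ : Spx d) * (w κ - m) := by
            rw [Finset.mul_sum, ← Finset.sum_sub_distrib]
            exact Finset.sum_congr rfl fun κ _ => by ring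
      _ = 0 := by rw [hz, hmem, mul_zero, sub_zero]
  have h1 := (Finset.sum_eq_zero_iff_of_nonneg fun (κ : K) _ =>
    mul_nonneg (hK κ κ.2).le (sq_nonneg _)).1 h0 κ (Finset.mem_univ _)
  have h2 := pow_eq_zero_iff (two_ne_zero) |>.1 ((mul_eq_zero.1 h1).resolve_left (hK κ κ.2).ne')
  rw [sub_eq_zero.1 h2, hm, mul_div_cancel₀ _ hpos.ne']

end MeanZero

namespace PolytopalMesh

open Matrix

variable {Ω : Set (Pt d)} (M : PolytopalMesh d Ω)

section Cell

variable {K : Coll d} (hK : K ∈ M.cells) (hd : 1 ≤ d)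

include hK hd

lemma matA_apply (A : Matrix (Fin d) (Fin d) ℝ) (S S' : Finset (Spx d)) (σ : S) (τ : S') :
    M.matA A K S S' σ τ = cellForm (toEuclideanLin A⁻¹) K (M.rtBasis K τ) (M.rtBasis K σ) :=
  (M.conforming_cell hd hK).integral_region_rtField _ _ _

lemma dotProduct_matA_mulVec (A : Matrix (Fin d) (Fin d) ℝ) (S S' : Finset (Spx d)) (c : S → ℝ)
    (c' : S' → ℝ) : c ⬝ᵥ M.matA A K S S' *ᵥ c' =
      cellForm (toEuclideanLin A⁻¹) K (M.combo K S' c') (M.combo K S c) := by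
  simp only [combo, map_sum, map_smul, LinearMap.sum_apply, LinearMap.smul_apply, dotProduct,
    mulVec, M.matA_apply hK hd, smul_eq_mul]
  refine Finset.sum_congr rfl fun σ _ => ?_
  congr 1
  exact Finset.sum_congr rfl fun τ _ => mul_comm _ _

lemma energy_combo {A : Matrix (Fin d) (Fin d) ℝ} (hA : A.PosDef) (c : extFacets K → ℝ)
    (x : intFacets K → ℝ) :
    cellForm (toEuclideanLin A⁻¹) K (M.combo K (extFacets K) c + M.combo K (intFacets K) x)
      (M.combo K (extFacets K) c + M.combo K (intFacets K) x) =
    c ⬝ᵥ M.matA A K (extFacets K) (extFacets K) *ᵥ c +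
      2 * (x ⬝ᵥ M.matA A K (intFacets K) (extFacets K) *ᵥ c) +
      x ⬝ᵥ M.matA A K (intFacets K) (intFacets K) *ᵥ x := by
  simp only [M.dotProduct_matA_mulVec hK hd, map_add, LinearMap.add_apply]
  rw [cellForm_comm (isSymmetric_toEuclideanLin_of_posDef hA.inv) K (M.combo K (intFacets K) x)]
  ring

lemma matA_transpose {A : Matrix (Fin d) (Fin d) ℝ} (hA : A.PosDef) :
    (M.matA A K (intFacets K) (intFacets K))ᵀ = M.matA A K (intFacets K) (intFacets K) := by
  ext σ τ
  rw [transpose_apply, M.matA_apply hK hd, M.matA_apply hK hd,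
    cellForm_comm (isSymmetric_toEuclideanLin_of_posDef hA.inv)]

lemma combo_eq_zero {x : intFacets K → ℝ} (hx : ∀ κ ∈ K, M.combo K (intFacets K) x κ = 0) :
    x = 0 := by
  ext σ
  obtain ⟨⟨κ, hκ, hσκ⟩, -⟩ := mem_intFacets.1 σ.2
  have h1 := M.flux_combo hK hd x hκ hσκ
  rw [hx κ hκ, flux_zero, dif_pos σ.2] at h1
  have h2 := M.faceSign_mul_self hK hd hκ hσκ
  have h3 : M.faceSign K κ σ ≠ 0 := fun h => by rw [h] at h2; norm_num at h2
  exact (mul_eq_zero.1 h1.symm).resolve_left h3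

lemma matA_posDef {A : Matrix (Fin d) (Fin d) ℝ} (hA : A.PosDef) (x : intFacets K → ℝ)
    (hx : x ⬝ᵥ M.matA A K (intFacets K) (intFacets K) *ᵥ x ≤ 0) : x = 0 := by
  rw [M.dotProduct_matA_mulVec hK hd] at hx
  exact M.combo_eq_zero hK hd fun κ hκ => (M.conforming_cell hd hK).eq_zero_of_cellForm_le
    (fun _ => inner_toEuclideanLin_pos hA.inv) hx hκ

omit hK hd in
lemma matB_mulVec {n : ℕ} (q : Module.Basis (Fin n) ℝ (Q0 K)) (S : Finset (Spx d)) (c : S → ℝ)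
    (i : Fin n) : (M.matB K q S *ᵥ c) i =
      -∑ κ : K, vol (κ : Spx d) * rtDiv (M.combo K S c κ) * (q i : K → ℝ) κ := by
  have hdiv : ∀ κ, rtDiv (M.combo K S c κ) = ∑ σ, c σ * rtDiv (M.rtBasis K σ κ) := fun κ => by
    simp only [combo, rtDiv, Finset.sum_apply, Pi.smul_apply, Prod.snd_sum, Prod.smul_snd,
      smul_eq_mul, Finset.mul_sum]
    exact Finset.sum_congr rfl fun σ _ => by ring
  simp only [matB, mulVec, dotProduct, of_apply, hdiv, neg_mul, Finset.sum_neg_distrib,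
    Finset.mul_sum, Finset.sum_mul]
  rw [Finset.sum_comm]
  congr 1
  exact Finset.sum_congr rfl fun κ _ => Finset.sum_congr rfl fun σ _ => by ring

/-- An interior basis function has divergence integrals of opposite sign on its two simplices, so
the piecewise constant `z` takes equal values there. Connectedness through interior facets makes `z`
constant, and its zero mean makes it zero. -/
lemma matB_transpose_injective {n : ℕ} (q : Module.Basis (Fin n) ℝ (Q0 K)) (y : Fin n → ℝ)
    (hy : (M.matB K q (intFacets K))ᵀ *ᵥ y = 0) : y = 0 := by
  have hc := M.conforming_cell hd hK
  set z : Q0 K := ∑ i, y i • q i with hz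
  have hzσ : ∀ σ : intFacets K,
      ∑ κ : K, vol (κ : Spx d) * rtDiv (M.rtBasis K σ κ) * (z : K → ℝ) κ = 0 := fun σ => by
    have h1 := congrFun hy σ
    simp only [mulVec, dotProduct, transpose_apply, matB, of_apply, neg_mul, Pi.zero_apply,
      Finset.sum_neg_distrib, neg_eq_zero, Finset.sum_mul] at h1
    rw [← h1, hz]
    simp only [Submodule.coe_sum, Submodule.coe_smul, Finset.sum_apply, Pi.smul_apply, smul_eq_mul,
      Finset.mul_sum]
    rw [Finset.sum_comm]
    exact Finset.sum_congr rfl fun i _ => Finset.sum_congr rfl fun κ _ => by ring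
  have hadj : ∀ κ κ' : K, ∀ σ ∈ intFacets K, σ ∈ facets (κ : Spx d) → σ ∈ facets (κ' : Spx d) →
      (z : K → ℝ) κ = (z : K → ℝ) κ' := fun κ κ' σ hσ hσκ hσκ' => by
    by_cases hne : κ = κ'
    · rw [hne]
    have hne' : (κ : Spx d) ≠ κ' := fun h => hne (Subtype.ext h)
    have h1 := hzσ ⟨σ, hσ⟩
    rw [Fintype.sum_eq_add κ κ' hne] at h1
    · rw [M.vol_mul_rtDiv_rtBasis hK hd κ.2, M.vol_mul_rtDiv_rtBasis hK hd κ'.2, if_pos hσκ,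
        if_pos hσκ', M.faceSign_neg hK hd κ.2 κ'.2 hne' hσκ hσκ'] at h1
      have h2 := M.faceSign_mul_self hK hd κ.2 hσκ
      have h3 : M.faceSign K κ σ * ((z : K → ℝ) κ - (z : K → ℝ) κ') = 0 := by linarith
      have h4 : M.faceSign K κ σ ≠ 0 := fun h => by rw [h] at h2; norm_num at h2
      exact sub_eq_zero.1 ((mul_eq_zero.1 h3).resolve_left h4)
    · rintro τ ⟨h2, h3⟩
      rw [M.vol_mul_rtDiv_rtBasis hK hd τ.2, if_neg, zero_mul]
      intro hστ
      rcases hc.eq_or_eq_of_common_facet κ.2 κ'.2 τ.2 hσκ hσκ' hστ hne' with h | h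
      · exact h2 (Subtype.ext h)
      · exact h3 (Subtype.ext h)
  obtain ⟨κ₀, hκ₀⟩ := M.cell_nonempty hK
  have hS := hc.eq_of_closed_under_adjacency (M.connected K hK).isPreconnected
    (S := K.filter fun κ => ∀ h : κ ∈ K, (z : K → ℝ) ⟨κ, h⟩ = (z : K → ℝ) ⟨κ₀, hκ₀⟩)
    (Finset.filter_subset _ _) ⟨κ₀, by simp [hκ₀]⟩ (fun κ hκ κ' hκ' σ hσ h1 h2 => by
      rw [Finset.mem_filter] at hκ ⊢
      exact ⟨hκ', fun h => by rw [← hadj ⟨κ, hκ.1⟩ ⟨κ', h⟩ σ hσ h1 h2, hκ.2 hκ.1]⟩)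
  have hconst : ∀ κ : K, (z : K → ℝ) κ = (z : K → ℝ) ⟨κ₀, hκ₀⟩ := fun κ => by
    exact Finset.filter_eq_self.1 hS κ κ.2 κ.2
  have h0 := mem_Q0.1 z.2
  simp only [hconst, ← Finset.sum_mul] at h0
  have hpos : 0 < ∑ κ : K, vol (κ : Spx d) :=
    Finset.sum_pos (fun κ _ => (hc.isSimplex κ κ.2).vol_pos) ⟨⟨κ₀, hκ₀⟩, Finset.mem_univ _⟩
  have hz0 : z = 0 := by
    ext κ
    rw [hconst κ, (mul_eq_zero.1 h0).resolve_left hpos.ne']; rfl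
  ext i
  exact Fintype.linearIndependent_iff.1 q.linearIndependent y (hz ▸ hz0) i

lemma isUnit_saddle {A : Matrix (Fin d) (Fin d) ℝ} (hA : A.PosDef) {n : ℕ}
    (q : Module.Basis (Fin n) ℝ (Q0 K)) : IsUnit (M.saddle A K q) :=
  isUnit_fromBlocks_saddle (M.matA_posDef hK hd hA) (M.matB_transpose_injective hK hd q)

/-- The matrix constraint only tests against mean-zero functions, so it says that the divergence is
constant. The value of the constant is fixed by the total exterior flux. -/
lemma matB_constraint_iff {n : ℕ} (q : Module.Basis (Fin n) ℝ (Q0 K)) {c : extFacets K → ℝ} {b : ℝ}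
    (hb : ∑ σ, c σ = b * ∑ κ ∈ K, vol κ) (x : intFacets K → ℝ) :
    M.matB K q (extFacets K) *ᵥ c + M.matB K q (intFacets K) *ᵥ x = 0 ↔
      ∀ κ ∈ K, rtDiv ((M.combo K (extFacets K) c + M.combo K (intFacets K) x) κ) = b := by
  set v := M.combo K (extFacets K) c + M.combo K (intFacets K) x with hv
  have hpos := M.sum_vol_pos hd hK
  have hval : ∀ i, (M.matB K q (extFacets K) *ᵥ c + M.matB K q (intFacets K) *ᵥ x) i =
      -∑ κ : K, vol (κ : Spx d) * rtDiv (v κ) * (q i : K → ℝ) κ := fun i => by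
    rw [Pi.add_apply, M.matB_mulVec, M.matB_mulVec, ← neg_add, ← Finset.sum_add_distrib]
    congr 1
    refine Finset.sum_congr rfl fun κ _ => ?_
    rw [hv, Pi.add_apply]
    simp only [rtDiv, Prod.snd_add]
    ring
  have hsum : ∑ κ ∈ K, vol κ * rtDiv (v κ) = b * ∑ κ ∈ K, vol κ := by
    rw [← hb]
    exact M.sum_vol_rtDiv hK hd (fun σ hσ => M.jump_combo hK hd c x hσ)
      (fun κ hκ σ hσ => M.flux_combo_ext hK hd c x hκ σ hσ)
  constructor
  · intro h κ hκ
    have h1 := eq_of_orthogonal_Q0 q (w := fun κ : K => rtDiv (v κ))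
      (fun κ hκ => ((M.conforming_cell hd hK).isSimplex κ hκ).vol_pos)
      (fun i => by have := hval i; rw [h] at this; simpa using this.symm) ⟨κ, hκ⟩
    rw [Finset.sum_coe_sort K vol, Finset.sum_coe_sort K fun κ => vol κ * rtDiv (v κ), hsum,
      mul_comm] at h1
    exact mul_right_cancel₀ hpos.ne' h1
  · intro h
    ext i
    rw [hval, Pi.zero_apply, neg_eq_zero]
    have h1 := mem_Q0.1 (q i).2
    rw [← mul_zero b, ← h1, Finset.mul_sum]
    refine Finset.sum_congr rfl fun κ _ => ?_
    rw [h κ κ.2]; ring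

/-- The local flux reconstruction problem has a solution, unique on the simplices of the element,
and its energy is given by the Schur complement. -/
lemma exists_local_minimizer {A : Matrix (Fin d) (Fin d) ℝ} (hA : A.PosDef) {n : ℕ}
    (q : Module.Basis (Fin n) ℝ (Q0 K)) {U : Coll d → ℝ} {b : ℝ}
    (hb : ∑ σ, M.extFlux U K σ = b * ∑ κ ∈ K, vol κ) :
    ∃ u, M.IsAdmissible U K b u ∧
      cellForm (toEuclideanLin A⁻¹) K u u =
        M.extFlux U K ⬝ᵥ (M.matMFE A K q).mulVec (M.extFlux U K) ∧
      ∀ v, M.IsAdmissible U K b v →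
        cellForm (toEuclideanLin A⁻¹) K u u ≤ cellForm (toEuclideanLin A⁻¹) K v v ∧
        (cellForm (toEuclideanLin A⁻¹) K v v ≤ cellForm (toEuclideanLin A⁻¹) K u u →
          ∀ κ ∈ K, v κ = u κ) := by
  obtain ⟨x, hx1, hx2, hx3⟩ := exists_saddle_solution (M.matA_transpose hK hd hA)
    (M.isUnit_saddle hK hd hA q) (M.matA A K (extFacets K) (extFacets K))
    (M.matA A K (intFacets K) (extFacets K)) (M.matB K q (extFacets K)) (M.extFlux U K)
  refine ⟨M.combo K (extFacets K) (M.extFlux U K) + M.combo K (intFacets K) x, ?_, ?_, ?_⟩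
  · rw [M.isAdmissible_iff hd hK]
    exact ⟨(M.matB_constraint_iff hK hd q hb x).1 hx1, fun σ hσ => M.jump_combo hK hd _ x hσ,
      fun κ hκ σ hσ => M.flux_combo_ext hK hd _ x hκ σ hσ⟩
  · rw [M.energy_combo hK hd hA, hx2]
    rfl
  · intro v hv
    rw [M.isAdmissible_iff hd hK] at hv
    obtain ⟨y, hy⟩ := M.exists_eq_combo hK hd hv.2.1 hv.2.2
    have hvy : cellForm (toEuclideanLin A⁻¹) K v v =
        cellForm (toEuclideanLin A⁻¹) K
          (M.combo K (extFacets K) (M.extFlux U K) + M.combo K (intFacets K) y)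
          (M.combo K (extFacets K) (M.extFlux U K) + M.combo K (intFacets K) y) := by
      simp only [cellForm_apply]
      exact Finset.sum_congr rfl fun κ hκ => by rw [hy κ hκ]
    -- The excess energy of a competitor is exactly the quadratic form of `y - x`; its definiteness
    -- yields both minimality and uniqueness.
    have hy1 := hx3 y ((M.matB_constraint_iff hK hd q hb y).2 fun κ hκ => by
      rw [← hy κ hκ]; exact hv.1 κ hκ)
    have hnn : 0 ≤ (y - x) ⬝ᵥ M.matA A K (intFacets K) (intFacets K) *ᵥ (y - x) := by
      by_contra! h
      rw [M.matA_posDef hK hd hA _ h.le, zero_dotProduct] at h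
      exact lt_irrefl _ h
    rw [hvy, M.energy_combo hK hd hA, M.energy_combo hK hd hA, hy1]
    refine ⟨by linarith, fun h κ hκ => ?_⟩
    have h0 : y - x = 0 := M.matA_posDef hK hd hA _ (by linarith)
    rw [hy κ hκ, sub_eq_zero.1 h0]

end Cell

end PolytopalMesh

/-! ### The flux reconstruction -/

lemma jump_congr {K : Coll d} {v w : Spx d → RT d} (h : ∀ κ ∈ K, v κ = w κ) (σ : Spx d) :
    jump K v σ = jump K w σ :=
  Finset.sum_congr rfl fun κ hκ => by rw [h κ (Finset.mem_filter.1 hκ).1]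

namespace PolytopalMesh

open Matrix

variable {Ω : Set (Pt d)} (M : PolytopalMesh d Ω)

lemma IsAdmissible.congr (hd : 1 ≤ d) {K : Coll d} (hK : K ∈ M.cells) {U : Coll d → ℝ} {c : ℝ}
    {v w : Spx d → RT d} (hv : M.IsAdmissible U K c v) (h : ∀ κ ∈ K, v κ = w κ) :
    M.IsAdmissible U K c w := by
  rw [M.isAdmissible_iff hd hK] at hv ⊢
  exact ⟨fun κ hκ => by rw [← h κ hκ]; exact hv.1 κ hκ,
    fun σ hσ => by rw [← jump_congr h]; exact hv.2.1 σ hσ,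
    fun κ hκ σ hσ => by rw [← h κ hκ]; exact hv.2.2 κ hκ σ hσ⟩

lemma cellForm_congr (T : Pt d →ₗ[ℝ] Pt d) {K : Coll d} {v w : Spx d → RT d}
    (h : ∀ κ ∈ K, v κ = w κ) : cellForm T K v v = cellForm T K w w := by
  simp only [cellForm_apply]
  exact Finset.sum_congr rfl fun κ hκ => by rw [h κ hκ]

lemma exists_reconstruction (hd : 1 ≤ d) {D : Coll d → Matrix (Fin d) (Fin d) ℝ}
    (hD : ∀ K ∈ M.cells, (D K).PosDef) {f U : Coll d → ℝ} (hU : M.FluxBalance f U)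
    {n : Coll d → ℕ} (q : ∀ K : Coll d, Module.Basis (Fin (n K)) ℝ (Q0 K)) :
    ∃ uh : Spx d → RT d, ∀ K ∈ M.cells, M.IsAdmissible U K (f K) uh ∧
      cellForm (toEuclideanLin (D K)⁻¹) K uh uh =
        M.extFlux U K ⬝ᵥ (M.matMFE (D K) K (q K)).mulVec (M.extFlux U K) ∧
      ∀ v, M.IsAdmissible U K (f K) v →
        cellForm (toEuclideanLin (D K)⁻¹) K uh uh ≤ cellForm (toEuclideanLin (D K)⁻¹) K v v ∧
        (cellForm (toEuclideanLin (D K)⁻¹) K v v ≤ cellForm (toEuclideanLin (D K)⁻¹) K uh uh →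
          ∀ κ ∈ K, v κ = uh κ) := by
  choose! u hu using fun (K : Coll d) (hK : K ∈ M.cells) =>
    M.exists_local_minimizer hK hd (hD K hK) (q K)
      ((M.sum_extFlux hd hK hU).trans (M.load_eq hd hK f))
  -- Each simplex belongs to one element, so the local minimizers assemble without any compatibility
  -- condition.
  refine ⟨fun κ => u (M.TH.part κ) κ, fun K hK => ?_⟩
  have h : ∀ κ ∈ K, u K κ = u (M.TH.part κ) κ := fun κ hκ => by rw [M.TH.part_eq_of_mem hK hκ]
  obtain ⟨h1, h2, h3⟩ := hu K hK
  rw [← cellForm_congr _ h]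
  exact ⟨h1.congr M hd hK h, h2, fun v hv => ⟨(h3 v hv).1, fun hle κ hκ =>
    ((h3 v hv).2 hle κ hκ).trans (h κ hκ)⟩⟩

/-- Were the facet interior to `K`, a second simplex of `K` would share it, giving three simplices
on one facet. -/
lemma mem_extFacets_of_ne (hd : 1 ≤ d) {K K' : Coll d} (hK : K ∈ M.cells) (hK' : K' ∈ M.cells)
    (hne : K ≠ K') {κ κ' σ : Spx d} (hκ : κ ∈ K) (hκ' : κ' ∈ K') (hσ : σ ∈ facets κ)
    (hσ' : σ ∈ facets κ') : σ ∈ extFacets K := by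
  by_contra he
  have hf : ¬ hull σ ⊆ frontier (region K) := fun h => he (mem_extFacets.2 ⟨⟨κ, hκ, hσ⟩, h⟩)
  obtain ⟨κ₁, hκ₁, hne₁, hσ₁⟩ :=
    (M.conforming_cell hd hK).exists_ne_of_not_subset_frontier hκ hσ hf
  have hκκ' : κ ≠ κ' := fun h => hne (M.cell_unique hK hK' hκ (h ▸ hκ'))
  rcases (M.conforming hd).eq_or_eq_of_common_facet (M.cell_subset hK hκ) (M.cell_subset hK' hκ')
    (M.cell_subset hK hκ₁) hσ hσ' hσ₁ hκκ' with h | h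
  · exact hne₁ h
  · exact hne (M.cell_unique hK hK' (h ▸ hκ₁) hκ')

/-- Jumps inside an element vanish by admissibility. Between elements both sides carry the same
`subFlux`, with opposite outward normals. -/
lemma hasWeakDiv_of_isAdmissible (hd : 1 ≤ d) (hΩ : interior (closure Ω) = Ω) {f U : Coll d → ℝ}
    {u : Spx d → RT d} (hu : ∀ K ∈ M.cells, M.IsAdmissible U K (f K) u) :
    HasWeakDiv Ω (rtField M.Th u) (M.pwc f) := by
  have hc := M.conforming hd
  have key : HasWeakDiv (interior (region M.Th)) (rtField M.Th u) (M.pwc f) := by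
    refine hc.hasWeakDiv_of_jump_eq_zero (fun κ hκ x hx => ?_) fun σ hσ => ?_
    · obtain ⟨K, hK, hκK⟩ := M.exists_cell hκ
      rw [M.pwc_apply hd f hK hκK hx, ((M.isAdmissible_iff hd hK).1 (hu K hK)).1 κ hκK]
    · obtain ⟨⟨κ, hκ, hσκ⟩, hf⟩ := mem_intFacets.1 hσ
      obtain ⟨κ', hκ', hne, hσκ'⟩ := hc.exists_ne_of_not_subset_frontier hκ hσκ hf
      obtain ⟨K, hK, hκK⟩ := M.exists_cell hκ
      obtain ⟨K', hK', hκK'⟩ := M.exists_cell hκ'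
      obtain ⟨-, hj, hv⟩ := (M.isAdmissible_iff hd hK).1 (hu K hK)
      obtain ⟨-, -, hv'⟩ := (M.isAdmissible_iff hd hK').1 (hu K' hK')
      rw [hc.jump_eq_add hκ hκ' hσκ hσκ' hne.symm]
      by_cases hKK : K = K'
      · subst hKK
        have he : σ ∉ extFacets K := fun h =>
          hne (M.eq_of_mem_extFacets hK h hd hκK' hκK hσκ' hσκ)
        rw [← (M.conforming_cell hd hK).jump_eq_add hκK hκK' hσκ hσκ' hne.symm]
        exact hj σ (mem_intFacets.2 ⟨⟨κ, hκK, hσκ⟩,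
          fun h => he (mem_extFacets.2 ⟨⟨κ, hκK, hσκ⟩, h⟩)⟩)
      · have he := M.mem_extFacets_of_ne hd hK hK' hKK hκK hκK' hσκ hσκ'
        have he' := M.mem_extFacets_of_ne hd hK' hK (Ne.symm hKK) hκK' hκK hσκ' hσκ
        rw [hv κ hκK ⟨σ, he⟩ hσκ, hv' κ' hκK' ⟨σ, he'⟩ hσκ', extFlux, extFlux,
          M.cellNormal_part hK he hκK hσκ, M.cellNormal_part hK' he' hκK' hσκ',
          hc.outNormal_eq_neg hκ hκ' hne.symm hσκ hσκ', inner_neg_left]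
        ring
  rwa [M.interior_region_Th hΩ] at key

end PolytopalMesh

/-! ### Continuous piecewise affine functions -/

/-- The affine function on `κ` with the vertex values `Z`. -/
def affineInterp (Z : Pt d → ℝ) (κ : Spx d) (x : Pt d) : ℝ := ∑ a ∈ κ, Z a * hat κ a x

/-- The gradient of `affineInterp Z κ`. -/
def interpGrad (Z : Pt d → ℝ) (κ : Spx d) : Pt d := ∑ a ∈ κ, Z a • hatGrad κ a

lemma contDiff_affineInterp (Z : Pt d → ℝ) (κ : Spx d) : ContDiff ℝ ∞ (affineInterp Z κ) := by
  unfold affineInterp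
  exact ContDiff.sum fun a _ => contDiff_const.mul (contDiff_hat κ a)

lemma fderiv_affineInterp (Z : Pt d → ℝ) (κ : Spx d) (x v : Pt d) :
    fderiv ℝ (affineInterp Z κ) x v = inner ℝ (interpGrad Z κ) v :=
  IsSimplex.fderiv_sum_hat κ Z x v

lemma gradient_affineInterp (Z : Pt d → ℝ) (κ : Spx d) (x : Pt d) :
    gradient (affineInterp Z κ) x = interpGrad Z κ :=
  ext_inner_right ℝ fun v => by rw [inner_gradient_left, fderiv_affineInterp]

lemma affineInterp_sub (Z : Pt d → ℝ) (κ : Spx d) (x y : Pt d) :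
    affineInterp Z κ x - affineInterp Z κ y = inner ℝ (interpGrad Z κ) (x - y) := by
  rw [affineInterp, affineInterp, interpGrad, sum_inner, ← Finset.sum_sub_distrib]
  exact Finset.sum_congr rfl fun a _ => by rw [real_inner_smul_left, ← hat_sub_hat]; ring

lemma volume_affineInterp_eq_zero {Z : Pt d → ℝ} {κ : Spx d} (h : interpGrad Z κ ≠ 0) :
    volume {x | affineInterp Z κ x = 0} = 0 := by
  rcases Set.eq_empty_or_nonempty {x | affineInterp Z κ x = 0} with he | ⟨y, hy⟩
  · rw [he, measure_empty]
  rw [Set.mem_ofPred_eq] at hy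
  refine measure_mono_null (t := (AffineSubspace.mk' y (ℝ ∙ interpGrad Z κ)ᗮ : Set (Pt d)))
    (fun x hx => ?_) (Measure.addHaar_affineSubspace _ _ fun htop => ?_)
  · rw [Set.mem_ofPred_eq] at hx
    rw [SetLike.mem_coe, AffineSubspace.mem_mk', vsub_eq_sub,
      Submodule.mem_orthogonal_singleton_iff_inner_right, ← affineInterp_sub, hx, hy, sub_zero]
  · have h1 : y + interpGrad Z κ ∈ AffineSubspace.mk' y (ℝ ∙ interpGrad Z κ)ᗮ := by
      rw [htop]; trivial
    rw [AffineSubspace.mem_mk', vsub_eq_sub, add_sub_cancel_left,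
      Submodule.mem_orthogonal_singleton_iff_inner_right, inner_self_eq_zero] at h1
    exact h h1

/-- Either the gradient is zero, or the zero set lies in a hyperplane and is null. -/
lemma ae_fderiv_affineInterp_eq_zero (Z : Pt d → ℝ) (κ : Spx d) :
    ∀ᵐ x, x ∈ interior (hull κ) → affineInterp Z κ x = 0 → fderiv ℝ (affineInterp Z κ) x = 0 := by
  by_cases h : interpGrad Z κ = 0
  · refine Eventually.of_forall fun x _ _ => ?_
    ext v
    rw [fderiv_affineInterp, h, inner_zero_left]; rfl
  · filter_upwards [measure_eq_zero_iff_ae_notMem.1 (volume_affineInterp_eq_zero h)] with x hx _ h0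
    exact absurd h0 hx

lemma Conforming.isFitting_affineInterp {K : Coll d} (hK : Conforming K) {Z : Pt d → ℝ}
    (hZ : ∀ a ∈ frontier (region K), Z a = 0) : IsFitting K (affineInterp Z) where
  contDiff κ _ := contDiff_affineInterp Z κ
  agree κ hκ κ' hκ' x hx hx' := by
    have key : ∀ κ₁ ∈ K, ∀ κ₂ ∈ K, x ∈ hull κ₁ → x ∈ hull κ₂ →
        affineInterp Z κ₁ x = ∑ a ∈ κ₁ ∩ κ₂, Z a * hat κ₁ a x := fun κ₁ h₁ κ₂ h₂ hx₁ hx₂ => by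
      refine (Finset.sum_subset Finset.inter_subset_left fun a ha ha' => ?_).symm
      have hnn := (hK.isSimplex κ₁ h₁).hat_nonneg hx₁ ha
      rcases hnn.eq_or_lt with h | h
      · rw [← h, mul_zero]
      · exact absurd (Finset.mem_inter.2 ⟨ha, hK.mem_of_hat_pos h₁ h₂ hx₁ hx₂ ha h⟩) ha'
    rw [key κ hκ κ' hκ' hx hx', key κ' hκ' κ hκ hx' hx, Finset.inter_comm κ' κ]
    refine Finset.sum_congr rfl fun a ha => ?_
    rw [Finset.mem_inter] at ha
    rw [hK.hat_eq_hat hκ hκ' hx hx' ha.1 ha.2]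
  eq_zero κ hκ x hx hxf := by
    have h := hK.isSimplex κ hκ
    refine Finset.sum_eq_zero fun a ha => ?_
    rcases (h.hat_nonneg hx ha).eq_or_lt with h0 | h0
    · rw [← h0, mul_zero]
    rw [hZ a, zero_mul]
    rw [(isClosed_region K).frontier_eq] at hxf ⊢
    have haκ : a ∈ hull κ := subset_convexHull ℝ _ ha
    refine ⟨hull_subset_region hκ haκ, fun hai => hxf.2 ?_⟩
    -- The vertex `a` belongs to the face carrying `x`; if `a` were interior to the region, `x`
    -- would be too. Thus every vertex with positive weight is on the boundary, where `Z` is zero.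
    have hsub : κ.filter (fun b => 0 < hat κ b x) ⊆ κ := Finset.filter_subset _ _
    refine hK.mem_interior_region_of_face hκ hsub ((h.mem_hull_of_subset hsub).2
      ⟨hx, fun b hb hb' => ?_⟩) (fun b hb => (Finset.mem_filter.1 hb).2)
      (subset_convexHull ℝ _ (Finset.mem_coe.2 (Finset.mem_filter.2 ⟨ha, h0⟩))) hai
    have h1 := h.hat_nonneg hx hb
    by_contra hne
    exact hb' (Finset.mem_filter.2 ⟨hb, lt_of_le_of_ne h1 (Ne.symm hne)⟩)

lemma PolytopalMesh.memH10_glue_pointValue {Ω : Set (Pt d)} (M : PolytopalMesh d Ω) (hd : 1 ≤ d)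
    (hΩ : interior (closure Ω) = Ω) (P : Coll d → ℝ) :
    IsFitting M.Th (affineInterp (M.pointValue P)) ∧
      MemH10 Ω (glue M.Th (affineInterp (M.pointValue P)))
        (gradient (glue M.Th (affineInterp (M.pointValue P)))) := by
  have hfr : frontier (region M.Th) = frontier Ω := by
    rw [M.isMesh.cover, frontier, frontier, closure_closure, hΩ,
      (hΩ ▸ isOpen_interior : IsOpen Ω).interior_eq]
  have hg := (M.conforming hd).isFitting_affineInterp (Z := M.pointValue P)
    fun a ha => by rw [PolytopalMesh.pointValue, if_pos (hfr ▸ ha)]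
  have h1 := hg.memH10_glue fun κ _ => ae_fderiv_affineInterp_eq_zero _ κ
  rw [M.interior_region_Th hΩ] at h1
  exact ⟨hg, h1⟩

/-! ### The element estimator as a sum of integrals -/

lemma sum_vertices {V : Type*} [AddCommMonoid V] {K : Coll d} {κ : Spx d} (hκ : κ ∈ K)
    (F : Pt d → V) : ∑ a : vertices K, (if (a : Pt d) ∈ κ then F a else 0) = ∑ a ∈ κ, F a := by
  rw [Finset.sum_coe_sort (vertices K) fun a => if a ∈ κ then F a else 0, ← Finset.sum_filter]
  refine Finset.sum_congr ?_ fun _ _ => rfl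
  ext a
  rw [Finset.mem_filter, and_iff_right_iff_imp]
  exact fun ha => Finset.mem_biUnion.2 ⟨κ, hκ, ha⟩

namespace Conforming

open Matrix

variable {K : Coll d} (hK : Conforming K)

include hK

lemma dotProduct_matStiff_mulVec (A : Matrix (Fin d) (Fin d) ℝ) (Z : Pt d → ℝ) :
    (fun a : vertices K => Z a) ⬝ᵥ matStiff A K *ᵥ (fun a => Z a) =
      ∑ κ ∈ K, vol κ * inner ℝ (toEuclideanLin A (interpGrad Z κ)) (interpGrad Z κ) := by
  set G : Spx d → Pt d → Pt d := fun κ a => if a ∈ κ then hatGrad κ a else 0 with hG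
  have hentry : ∀ a b : vertices K, matStiff A K a b =
      ∑ κ ∈ K, vol κ * inner ℝ (toEuclideanLin A (G κ b)) (G κ a) := fun a b => by
    rw [matStiff, of_apply, hK.setIntegral_region
      (G := fun κ _ => inner ℝ (toEuclideanLin A (G κ b)) (G κ a))
      (fun κ _ => Continuous.integrableOn_hull continuous_const κ) fun κ hκ x hx => by
        rw [psiGrad, psiGrad, hK.pw_apply hκ _ hx, hK.pw_apply hκ _ hx]]
    exact Finset.sum_congr rfl fun κ _ => by rw [setIntegral_const, smul_eq_mul, vol]
  have hsum : ∀ κ ∈ K, interpGrad Z κ = ∑ a : vertices K, Z a • G κ a := fun κ hκ => by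
    simp only [hG, smul_ite, smul_zero]
    exact (sum_vertices hκ fun a => Z a • hatGrad κ a).symm
  simp only [dotProduct, mulVec, hentry, Finset.mul_sum, Finset.sum_mul]
  rw [Finset.sum_congr rfl fun a _ => Finset.sum_comm, Finset.sum_comm]
  refine Finset.sum_congr rfl fun κ hκ => ?_
  rw [hsum κ hκ]
  simp only [map_sum, map_smul, sum_inner, inner_sum, real_inner_smul_left, real_inner_smul_right,
    Finset.mul_sum]
  exact Finset.sum_congr rfl fun a _ => Finset.sum_congr rfl fun b _ => by ring

lemma dotProduct_matMass_mulVec (Z : Pt d → ℝ) :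
    (fun _ => 1) ⬝ᵥ matMass K *ᵥ (fun a : vertices K => Z a) =
      ∑ κ ∈ K, ∫ x in hull κ, affineInterp Z κ x := by
  set H : Spx d → Pt d → Pt d → ℝ := fun κ a x => if a ∈ κ then hat κ a x else 0 with hH
  have hHc : ∀ κ a, Continuous (H κ a) := fun κ a => by
    simp only [hH]
    split_ifs
    · exact continuous_hat κ a
    · exact continuous_const
  have hentry : ∀ a b : vertices K, matMass K a b =
      ∑ κ ∈ K, ∫ x in hull κ, H κ b x * H κ a x := fun a b => by
    rw [matMass, of_apply, hK.setIntegral_region (G := fun κ x => H κ b x * H κ a x)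
      (fun κ _ => Continuous.integrableOn_hull ((hHc κ b).mul (hHc κ a)) κ) fun κ hκ x hx => by
        rw [psi, psi, hK.pw_apply hκ _ hx, hK.pw_apply hκ _ hx]]
  simp only [dotProduct, mulVec, hentry, Finset.mul_sum, Finset.sum_mul, one_mul]
  rw [Finset.sum_congr rfl fun a _ => Finset.sum_comm, Finset.sum_comm]
  refine Finset.sum_congr rfl fun κ hκ => ?_
  -- The all-ones vector represents the function `1`, since the hat functions form a partition of
  -- unity.
  have h1 : ∀ x, affineInterp Z κ x =
      ∑ a : vertices K, ∑ b : vertices K, H κ b x * H κ a x * Z b := fun x => by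
    have e1 : ∑ a : vertices K, H κ a x = 1 :=
      (sum_vertices hκ fun a => hat κ a x).trans ((hK.isSimplex κ hκ).sum_hat x)
    have e2 : ∑ a : vertices K, Z a * H κ a x = affineInterp Z κ x := by
      simp only [hH, mul_ite, mul_zero]
      exact sum_vertices hκ fun a => Z a * hat κ a x
    rw [← one_mul (affineInterp Z κ x), ← e1, ← e2, Finset.sum_mul_sum]
    exact Finset.sum_congr rfl fun a _ => Finset.sum_congr rfl fun b _ => by ring
  have hint : ∀ a b : vertices K, IntegrableOn (fun x => H κ b x * H κ a x * Z b) (hull κ) :=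
    fun a b => Continuous.integrableOn_hull (((hHc κ b).mul (hHc κ a)).mul continuous_const) κ
  simp only [h1]
  rw [integral_finsetSum _ fun a _ => integrable_finsetSum _ fun b _ => hint a b]
  refine Finset.sum_congr rfl fun a _ => ?_
  rw [integral_finsetSum _ fun b _ => hint a b]
  exact Finset.sum_congr rfl fun b _ => by rw [integral_mul_const]

end Conforming

/-! ### The estimator as the energy of the residual -/

/-- The flux `v + A ∇s` on the simplex `κ`, where `s` has the vertex values `Z`. -/
def residual (A : Matrix (Fin d) (Fin d) ℝ) (Z : Pt d → ℝ) (q : RT d) (κ : Spx d) (x : Pt d) :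
    Pt d :=
  rtEval q x + Matrix.toEuclideanLin A (interpGrad Z κ)

lemma continuous_residual (A : Matrix (Fin d) (Fin d) ℝ) (Z : Pt d → ℝ) (q : RT d) (κ : Spx d) :
    Continuous (residual A Z q κ) := (continuous_rtEval q).add continuous_const

lemma continuous_inner_residual (A B : Matrix (Fin d) (Fin d) ℝ) (Z : Pt d → ℝ) (q : RT d)
    (κ : Spx d) : Continuous fun x =>
      (inner ℝ (Matrix.toEuclideanLin A (residual B Z q κ x)) (residual B Z q κ x) : ℝ) :=
  ((LinearMap.continuous_of_finiteDimensional _).comp (continuous_residual B Z q κ)).inner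
    (continuous_residual B Z q κ)

/-- In the expanded square `A⁻¹` cancels `A`, so the cross term is `2 q · ∇s`; Green's formula and
the exact face means of an affine function evaluate it. -/
lemma integral_inner_residual {A : Matrix (Fin d) (Fin d) ℝ} (hA : A.PosDef) {κ : Spx d}
    (h : IsSimplex κ) (Z : Pt d → ℝ) (q : RT d) :
    ∫ x in hull κ, inner ℝ (Matrix.toEuclideanLin A⁻¹ (residual A Z q κ x)) (residual A Z q κ x) =
      (∫ x in hull κ, inner ℝ (Matrix.toEuclideanLin A⁻¹ (rtEval q x)) (rtEval q x)) +
      vol κ * inner ℝ (Matrix.toEuclideanLin A (interpGrad Z κ)) (interpGrad Z κ) +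
      2 * ((∑ σ ∈ facets κ, flux κ σ q * ((d : ℝ)⁻¹ * ∑ a ∈ σ, Z a)) -
        rtDiv q * ∫ x in hull κ, affineInterp Z κ x) := by
  have hs := (contDiff_affineInterp Z κ).of_le (m := 1) (by norm_cast)
  have hIs := Continuous.integrableOn_hull (hs.continuous) κ
  have h1 := h.integral_rt q hs
  have h2 : ∀ σ ∈ facets κ, traceMean κ σ (affineInterp Z κ) = (d : ℝ)⁻¹ * ∑ a ∈ σ, Z a :=
    fun σ hσ => h.traceMean_sum_hat hσ Z
  have hc1 : Continuous fun x => (inner ℝ (interpGrad Z κ) (rtEval q x) : ℝ) :=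
    continuous_const.inner (continuous_rtEval q)
  have hI1 := Continuous.integrableOn_hull hc1 κ
  have hI2 := Continuous.integrableOn_hull
    (continuous_inner_map_rtEval (Matrix.toEuclideanLin A⁻¹) q q) κ
  simp only [fderiv_affineInterp] at h1
  rw [Finset.sum_congr rfl fun σ hσ => by rw [h2 σ hσ], integral_add hI1 (hIs.const_mul _),
    integral_const_mul] at h1
  have hpt : ∀ x, (inner ℝ (Matrix.toEuclideanLin A⁻¹ (residual A Z q κ x)) (residual A Z q κ x) : ℝ)
      = inner ℝ (Matrix.toEuclideanLin A⁻¹ (rtEval q x)) (rtEval q x) +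
        inner ℝ (Matrix.toEuclideanLin A (interpGrad Z κ)) (interpGrad Z κ) +
        2 * inner ℝ (interpGrad Z κ) (rtEval q x) := fun x => by
    rw [residual, map_add, toEuclideanLin_inv_apply hA, inner_add_left, inner_add_right,
      inner_add_right, isSymmetric_toEuclideanLin_of_posDef hA.inv (rtEval q x)
        (Matrix.toEuclideanLin A _), toEuclideanLin_inv_apply hA, real_inner_comm (interpGrad Z κ) (rtEval q x),
      real_inner_comm (Matrix.toEuclideanLin A (interpGrad Z κ))]
    ring
  have hI3 : IntegrableOn (fun _ => (inner ℝ (Matrix.toEuclideanLin A (interpGrad Z κ))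
      (interpGrad Z κ) : ℝ)) (hull κ) := Continuous.integrableOn_hull continuous_const κ
  have hI4 : IntegrableOn (fun x =>
      (inner ℝ (Matrix.toEuclideanLin A⁻¹ (rtEval q x)) (rtEval q x) : ℝ) +
        inner ℝ (Matrix.toEuclideanLin A (interpGrad Z κ)) (interpGrad Z κ)) (hull κ) :=
    Integrable.add hI2 hI3
  simp only [hpt]
  rw [integral_add hI4 (hI1.const_mul 2), integral_add hI2 hI3,
    setIntegral_const,
    integral_const_mul, ← h1, smul_eq_mul, vol]
  ring

namespace PolytopalMesh

open Matrix

variable {Ω : Set (Pt d)} (M : PolytopalMesh d Ω)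

/-- Summing the simplexwise identity over the element cancels the interior fluxes, so only exterior
ones meet the face means. The divergence is the constant `load / |K|`, which matches the mass term.
-/
lemma etaSq_eq (hd : 1 ≤ d) {D : Coll d → Matrix (Fin d) (Fin d) ℝ} {f U : Coll d → ℝ}
    (P : Coll d → ℝ) {K : Coll d} (hK : K ∈ M.cells) (hD : (D K).PosDef) {n : ℕ}
    (q : Module.Basis (Fin n) ℝ (Q0 K)) {u : Spx d → RT d} (hu : M.IsAdmissible U K (f K) u)
    (hE : cellForm (toEuclideanLin (D K)⁻¹) K u u =
        M.extFlux U K ⬝ᵥ (M.matMFE (D K) K q).mulVec (M.extFlux U K)) :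
    M.etaSq D f U P K q = ∑ κ ∈ K, ∫ x in hull κ,
      inner ℝ (toEuclideanLin (D K)⁻¹ (residual (D K) (M.pointValue P) (u κ) κ x))
        (residual (D K) (M.pointValue P) (u κ) κ x) := by
  have hc := M.conforming_cell hd hK
  obtain ⟨h1, h2, h3⟩ := (M.isAdmissible_iff hd hK).1 hu
  have hflux := M.sum_sum_flux_cell hK hd h2 h3 fun σ => (d : ℝ)⁻¹ * ∑ a ∈ σ, M.pointValue P a
  have hface : M.extFlux U K ⬝ᵥ M.faceVec P K =
      ∑ σ : extFacets K, M.extFlux U K σ * ((d : ℝ)⁻¹ * ∑ a ∈ (σ : Spx d), M.pointValue P a) := rfl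
  have hpos := M.sum_vol_pos hd hK
  rw [Finset.sum_congr rfl fun κ hκ => by
    rw [integral_inner_residual hD (hc.isSimplex κ hκ), h1 κ hκ], Finset.sum_add_distrib,
    Finset.sum_add_distrib, ← Finset.mul_sum, Finset.sum_sub_distrib, ← Finset.mul_sum, hflux,
    ← hface, etaSq, ← hE, M.load_eq hd hK, M.volume_region hd hK, cellForm_apply]
  have e1 := hc.dotProduct_matStiff_mulVec (D K) (M.pointValue P)
  have e2 := hc.dotProduct_matMass_mulVec (M.pointValue P)
  have e3 : M.vertexVec P K = fun a : vertices K => M.pointValue P a := rfl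
  rw [e3, e1, e2]
  field_simp
  ring

lemma etaSq_nonneg (hd : 1 ≤ d) {D : Coll d → Matrix (Fin d) (Fin d) ℝ} {f U : Coll d → ℝ}
    (P : Coll d → ℝ) {K : Coll d} (hK : K ∈ M.cells) (hD : (D K).PosDef) {n : ℕ}
    (q : Module.Basis (Fin n) ℝ (Q0 K)) {u : Spx d → RT d} (hu : M.IsAdmissible U K (f K) u)
    (hE : cellForm (toEuclideanLin (D K)⁻¹) K u u =
        M.extFlux U K ⬝ᵥ (M.matMFE (D K) K q).mulVec (M.extFlux U K)) :
    0 ≤ M.etaSq D f U P K q := by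
  rw [M.etaSq_eq hd P hK hD q hu hE]
  refine Finset.sum_nonneg fun κ _ => integral_nonneg fun x => ?_
  simp only [Pi.zero_apply]
  by_cases h : residual (D K) (M.pointValue P) (u κ) κ x = 0
  · rw [h, map_zero, inner_zero_left]
  · exact (inner_toEuclideanLin_pos hD.inv h).le

end PolytopalMesh

/-! ### The energy error -/

namespace PolytopalMesh

open Matrix

variable {Ω : Set (Pt d)} (M : PolytopalMesh d Ω)

lemma restrict_eq (hΩ : interior (closure Ω) = Ω) :
    (volume.restrict Ω : Measure (Pt d)) = volume.restrict (region M.Th) := by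
  rw [← Measure.restrict_congr_set (interior_region_ae_eq M.Th), M.interior_region_Th hΩ]

lemma ae_pwc (hd : 1 ≤ d) (hΩ : interior (closure Ω) = Ω) {V : Type*} [AddCommMonoid V]
    (c : Coll d → V) : ∀ᵐ x ∂volume.restrict Ω, ∃ K ∈ M.cells, M.pwc c x = c K := by
  rw [M.restrict_eq hΩ]
  filter_upwards [ae_mem_interior_hull M.Th] with x ⟨κ, hκ, hx⟩
  obtain ⟨K, hK, hκK⟩ := M.exists_cell hκ
  exact ⟨K, hK, M.pwc_apply hd c hK hκK hx⟩

lemma memLp_map (hd : 1 ≤ d) (hΩ : interior (closure Ω) = Ω)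
    {A : Coll d → Matrix (Fin d) (Fin d) ℝ} {φ : Matrix (Fin d) (Fin d) ℝ → Pt d →ₗ[ℝ] Pt d}
    {v : Pt d → Pt d} (hv : MemLp v 2 (volume.restrict Ω)) :
    MemLp (fun x => φ (M.pwc A x) (v x)) 2 (volume.restrict Ω) := by
  have hc := M.conforming hd
  have h1 : pw M.Th (fun κ x => φ (A (M.TH.part κ)) (v x)) =ᵐ[volume.restrict Ω]
      fun x => φ (M.pwc A x) (v x) := by
    rw [M.restrict_eq hΩ]
    filter_upwards [ae_mem_interior_hull M.Th] with x ⟨κ, hκ, hx⟩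
    obtain ⟨K, hK, hκK⟩ := M.exists_cell hκ
    rw [hc.pw_apply hκ _ hx, M.pwc_apply hd A hK hκK hx, M.TH.part_eq_of_mem hK hκK]
  refine MemLp.ae_eq h1 ?_
  unfold pw
  exact memLp_finsetSum _ fun κ _ => MemLp.indicator isOpen_interior.measurableSet
    ((φ (A (M.TH.part κ))).toContinuousLinearMap.comp_memLp' hv)

/-- Among the fields of the form `w + D ∇s` with `s ∈ H¹₀(Ω)`, where `w` is in equilibrium with the
load, the error `u - w` has the smallest energy. -/
lemma energySq_sub_le (hd : 1 ≤ d) (hΩ : interior (closure Ω) = Ω)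
    {D : Coll d → Matrix (Fin d) (Fin d) ℝ} (hD : ∀ K ∈ M.cells, (D K).PosDef) {f : Coll d → ℝ}
    {p : Pt d → ℝ} {g : Pt d → Pt d} (hp : M.IsWeakSolution D f p g) {w : Pt d → Pt d}
    (hw : HasWeakDiv Ω w (M.pwc f)) {s : Pt d → ℝ} {gs : Pt d → Pt d} (hs : MemH10 Ω s gs) :
    energySq Ω (M.pwc D) (fun x => M.darcyFlux D g x - w x) ≤
      energySq Ω (M.pwc D) (fun x => w x + toEuclideanLin (M.pwc D x) (gs x)) := by
  have hS : ∀ {v : Pt d → Pt d}, MemLp v 2 (volume.restrict Ω) →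
      MemLp (fun x => toEuclideanLin (M.pwc D x) (v x)) 2 (volume.restrict Ω) := fun hv =>
    M.memLp_map hd hΩ (φ := fun A => toEuclideanLin A) hv
  have hT : ∀ {v : Pt d → Pt d}, MemLp v 2 (volume.restrict Ω) →
      MemLp (fun x => toEuclideanLin (M.pwc D x)⁻¹ (v x)) 2 (volume.restrict Ω) := fun hv =>
    M.memLp_map hd hΩ (φ := fun A => toEuclideanLin A⁻¹) hv
  have hg2 := hp.1.1.2.1
  have hgs2 := hs.1.2.1
  have he2 : MemLp (fun x => M.darcyFlux D g x - w x) 2 (volume.restrict Ω) :=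
    (hS hg2).neg.sub hw.1
  have hr2 : MemLp (fun x => w x + toEuclideanLin (M.pwc D x) (gs x)) 2 (volume.restrict Ω) :=
    hw.1.add (hS hgs2)
  -- Orthogonality: the weak equation for `p` and the weak divergence of `w` are each tested with
  -- both `p` and `s`, and the loads cancel.
  have hcross : ∫ x in Ω, (inner ℝ (gs x - g x) (M.darcyFlux D g x - w x) : ℝ) = 0 := by
    have i1 := integrable_inner_of_memLp (hS hg2) hgs2
    have i2 := integrable_inner_of_memLp (hS hg2) hg2
    have i3 := integrable_inner_of_memLp hw.1 hgs2
    have i4 := integrable_inner_of_memLp hw.1 hg2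
    have hpt : ∀ x, (inner ℝ (gs x - g x) (M.darcyFlux D g x - w x) : ℝ) =
        inner ℝ (toEuclideanLin (M.pwc D x) (g x)) (g x) -
          inner ℝ (toEuclideanLin (M.pwc D x) (g x)) (gs x) +
          (inner ℝ (w x) (g x) - inner ℝ (w x) (gs x)) := fun x => by
      rw [real_inner_comm, darcyFlux, inner_sub_left, inner_neg_left, inner_sub_right,
        inner_sub_right]
      ring
    have j1 : Integrable (fun x => (inner ℝ (toEuclideanLin (M.pwc D x) (g x)) (g x) : ℝ) -
        inner ℝ (toEuclideanLin (M.pwc D x) (g x)) (gs x)) (volume.restrict Ω) := i2.sub i1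
    have j2 : Integrable (fun x => (inner ℝ (w x) (g x) : ℝ) - inner ℝ (w x) (gs x))
        (volume.restrict Ω) := i4.sub i3
    simp only [hpt]
    rw [integral_add j1 j2, integral_sub i2 i1, integral_sub i4 i3,
      hp.2 _ _ hp.1, hp.2 _ _ hs, hw.integral_inner_eq hp.1, hw.integral_inner_eq hs]
    ring
  rw [energySq, energySq, ← sub_nonneg,
    ← integral_sub (integrable_inner_of_memLp (hT hr2) hr2) (integrable_inner_of_memLp (hT he2) he2)]
  calc (0 : ℝ) = ∫ x in Ω, -(2 * inner ℝ (gs x - g x) (M.darcyFlux D g x - w x)) := by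
        rw [integral_neg, integral_const_mul, hcross, mul_zero, neg_zero]
    _ ≤ _ := by
      refine integral_mono_ae
        (((integrable_inner_of_memLp (hgs2.sub hg2) he2).const_mul 2).neg)
        ((integrable_inner_of_memLp (hT hr2) hr2).sub (integrable_inner_of_memLp (hT he2) he2)) ?_
      filter_upwards [M.ae_pwc hd hΩ D] with x ⟨K, hK, hx⟩
      have hDx : (M.pwc D x).PosDef := hx ▸ hD K hK
      set A := M.pwc D x
      set e := M.darcyFlux D g x - w x with he
      -- The pointwise form of the decomposition. Dropping the nonnegative square of `gs x - g x`
      -- leaves the claimed inequality plus the cross term.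
      have hr : w x + toEuclideanLin A (gs x) = toEuclideanLin A (gs x - g x) - e := by
        rw [he, darcyFlux, map_sub]; abel
      have hnn : 0 ≤ (inner ℝ (gs x - g x) (toEuclideanLin A (gs x - g x)) : ℝ) := by
        by_cases h : gs x - g x = 0
        · rw [h, inner_zero_left]
        · rw [real_inner_comm]; exact (inner_toEuclideanLin_pos hDx h).le
      have hsym : (inner ℝ (toEuclideanLin A⁻¹ e) (toEuclideanLin A (gs x - g x)) : ℝ) =
          inner ℝ (gs x - g x) e := by
        rw [isSymmetric_toEuclideanLin_of_posDef hDx.inv, toEuclideanLin_inv_apply hDx,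
          real_inner_comm]
      change -(2 * inner ℝ (gs x - g x) e) ≤ (inner ℝ (toEuclideanLin A⁻¹
        (w x + toEuclideanLin A (gs x))) (w x + toEuclideanLin A (gs x)) : ℝ) -
          inner ℝ (toEuclideanLin A⁻¹ e) e
      rw [hr]
      clear_value e
      clear hr
      generalize gs x - g x = y at hnn hsym ⊢
      rw [map_sub, toEuclideanLin_inv_apply hDx, inner_sub_left, inner_sub_right,
        inner_sub_right, hsym]
      linarith

lemma energySq_residual (hd : 1 ≤ d) (hΩ : interior (closure Ω) = Ω)
    {D : Coll d → Matrix (Fin d) (Fin d) ℝ} {u : Spx d → RT d} {Z : Pt d → ℝ}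
    (hg : IsFitting M.Th (affineInterp Z)) :
    energySq Ω (M.pwc D) (fun x => rtField M.Th u x +
        toEuclideanLin (M.pwc D x) (gradient (glue M.Th (affineInterp Z)) x)) =
      ∑ K ∈ M.cells, ∑ κ ∈ K, ∫ x in hull κ,
        inner ℝ (toEuclideanLin (D K)⁻¹ (residual (D K) Z (u κ) κ x))
          (residual (D K) Z (u κ) κ x) := by
  have hc := M.conforming hd
  rw [energySq, M.restrict_eq hΩ, hc.setIntegral_region
    (G := fun κ x => inner ℝ (toEuclideanLin (D (M.TH.part κ))⁻¹
      (residual (D (M.TH.part κ)) Z (u κ) κ x)) (residual (D (M.TH.part κ)) Z (u κ) κ x))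
    (fun κ _ => Continuous.integrableOn_hull (continuous_inner_residual _ _ _ _ _) κ)
    fun κ hκ x hx => ?_, M.sum_cells]
  · exact Finset.sum_congr rfl fun K hK => Finset.sum_congr rfl fun κ hκ => by
      rw [M.TH.part_eq_of_mem hK hκ]
  · obtain ⟨K, hK, hκK⟩ := M.exists_cell hκ
    rw [M.pwc_apply hd D hK hκK hx, M.TH.part_eq_of_mem hK hκK, hg.gradient_glue hκ hx,
      gradient_affineInterp, rtField, hc.pw_apply hκ _ hx, residual]

end PolytopalMesh

end PolytopalDarcy

end

theorem mainTheorem3 (d : ℕ) (hd : 1 ≤ d) (Ω : Set (PolytopalDarcy.Pt d))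
    (hΩ : interior (closure Ω) = Ω)
    (M : PolytopalDarcy.PolytopalMesh d Ω)
    (D : PolytopalDarcy.Coll d → Matrix (Fin d) (Fin d) ℝ)
    (hD : ∀ K ∈ M.cells, (D K).PosDef)
    (f : PolytopalDarcy.Coll d → ℝ)
    (p : PolytopalDarcy.Pt d → ℝ) (g : PolytopalDarcy.Pt d → PolytopalDarcy.Pt d)
    (hp : M.IsWeakSolution D f p g)
    (U P : PolytopalDarcy.Coll d → ℝ) (hU : M.FluxBalance f U)
    (n : PolytopalDarcy.Coll d → ℕ)
    (q : ∀ K : PolytopalDarcy.Coll d,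
      Module.Basis (Fin (n K)) ℝ (PolytopalDarcy.Q0 K)) :
    (∀ K ∈ M.cells, IsUnit (M.saddle (D K) K (q K)) ∧ 0 ≤ M.etaSq D f U P K (q K)) ∧
    ∃ uh : PolytopalDarcy.Spx d → PolytopalDarcy.RT d,
      M.IsFluxReconstruction D f U uh ∧
      (∀ uh' : PolytopalDarcy.Spx d → PolytopalDarcy.RT d,
        M.IsFluxReconstruction D f U uh' → ∀ κ ∈ M.Th, uh' κ = uh κ) ∧
      PolytopalDarcy.HasWeakDiv Ω (PolytopalDarcy.rtField M.Th uh) (M.pwc f) ∧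
      PolytopalDarcy.PolytopalMesh.energyNorm Ω (M.pwc D)
          (fun x => M.darcyFlux D g x - PolytopalDarcy.rtField M.Th uh x) ≤
        Real.sqrt (∑ K ∈ M.cells, M.etaSq D f U P K (q K)) := by
  have hadm := M.exists_reconstruction hd hD hU q
  obtain ⟨uh, huh⟩ := hadm
  have hcell : ∀ K ∈ M.cells, ∀ v : PolytopalDarcy.Spx d → PolytopalDarcy.RT d,
      PolytopalDarcy.PolytopalMesh.energySq (PolytopalDarcy.region K) (fun _ => D K)
        (PolytopalDarcy.rtField K v) =
      PolytopalDarcy.cellForm (Matrix.toEuclideanLin (D K)⁻¹) K v v := fun K hK v =>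
    (M.conforming_cell hd hK).integral_region_rtField _ v v
  have hdiv := M.hasWeakDiv_of_isAdmissible hd hΩ fun K hK => (huh K hK).1
  obtain ⟨hfit, hH10⟩ := M.memH10_glue_pointValue hd hΩ P
  refine ⟨fun K hK => ⟨M.isUnit_saddle hK hd (hD K hK) (q K),
    M.etaSq_nonneg hd P hK (hD K hK) (q K) (huh K hK).1 (huh K hK).2.1⟩, uh, fun K hK => ?_,
    fun uh' huh' κ hκ => ?_, hdiv, ?_⟩
  · refine ⟨(huh K hK).1, fun v hv => ?_⟩
    rw [hcell K hK, hcell K hK]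
    exact ((huh K hK).2.2 v hv).1
  · obtain ⟨K, hK, hκK⟩ := M.exists_cell hκ
    obtain ⟨h1, h2⟩ := huh' K hK
    refine ((huh K hK).2.2 uh' h1).2 ?_ κ hκK
    rw [← hcell K hK, ← hcell K hK]
    exact h2 uh (huh K hK).1
  -- The comparison function is the interpolant of the point values; its residual energy is the sum
  -- of the estimators.
  · refine Real.sqrt_le_sqrt ((M.energySq_sub_le hd hΩ hD hp hdiv hH10).trans_eq ?_)
    rw [M.energySq_residual hd hΩ hfit]
    exact Finset.sum_congr rfl fun K hK =>
      (M.etaSq_eq hd P hK (hD K hK) (q K) (huh K hK).1 (huh K hK).2.1).symm
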